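/- **Setting.** Let $\Phi^t$, $t\in\mathbb R$, be a continuous flow on a metric space $M$ with invariant Borel probability measure $\mu$ that is not a Dirac measure. Let $\Delta t>0$ be such that $\Phi^{\Delta t}$ is ergodic for $\mu$. Let $h:M\to\mathbb R$ be continuous, and let $F:M\to Y$ be a continuous injective map into a metric space. Let $x_n=\Phi^{n\Delta t}(x_0)$, $\mu_N=\frac1N\sum_{n<N}\delta_{x_n}$, and assume that $\mu_N\to\mu$ weakly and that all $x_n$ lie in a compact set $\mathcal X\subseteq M$ with $\mu(\mathcal X)=1$ (so $h$ is bounded on $\mathcal X$). A kernel is a continuous, symmetric, positive-semidefinite function. It is $L^2(\nu)$-strictly positive if all eigenvalues of $G_\nu f=\int k(\cdot,y)f(y)\,d\nu(y)$ on $L^2(\nu)$ are positive, Markov if $G_\nu$ preserves positivity and constants, and ergodic if moreover the eigenvalue $1$ is simple. For $N\ge1$ let $p_N(x,x')=\tilde p_N(F(x),F(x'))$, with $\tilde p_N$ a kernel on $Y$, be $L^2(\mu_N)$-strictly positive, Markov and ergodic, and let $p_N\to p$ uniformly on $\mathcal X\times\mathcal X$, where $p$ is a kernel on $\mathcal X$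 that is $L^2(\mu)$-strictly positive, Markov and ergodic. Let $(\phi_{j,N})_{0\le j<N}$ and $(\phi_j)_{j\ge0}$ be orthonormal bases of $L^2(\mu_N)$ and $L^2(\mu)$ consisting of eigenfunctions of the integral operators of $p_N$ and $p$, with eigenvalues $\lambda_{j,N}$ and $\lambda_j$ in non-increasing order. Their continuous representatives are $\varphi_{j,N}=\lambda_{j,N}^{-1}\int p_N(\cdot,y)\phi_{j,N}(y)\,d\mu_N(y)$ and, likewise, $\varphi_j$. **Partitions.** For $\nu\in\{\mu,\mu_N\}$ and $S\ge1$ let $\xi_k=\inf\{a:\nu(h\le a)\ge k/S\}$, $0<k<S$, be the boundary points of the quantile partition of $\mathbb R$ into $\Xi_i=[\xi_i,\xi_{i+1})$, $0\le i<S$ (with $\xi_0=-\infty$, $\xi_S=+\infty$). Let $M_i=h^{-1}(\Xi_i)$, let $\pi_h(a)$ be the index $i$ with $a\in\Xi_i$, let $\bar a_i$ be the mean of $h$ over $M_i$ with respect to $\nu$, and let $\bar h=\sum_i\bar a_i1_{M_i}$. For $\nu=\mu_N$ these objects carry the index $N$. Assume $\mu(h=\xi_k)=0$ for all boundary points $\xi_k$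 of the partition for $\mu$. **Schemes.** Let $U^{q}f=f\circ\Phi^{q\Delta t}$ on $L^2(\mu)$. On $L^2(\mu_N)$ let $U^{(q)}_N$ be the shift, $(U^{(q)}_Nf)(x_n)=f(x_{n+q})$ for $n<N-q$ and $0$ for $N-q\le n<N$. Let $E_i$ be the spectral projector of multiplication by $\bar h$ at the value $\bar a_i$, i.e. multiplication by $1_{\{\bar h=\bar a_i\}}$. For a spectral resolution $L\ge1$ let $\Pi_L$ be the orthogonal projection onto the span of the first $L$ basis vectors, and let $U^q_L=\Pi_LU^q\Pi_L$ and $E_{i,L}=\Pi_LE_i\Pi_L$. On $L^2(\mu_N)$ define $\Pi_{L,N}$, $U^{(q)}_{L,N}$ and $E_{i,L,N}$ in the same way. A measurement record prescribes at which sampling times $t_m=m\Delta t$ a measurement of $h$ is made, and its real value. The scheme starts from the stationary state ($\bar\rho=\langle1,\cdot\rangle1$, respectively $\bar\rho_N=\langle\phi_{0,N},\cdot\rangle\phi_{0,N}$). If $\rho$ is the state just after the last measurement before $t_j$ (or the initial state if there is none), and $q$ is the number of sampling intervals elapsed since then, the state at $t_j$ is $\hat\rho_{t_j}=U_L^{q*}\rho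 U^q_L/\operatorname{tr}(U_L^{q*}\rho U^q_L)$, and $\hat P_i(t_j)=\operatorname{tr}(E_{i,L}\hat\rho_{t_j})$. A measurement of the value $a$ replaces the state $\rho^-$ by $E_{i,L}\rho^-E_{i,L}/\operatorname{tr}(E_{i,L}\rho^-E_{i,L})$, $i=\pi_h(a)$. The data-driven scheme, with probabilities $\hat P_{i,N}(t_j)$, is the same with all objects replaced by those for $\mu_N$. **Theorem.** As $N\to\infty$, the partitions $\Xi_N$ converge to $\Xi$, i.e. $\xi_{k,N}\to\xi_k$ for $0<k<S$. Furthermore, let $L\ge1$ be any spectral resolution such that the first $L$ eigenvalues do not split an eigenspace, $\lambda_L<\lambda_{L-1}$, or, if they do, such that the eigenfunctions used satisfy $\varphi_{l,N}\to\varphi_l$ uniformly on $\mathcal X$ for all $l<L$. Then for every $j\in\mathbb N_0$ and every measurement record such that no value measured before $t_j$ is a boundary point $\xi_k$ and all normalizing traces that enter $\hat\rho_{t_j}$ in the infinite-data scheme are nonzero, $$\lim_{N\to\infty}\hat P_{i,N}(t_j)=\hat P_i(t_j),\qquad 0\le i<S.$$ The condition on the measured values holds almost surely: for $\mu$-almost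 every $z\in M$, none of the values $h(\Phi^{m\Delta t}(z))$, $m\in\mathbb N_0$, is a boundary point $\xi_k$. -/

import Mathlib

open MeasureTheory Filter Topology
open scoped ENNReal InnerProductSpace

namespace QMDA

noncomputable section

/-! ### Quantile partitions and quantized observables -/

section Quantile

variable {M : Type*} [MeasurableSpace M]

/-- Cumulative distribution function of `h` under `ν`: `a ↦ ν {h ≤ a}`. -/
def cdfOf (ν : Measure M) (h : M → ℝ) (a : ℝ) : ℝ := ν.real {x | h x ≤ a}

/-- Quantile function `s ↦ inf {a | s ≤ CDF a}`, for `s ∈ (0, 1)`. -/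
def quantile (ν : Measure M) (h : M → ℝ) (s : ℝ) : ℝ := sInf {a : ℝ | s ≤ cdfOf ν h a}

/-- The `k`-th boundary point (`0 < k < S`) of the `S`-element quantile partition of the line:
the quantile function at `k / S`. -/
def bdry (S : ℕ) (ν : Measure M) (h : M → ℝ) (k : ℕ) : ℝ := quantile ν h ((k : ℝ) / (S : ℝ))

/-- The `i`-th element (`i < S`) of the quantile partition: the interval from the `i`-th boundary
point (included) to the `(i+1)`-st one (excluded); the first interval is unbounded below and the
last one is unbounded above. -/
def bin (S : ℕ) (ν : Measure M) (h : M → ℝ) (i : ℕ) : Set ℝ :=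
  {a | (0 < i → bdry S ν h i ≤ a) ∧ (i + 1 < S → a < bdry S ν h (i + 1))}

/-- The affiliation function of the quantile partition: `a` is sent to the index of the
partition element that contains it. -/
def affil (S : ℕ) (ν : Measure M) (h : M → ℝ) (a : ℝ) : ℕ :=
  sInf {i | i < S ∧ a ∈ bin S ν h i}

theorem measurableSet_bin (S : ℕ) (ν : Measure M) (h : M → ℝ) (i : ℕ) :
    MeasurableSet (bin S ν h i) := by
  have h1 : MeasurableSet {a : ℝ | 0 < i → bdry S ν h i ≤ a} := by
    by_cases hi : 0 < i
    · simp only [hi, forall_const]; exact measurableSet_Ici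
    · simp [hi]
  have h2 : MeasurableSet {a : ℝ | i + 1 < S → a < bdry S ν h (i + 1)} := by
    by_cases hi : i + 1 < S
    · simp only [hi, forall_const]; exact measurableSet_Iio
    · simp [hi]
  exact h1.inter h2

/-- The mean value of `h` on the `i`-th partition element of state space, `h ⁻¹' bin i`. -/
def binMean (S : ℕ) (ν : Measure M) (h : M → ℝ) (i : ℕ) : ℝ :=
  ⨍ x in h ⁻¹' bin S ν h i, h x ∂ν

/-- The quantized observable: the conditional expectation of `h` given its affiliation. -/
def quantized (S : ℕ) (ν : Measure M) (h : M → ℝ) (x : M) : ℝ :=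
  ∑ i ∈ Finset.range S, (h ⁻¹' bin S ν h i).indicator (fun _ => binMean S ν h i) x

theorem measurable_quantized (S : ℕ) (ν : Measure M) {h : M → ℝ} (hh : Measurable h) :
    Measurable (quantized S ν h) := by
  unfold quantized
  exact Finset.measurable_sum _ fun i _ =>
    measurable_const.indicator (hh (measurableSet_bin S ν h i))

end Quantile

/-! ### Kernels and their integral operators -/

section Kernels

/-- A kernel on a set `A`: continuous, symmetric and positive-semidefinite on `A × A`. -/
def IsKernelOn {Z : Type*} [TopologicalSpace Z] (A : Set Z) (k : Z → Z → ℝ) : Prop :=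
  ContinuousOn (Function.uncurry k) (A ×ˢ A) ∧
  (∀ x ∈ A, ∀ y ∈ A, k x y = k y x) ∧
  ∀ (n : ℕ) (x : Fin n → Z), (∀ i, x i ∈ A) →
    (Matrix.of fun i j => k (x i) (x j)).PosSemidef

variable {M : Type*} [MeasurableSpace M]

/-- The kernel integral operator `f ↦ ∫ k(·, y) f(y) dν(y)`. -/
def kernelInt (k : M → M → ℝ) (ν : Measure M) (f : M → ℂ) (x : M) : ℂ :=
  ∫ y, (k x y : ℂ) * f y ∂ν

/-- `f ∈ L²(ν)` satisfies `G f = c f` for the integral operator `G` of `k` on `L²(ν)`. -/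
def IsEigen (k : M → M → ℝ) (ν : Measure M) (c : ℝ) (f : Lp ℂ 2 ν) : Prop :=
  ∀ᵐ x ∂ν, kernelInt k ν f x = (c : ℂ) * f x

/-- All eigenvalues of the integral operator on `L²(ν)` are strictly positive. -/
def KernelStrictlyPositive (k : M → M → ℝ) (ν : Measure M) : Prop :=
  ∀ (c : ℝ) (f : Lp ℂ 2 ν), f ≠ 0 → IsEigen k ν c f → 0 < c

/-- The integral operator on `L²(ν)` preserves positivity and constants. -/
def KernelMarkov (k : M → M → ℝ) (ν : Measure M) : Prop :=
  (∀ f : Lp ℝ 2 ν, 0 ≤ᵐ[ν] f → ∀ᵐ x ∂ν, 0 ≤ ∫ y, k x y * f y ∂ν) ∧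
  ∀ᵐ x ∂ν, ∫ y, k x y ∂ν = 1

/-- The eigenvalue `1` of the integral operator is simple: its eigenfunctions are constant. -/
def KernelErgodic (k : M → M → ℝ) (ν : Measure M) : Prop :=
  ∀ f : Lp ℂ 2 ν, IsEigen k ν 1 f → ∃ c : ℂ, f =ᵐ[ν] fun _ => c

/-- `b` is an orthonormal basis of `L²(ν)` consisting of eigenfunctions of the integral operator
of `k`, with eigenvalues `lam` (repeated according to multiplicity) in non-increasing order. -/
def IsEigenbasis {ι : Type*} [Preorder ι] (k : M → M → ℝ) (ν : Measure M)
    (b : HilbertBasis ι ℂ (Lp ℂ 2 ν)) (lam : ι → ℝ) : Prop :=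
  (∀ j, IsEigen k ν (lam j) (b j)) ∧ Antitone lam

/-- The continuous representative `c⁻¹ ∫ k(·, y) f(y) dν(y)` of an eigenfunction `f` with nonzero
eigenvalue `c`. -/
def contRep (k : M → M → ℝ) (ν : Measure M) (c : ℝ) (f : Lp ℂ 2 ν) (x : M) : ℂ :=
  (c : ℂ)⁻¹ * kernelInt k ν f x

end Kernels

/-! ### Operators on `L²` -/

section Operators

variable {M : Type*} [MeasurableSpace M]

/-- The multiplication operator `f ↦ 1_A f` on `L²(ν)`. -/
def indicatorOp (ν : Measure M) [IsFiniteMeasure ν] {A : Set M} (hA : MeasurableSet A) :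
    Lp ℂ 2 ν →L[ℂ] Lp ℂ 2 ν :=
  (ContinuousLinearMap.mul ℂ ℂ).holderL ν ∞ 2 2
    (indicatorConstLp ∞ hA (measure_ne_top ν A) (1 : ℂ))

/-- The spectral measure of the operator of multiplication by `g` on `L²(ν)`: a Borel set `Ω`
is sent to multiplication by the indicator of `g ⁻¹' Ω`. -/
def specProj (ν : Measure M) [IsFiniteMeasure ν] {g : M → ℝ} (hg : Measurable g) {Ω : Set ℝ}
    (hΩ : MeasurableSet Ω) : Lp ℂ 2 ν →L[ℂ] Lp ℂ 2 ν :=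
  indicatorOp ν (hg hΩ)

/-- The spectral projector of multiplication by the quantized observable at its `i`-th value. -/
def binProj (S : ℕ) (ν : Measure M) [IsFiniteMeasure ν] {h : M → ℝ} (hh : Measurable h)
    (i : ℕ) : Lp ℂ 2 ν →L[ℂ] Lp ℂ 2 ν :=
  specProj ν (measurable_quantized S ν hh) (measurableSet_singleton (binMean S ν h i))

/-- The Koopman operator `f ↦ f ∘ T` on `L²(μ)` of a measure-preserving map `T`. -/
def koopman {μ : Measure M} {T : M → M} (hT : MeasurePreserving T μ μ) :
    Lp ℂ 2 μ →L[ℂ] Lp ℂ 2 μ :=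
  (Lp.compMeasurePreservingₗᵢ ℂ T hT).toContinuousLinearMap

/-- The sampling measure `(1/N) ∑_{n < N} δ_{x n}`. -/
def samplingMeasure (x : ℕ → M) (N : ℕ) : Measure M :=
  (N : ℝ≥0∞)⁻¹ • ∑ n ∈ Finset.range N, Measure.dirac (x n)

instance isFiniteMeasure_samplingMeasure (x : ℕ → M) (N : ℕ) :
    IsFiniteMeasure (samplingMeasure x N) := by
  rcases Nat.eq_zero_or_pos N with rfl | hN
  · simp only [samplingMeasure, Finset.range_zero, Finset.sum_empty, smul_zero]
    infer_instance
  · have : (N : ℝ≥0∞)⁻¹ ≠ ∞ := by simp [hN.ne']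
    exact Measure.smul_finite _ this

/-- The indicator function of the point `x n`, as an element of `L²` of the sampling measure. -/
def pointInd [MeasurableSingletonClass M] (x : ℕ → M) (N n : ℕ) :
    Lp ℂ 2 (samplingMeasure x N) :=
  indicatorConstLp 2 (measurableSet_singleton (x n)) (measure_ne_top _ _) (1 : ℂ)

/-- The `q`-step shift operator on `L²` of the sampling measure:
`(U f)(x n) = f(x (n + q))` for `n < N - q` and `(U f)(x n) = 0` for `N - q ≤ n < N`
(see `shiftOp_apply_of_lt` and `shiftOp_apply_of_le`). -/
def shiftOp [MeasurableSingletonClass M] (x : ℕ → M) (N q : ℕ) :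
    Lp ℂ 2 (samplingMeasure x N) →L[ℂ] Lp ℂ 2 (samplingMeasure x N) :=
  ∑ n ∈ Finset.range (N - q),
    (N : ℂ) • InnerProductSpace.rankOne ℂ (pointInd x N n) (pointInd x N (n + q))

end Operators

/-! ### The truncated data assimilation scheme -/

section Scheme

variable {H : Type*} [NormedAddCommGroup H] [InnerProductSpace ℂ H] [CompleteSpace H]
  {ι : Type*}

/-- The input data of a truncated scheme on a Hilbert space `H`. -/
structure Scheme (H : Type*) [NormedAddCommGroup H] [InnerProductSpace ℂ H] (ι : Type*) where
  /-- orthonormal basis -/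
  basis : HilbertBasis ι ℂ H
  /-- the indices of the basis vectors that are retained -/
  retained : Finset ι
  /-- the evolution operator over `q` sampling intervals -/
  evol : ℕ → H →L[ℂ] H
  /-- the spectral projectors of the quantized observable -/
  proj : ℕ → H →L[ℂ] H
  /-- the affiliation function -/
  aff : ℝ → ℕ
  /-- the initial state -/
  init : H →L[ℂ] H

namespace Scheme

variable (Q : Scheme H ι)

/-- The trace (of a finite-rank operator), computed in the orthonormal basis. -/
def tr (A : H →L[ℂ] H) : ℂ := ∑' j, ⟪Q.basis j, A (Q.basis j)⟫_ℂ

/-- The orthogonal projection onto the span of the retained basis vectors. -/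
def trunc : H →L[ℂ] H :=
  ∑ j ∈ Q.retained, InnerProductSpace.rankOne ℂ (Q.basis j) (Q.basis j)

/-- The compression `Π A Π` of an operator. -/
def compress (A : H →L[ℂ] H) : H →L[ℂ] H := Q.trunc ∘L A ∘L Q.trunc

/-- Division of an operator by its trace. -/
def normalize (A : H →L[ℂ] H) : H →L[ℂ] H := (Q.tr A)⁻¹ • A

/-- The evolved operator `U* ρ U` over `q` sampling intervals, with `U` the compressed evolution
operator, before normalization. -/
def evolved (q : ℕ) (ρ : H →L[ℂ] H) : H →L[ℂ] H :=
  ContinuousLinearMap.adjoint (Q.compress (Q.evol q)) ∘L ρ ∘L Q.compress (Q.evol q)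

/-- The operator `E ρ E` after a measurement with outcome in the `i`-th partition element, with
`E` the compressed spectral projector, before normalization. -/
def updated (i : ℕ) (ρ : H →L[ℂ] H) : H →L[ℂ] H :=
  Q.compress (Q.proj i) ∘L ρ ∘L Q.compress (Q.proj i)

/-- For a measurement record `y` (`y m = some a` if a measurement is made at the `m`-th sampling
time, with value `a`, and `y m = none` otherwise), the state immediately after the last
measurement that precedes the `m`-th sampling time (the initial state if there is none), with
the number of sampling intervals elapsed since then. -/
def anchor (y : ℕ → Option ℝ) : ℕ → (H →L[ℂ] H) × ℕ
  | 0 => (Q.init, 0)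
  | m + 1 =>
    match y m with
    | none => ((anchor y m).1, (anchor y m).2 + 1)
    | some a =>
      (Q.normalize (Q.updated (Q.aff a)
        (Q.normalize (Q.evolved (anchor y m).2 (anchor y m).1))), 1)

/-- The state at the `m`-th sampling time, before any measurement made at that time. -/
def state (y : ℕ → Option ℝ) (m : ℕ) : H →L[ℂ] H :=
  Q.normalize (Q.evolved (Q.anchor y m).2 (Q.anchor y m).1)

/-- The probability, at the `m`-th sampling time, that the observable lies in the `i`-th element
of the partition. -/
def prob (y : ℕ → Option ℝ) (m i : ℕ) : ℝ :=
  (Q.tr (Q.compress (Q.proj i) ∘L Q.state y m)).re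

/-- All normalizing traces that enter the state `anchor y m` are nonzero. -/
def AnchorDefined (y : ℕ → Option ℝ) : ℕ → Prop
  | 0 => True
  | m + 1 =>
    match y m with
    | none => AnchorDefined y m
    | some a => AnchorDefined y m ∧
        Q.tr (Q.evolved (Q.anchor y m).2 (Q.anchor y m).1) ≠ 0 ∧
        Q.tr (Q.updated (Q.aff a) (Q.state y m)) ≠ 0

/-- All normalizing traces that enter the state at the `m`-th sampling time are nonzero, so that
the state is well defined. -/
def StateDefined (y : ℕ → Option ℝ) (m : ℕ) : Prop :=
  Q.AnchorDefined y m ∧ Q.tr (Q.evolved (Q.anchor y m).2 (Q.anchor y m).1) ≠ 0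

end Scheme

end Scheme

section Instances

variable {M : Type*} [MetricSpace M] [MeasurableSpace M] [BorelSpace M]

/-- The trajectory `x n = Φ^{n Δt}(x₀)` sampled at the interval `Δt`. -/
def orbit (Φ : Flow ℝ M) (Δt : ℝ) (x₀ : M) (n : ℕ) : M := Φ ((n : ℝ) * Δt) x₀

/-- `x₀` lies in the basin of `μ`: the sampling measures along its trajectory converge weakly
to `μ`. -/
def InBasin (Φ : Flow ℝ M) (Δt : ℝ) (μ : Measure M) (x₀ : M) : Prop :=
  ∀ f : BoundedContinuousFunction M ℂ,
    Tendsto (fun N => ∫ x, f x ∂(samplingMeasure (orbit Φ Δt x₀) N)) atTop (𝓝 (∫ x, f x ∂μ))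

/-- The infinite-data scheme on `L²(μ)` with spectral resolution `L`, in the basis `b`, started
from the stationary state `⟨1, ·⟩ 1`. -/
def trueScheme (Φ : Flow ℝ M) (Δt : ℝ) (μ : Measure M) [IsFiniteMeasure μ]
    (hinv : ∀ t : ℝ, MeasurePreserving (Φ t) μ μ) {h : M → ℝ} (hh : Measurable h)
    (S L : ℕ) (b : HilbertBasis ℕ ℂ (Lp ℂ 2 μ)) : Scheme (Lp ℂ 2 μ) ℕ where
  basis := b
  retained := Finset.range L
  evol q := koopman (hinv ((q : ℝ) * Δt))
  proj := binProj S μ hh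
  aff := affil S μ h
  init := InnerProductSpace.rankOne ℂ (Lp.const 2 μ (1 : ℂ)) (Lp.const 2 μ (1 : ℂ))

/-- The data-driven scheme on `L²(μ_N)`, for the sampling measure `μ_N` of `N` points `x n`, with
spectral resolution `L`, in the basis `b`, started from the stationary state
`⟨b 0, ·⟩ b 0`. -/
def dataScheme (x : ℕ → M) (N : ℕ) {h : M → ℝ} (hh : Measurable h) (S L : ℕ)
    (b : HilbertBasis (Fin N) ℂ (Lp ℂ 2 (samplingMeasure x N))) :
    Scheme (Lp ℂ 2 (samplingMeasure x N)) (Fin N) where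
  basis := b
  retained := Finset.univ.filter fun j => (j : ℕ) < L
  evol := shiftOp x N
  proj := binProj S (samplingMeasure x N) hh
  aff := affil S (samplingMeasure x N) h
  init := if hN : 0 < N then InnerProductSpace.rankOne ℂ (b ⟨0, hN⟩) (b ⟨0, hN⟩) else 0

end Instances

/-! ### The shift operator acts as described -/

section ShiftFacts

variable {M : Type*} [MeasurableSpace M] [MeasurableSingletonClass M]

theorem samplingMeasure_singleton_ne_zero (x : ℕ → M) {N n : ℕ} (hn : n < N) :
    samplingMeasure x N {x n} ≠ 0 := by
  have h1 : Measure.dirac (x n) {x n} ≤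
      (∑ m ∈ Finset.range N, Measure.dirac (x m)) {x n} := by
    rw [Measure.finsetSum_apply]
    exact Finset.single_le_sum (f := fun m => Measure.dirac (x m) {x n})
      (fun _ _ => zero_le) (Finset.mem_range.2 hn)
  simp only [samplingMeasure, Measure.smul_apply, smul_eq_mul]
  refine mul_ne_zero (by simp) (ne_of_gt (lt_of_lt_of_le ?_ h1))
  simp

theorem coe_eq_of_ae {x : ℕ → M} {N n : ℕ} (hn : n < N) {f g : M → ℂ}
    (h : f =ᵐ[samplingMeasure x N] g) : f (x n) = g (x n) := by
  by_contra hne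
  refine samplingMeasure_singleton_ne_zero x hn (measure_mono_null ?_ h)
  rintro _ rfl
  exact hne

theorem samplingMeasure_singleton {x : ℕ → M} {N n : ℕ} (hn : n < N)
    (hx : Set.InjOn x (Set.Iio N)) : (samplingMeasure x N).real {x n} = (N : ℝ)⁻¹ := by
  have h1 : (∑ m ∈ Finset.range N, Measure.dirac (x m)) {x n} = 1 := by
    rw [Measure.finsetSum_apply, Finset.sum_eq_single n]
    · simp
    · intro m hm hmn
      have : x m ≠ x n := fun e => hmn (hx (Finset.mem_range.1 hm) hn e)
      simp [this]
    · intro h; exact absurd (Finset.mem_range.2 hn) h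
  simp [Measure.real, samplingMeasure, h1]

theorem inner_pointInd {x : ℕ → M} {N n : ℕ} (hn : n < N) (hx : Set.InjOn x (Set.Iio N))
    (f : Lp ℂ 2 (samplingMeasure x N)) :
    ⟪pointInd x N n, f⟫_ℂ = (N : ℂ)⁻¹ * f (x n) := by
  rw [pointInd, L2.inner_indicatorConstLp_one, integral_singleton,
    samplingMeasure_singleton hn hx]
  simp

theorem shiftOp_eq {x : ℕ → M} {N q m : ℕ} (hm : m < N) (hx : Set.InjOn x (Set.Iio N))
    (f : Lp ℂ 2 (samplingMeasure x N)) :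
    (shiftOp x N q f) (x m) =
      ∑ n ∈ Finset.range (N - q), f (x (n + q)) * ({x n} : Set M).indicator 1 (x m) := by
  have h1 : shiftOp x N q f =
      ∑ n ∈ Finset.range (N - q), f (x (n + q)) • pointInd x N n := by
    rw [shiftOp, sum_apply]
    refine Finset.sum_congr rfl fun n hn => ?_
    have hn' : n + q < N := by have := Finset.mem_range.1 hn; omega
    have hN : (N : ℂ) ≠ 0 := by exact_mod_cast (by omega : N ≠ 0)
    rw [smul_apply, InnerProductSpace.rankOne_apply,
      inner_pointInd hn' hx, smul_smul, mul_inv_cancel_left₀ hN]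
  rw [h1]
  have h2 : ∀ s : Finset ℕ,
      (∑ n ∈ s, f (x (n + q)) • pointInd x N n : Lp ℂ 2 (samplingMeasure x N)) (x m) =
      ∑ n ∈ s, f (x (n + q)) * ({x n} : Set M).indicator 1 (x m) := by
    classical
    intro s
    induction s using Finset.induction_on with
    | empty => simpa using coe_eq_of_ae hm (Lp.coeFn_zero ℂ 2 (samplingMeasure x N))
    | insert a s ha ih =>
      rw [Finset.sum_insert ha, Finset.sum_insert ha, ← ih,
        coe_eq_of_ae hm (Lp.coeFn_add _ _), Pi.add_apply,
        coe_eq_of_ae hm (Lp.coeFn_smul _ _), Pi.smul_apply, smul_eq_mul]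
      congr 2
      rw [pointInd, coe_eq_of_ae hm indicatorConstLp_coeFn]
      rfl
  exact h2 _

theorem shiftOp_apply_of_lt {x : ℕ → M} {N q m : ℕ} (hm : m < N - q)
    (hx : Set.InjOn x (Set.Iio N)) (f : Lp ℂ 2 (samplingMeasure x N)) :
    (shiftOp x N q f) (x m) = f (x (m + q)) := by
  rw [shiftOp_eq (by omega) hx, Finset.sum_eq_single m]
  · simp
  · intro n hn hnm
    have hn' := Finset.mem_range.1 hn
    have : x m ≠ x n := fun e => hnm
      (hx (by simp only [Set.mem_Iio]; omega) (by simp only [Set.mem_Iio]; omega) e).symm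
    simp [this]
  · intro h; exact absurd (Finset.mem_range.2 hm) h

theorem shiftOp_apply_of_le {x : ℕ → M} {N q m : ℕ} (hm : m < N) (hqm : N - q ≤ m)
    (hx : Set.InjOn x (Set.Iio N)) (f : Lp ℂ 2 (samplingMeasure x N)) :
    (shiftOp x N q f) (x m) = 0 := by
  rw [shiftOp_eq hm hx]
  refine Finset.sum_eq_zero fun n hn => ?_
  have hn' := Finset.mem_range.1 hn
  have : x m ≠ x n := fun e => by
    have := hx hm (by simp only [Set.mem_Iio]; omega) e
    omega
  simp [this]

end ShiftFacts

end

end QMDA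

open QMDA

/-!
The argument has an operator part, which is finite-dimensional, and an analytic part, which
supplies the convergence of finitely many matrix elements.

*Schemes as matrix recursions.* In the retained basis vectors a truncated scheme is a recursion on
`L × L` matrices made of products, adjoints, traces and divisions by traces. It commutes with
unitary changes of basis. The eigenbasis of a data-driven kernel is determined only up to phases
and up to rotations inside (nearly) degenerate eigenspaces, so its matrices need not converge; but
it is enough that they converge after conjugation by matrices `C n` with `(C n)ᴴ * C n → 1`
(`GaugeTendsto`, `tendsto_prob`).

*Trial vectors.* For `C n` one takes the coefficients, in the data-driven eigenbasis, of the
continuous eigenfunctions `φ m`, `m < L`, of the limiting kernel (`coeffMatrix`). Since the `φ m`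
are continuous functions that do not depend on `N`, their Gram matrices and the matrix elements of
shift operators and of bin projections between them converge by weak convergence of the sampling
measures (`KernelConvOn.tendsto_gram`, `tendsto_inner_shiftOp`,
`WeakConvOn.tendsto_inner_binProj`). These limits transfer to the data-driven bases as soon as
each `φ m` has asymptotically all of its mass in the span of the first `L` data-driven
eigenvectors (`gaugeTendsto_of_inner`).

*Mass concentration.* The `φ m` are approximate eigenvectors of the data-driven operators, by
uniform convergence of the kernels; hence the mass of `φ m` concentrates on data-driven
eigenvalues near `lam m`. Near-orthonormality of the `φ m` gives, by counting, a lower bound for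
the ordered data-driven eigenvalues, and convergence of the Hilbert–Schmidt norms turns it into an
upper bound. With a gap `lam L < lam (L - 1)` the eigenvalues near `lam m`, `m < L`, are thus
among the first `L` (`SpectralApprox.tendsto_mass`). Without a gap, the assumed uniform
convergence of the eigenfunctions gives the same conclusion directly. The case `L = 1`, in which
the gap is a consequence of the Markov property and of ergodicity of the kernel
(`leading_eigenfunction`), handles the initial states.

*Partitions.* If the distribution function of `h` were constant on an interval above an inner
quantile, then almost every orbit, being connected, would stay on one side of it, against
ergodicity (`null_of_gap`). So the limiting distribution function increases strictly at the
quantiles, which are therefore limits of the empirical ones. As the boundary points are not atoms,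
the bins converge in measure, the bin means converge and are distinct, and the spectral
projections are the projections onto the bins.
-/

namespace QMDA

open Matrix

/-! ### Schemes as matrix recursions, up to asymptotically unitary changes of basis -/

section GaugeConvergence

variable {d : Type*} [Fintype d] {α : Type*} {l : Filter α}

/-- The matrices `A n` converge to `B` after the change of basis given by the (asymptotically
unitary) matrices `C n`. -/
def GaugeTendsto (l : Filter α) (C A : α → Matrix d d ℂ) (B : Matrix d d ℂ) : Prop :=
  Tendsto (fun n => (C n)ᴴ * A n * C n) l (𝓝 B)

variable {C A A' : α → Matrix d d ℂ} {B B' : Matrix d d ℂ}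

theorem GaugeTendsto.conjTranspose (h : GaugeTendsto l C A B) :
    GaugeTendsto l C (fun n => (A n)ᴴ) Bᴴ := by
  have := (Continuous.matrix_conjTranspose continuous_id).tendsto B |>.comp h
  refine this.congr fun n => ?_
  simp [Matrix.conjTranspose_mul, mul_assoc]

theorem GaugeTendsto.smul {c : α → ℂ} {c₀ : ℂ} (hc : Tendsto c l (𝓝 c₀))
    (h : GaugeTendsto l C A B) : GaugeTendsto l C (fun n => c n • A n) (c₀ • B) := by
  refine (hc.smul h).congr fun n => ?_
  simp

variable [DecidableEq d]

theorem tendsto_gram_det (hC : Tendsto (fun n => (C n)ᴴ * C n) l (𝓝 1)) :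
    Tendsto (fun n => ((C n)ᴴ * C n).det) l (𝓝 1) := by
  have hdet : Continuous fun A : Matrix d d ℂ => A.det := continuous_id.matrix_det
  have h := (hdet.tendsto 1).comp hC
  rwa [Matrix.det_one] at h

theorem tendsto_gram_inv (hC : Tendsto (fun n => (C n)ᴴ * C n) l (𝓝 1)) :
    Tendsto (fun n => ((C n)ᴴ * C n)⁻¹) l (𝓝 1) := by
  have hdet := tendsto_gram_det hC
  have hadj : Tendsto (fun n => ((C n)ᴴ * C n).adjugate) l (𝓝 1) := by
    have hcont : Continuous fun A : Matrix d d ℂ => A.adjugate := continuous_id.matrix_adjugate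
    have h := (hcont.tendsto 1).comp hC
    rwa [Matrix.adjugate_one] at h
  have := (hdet.inv₀ one_ne_zero).smul hadj
  simpa [Matrix.inv_def] using this

theorem eventually_gauge_isUnit (hC : Tendsto (fun n => (C n)ᴴ * C n) l (𝓝 1)) :
    ∀ᶠ n in l, IsUnit (C n).det := by
  have hdet := tendsto_gram_det hC
  filter_upwards [hdet.eventually_ne one_ne_zero] with n hn
  rw [Matrix.det_mul] at hn
  exact isUnit_iff_ne_zero.2 (right_ne_zero_of_mul hn)

theorem GaugeTendsto.mul (hC : Tendsto (fun n => (C n)ᴴ * C n) l (𝓝 1))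
    (h : GaugeTendsto l C A B) (h' : GaugeTendsto l C A' B') :
    GaugeTendsto l C (fun n => A n * A' n) (B * B') := by
  have := (Tendsto.mul h (tendsto_gram_inv hC)).mul h'
  rw [mul_one] at this
  refine this.congr' ?_
  filter_upwards [eventually_gauge_isUnit hC] with n hn
  have hn' : IsUnit ((C n)ᴴ).det := by simpa [Matrix.det_conjTranspose] using hn
  rw [Matrix.mul_inv_rev]
  calc (C n)ᴴ * A n * C n * ((C n)⁻¹ * ((C n)ᴴ)⁻¹) * ((C n)ᴴ * A' n * C n)
      = (C n)ᴴ * A n * (C n * (C n)⁻¹) * (((C n)ᴴ)⁻¹ * (C n)ᴴ) * (A' n * C n) := by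
        simp only [mul_assoc]
    _ = (C n)ᴴ * (A n * A' n) * C n := by
        rw [Matrix.mul_nonsing_inv _ hn, Matrix.nonsing_inv_mul _ hn']
        simp only [mul_assoc, mul_one]

theorem GaugeTendsto.trace (hC : Tendsto (fun n => (C n)ᴴ * C n) l (𝓝 1))
    (h : GaugeTendsto l C A B) : Tendsto (fun n => (A n).trace) l (𝓝 B.trace) := by
  have h1 := Tendsto.mul h (tendsto_gram_inv hC)
  rw [mul_one] at h1
  have := (Continuous.matrix_trace continuous_id).tendsto B |>.comp h1
  refine this.congr' ?_
  filter_upwards [eventually_gauge_isUnit hC] with n hn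
  have hn' : IsUnit ((C n)ᴴ).det := by simpa [Matrix.det_conjTranspose] using hn
  simp only [Function.comp, id]
  rw [Matrix.mul_inv_rev]
  calc ((C n)ᴴ * A n * C n * ((C n)⁻¹ * ((C n)ᴴ)⁻¹)).trace
      = ((C n)ᴴ * A n * (C n * (C n)⁻¹) * ((C n)ᴴ)⁻¹).trace := by simp only [mul_assoc]
    _ = (A n).trace := by
        rw [Matrix.mul_nonsing_inv _ hn, mul_one, Matrix.trace_mul_comm, ← mul_assoc,
          Matrix.nonsing_inv_mul _ hn', one_mul]

end GaugeConvergence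

section SchemeMatrix

variable {H : Type*} [NormedAddCommGroup H] [InnerProductSpace ℂ H]
  {ι : Type*} {d : Type*}

/-- The matrix of an operator in the retained basis vectors of a scheme, enumerated by `e`. -/
noncomputable def Scheme.mat (Q : Scheme H ι) (e : d → ι) (A : H →L[ℂ] H) : Matrix d d ℂ :=
  Matrix.of fun k m => ⟪Q.basis (e k), A (Q.basis (e m))⟫_ℂ

/-- `e` enumerates the retained basis indices of a scheme without repetition. -/
structure Scheme.Enum (Q : Scheme H ι) (e : d → ι) : Prop where
  inj : Function.Injective e
  mem : ∀ j, j ∈ Q.retained ↔ j ∈ Set.range e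

namespace Scheme

variable {Q : Scheme H ι} {e : d → ι}

theorem trunc_basis_of_mem {j : ι} (hj : j ∈ Q.retained) :
    Q.trunc (Q.basis j) = Q.basis j := by
  classical
  have h := orthonormal_iff_ite.1 Q.basis.orthonormal
  simp only [trunc, _root_.sum_apply, InnerProductSpace.rankOne_apply, h]
  simp [hj]

theorem trunc_basis_of_notMem {j : ι} (hj : j ∉ Q.retained) :
    Q.trunc (Q.basis j) = 0 := by
  classical
  have h := orthonormal_iff_ite.1 Q.basis.orthonormal
  simp only [trunc, _root_.sum_apply, InnerProductSpace.rankOne_apply, h]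
  simp [hj]

theorem inner_trunc_left (f g : H) : ⟪Q.trunc f, g⟫_ℂ = ⟪f, Q.trunc g⟫_ℂ := by
  simp only [trunc, _root_.sum_apply, InnerProductSpace.rankOne_apply, sum_inner, inner_sum,
    inner_smul_left, inner_smul_right, inner_conj_symm]
  exact Finset.sum_congr rfl fun _ _ => mul_comm _ _

theorem mat_smul (c : ℂ) (A : H →L[ℂ] H) : Q.mat e (c • A) = c • Q.mat e A := by
  ext k m
  simp [mat]

theorem Enum.mem_retained (he : Q.Enum e) (k : d) : e k ∈ Q.retained :=
  (he.mem _).2 ⟨k, rfl⟩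

theorem mat_adjoint [CompleteSpace H] (A : H →L[ℂ] H) :
    Q.mat e (ContinuousLinearMap.adjoint A) = (Q.mat e A)ᴴ := by
  ext k m
  simp only [mat, Matrix.of_apply, Matrix.conjTranspose_apply,
    ContinuousLinearMap.adjoint_inner_right, RCLike.star_def, inner_conj_symm]

theorem mat_trunc_comp (he : Q.Enum e) (A : H →L[ℂ] H) :
    Q.mat e (Q.trunc ∘L A) = Q.mat e A := by
  ext k m
  simp only [mat, Matrix.of_apply, ContinuousLinearMap.comp_apply]
  rw [← inner_trunc_left, trunc_basis_of_mem (he.mem_retained k)]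

theorem mat_comp_trunc (he : Q.Enum e) (A : H →L[ℂ] H) :
    Q.mat e (A ∘L Q.trunc) = Q.mat e A := by
  ext k m
  simp only [mat, Matrix.of_apply, ContinuousLinearMap.comp_apply]
  rw [trunc_basis_of_mem (he.mem_retained m)]

variable [Fintype d]

theorem Enum.sum_retained (he : Q.Enum e) {E : Type*} [AddCommMonoid E] (f : ι → E) :
    ∑ j ∈ Q.retained, f j = ∑ k, f (e k) := by
  classical
  have : Q.retained = Finset.univ.image e := by
    ext j; rw [he.mem]; simp
  rw [this, Finset.sum_image he.inj.injOn]

theorem mat_comp_trunc_comp (he : Q.Enum e) (A B : H →L[ℂ] H) :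
    Q.mat e (A ∘L Q.trunc ∘L B) = Q.mat e A * Q.mat e B := by
  ext k m
  simp only [mat, Matrix.mul_apply, Matrix.of_apply, ContinuousLinearMap.comp_apply]
  conv_lhs => rw [trunc]
  simp only [_root_.sum_apply, InnerProductSpace.rankOne_apply, map_sum, map_smul,
    inner_sum, inner_smul_right]
  rw [he.sum_retained]
  exact Finset.sum_congr rfl fun _ _ => mul_comm _ _

theorem mat_compress_comp (he : Q.Enum e) (A B : H →L[ℂ] H) :
    Q.mat e (Q.compress A ∘L B) = Q.mat e A * Q.mat e B := by
  have : Q.compress A ∘L B = Q.trunc ∘L (A ∘L Q.trunc ∘L B) := rfl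
  rw [this, mat_trunc_comp he, mat_comp_trunc_comp he]

theorem mat_comp_compress (he : Q.Enum e) (A B : H →L[ℂ] H) :
    Q.mat e (B ∘L Q.compress A) = Q.mat e B * Q.mat e A := by
  have : B ∘L Q.compress A = B ∘L Q.trunc ∘L (A ∘L Q.trunc) := rfl
  rw [this, mat_comp_trunc_comp he, mat_comp_trunc he]

/-- For operators whose range lies in the retained subspace, the trace is that of the matrix. -/
theorem tr_trunc_comp (he : Q.Enum e) (A : H →L[ℂ] H) :
    Q.tr (Q.trunc ∘L A) = (Q.mat e (Q.trunc ∘L A)).trace := by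
  rw [tr, tsum_eq_sum (s := Q.retained), he.sum_retained]
  · rfl
  · intro j hj
    rw [ContinuousLinearMap.comp_apply, ← inner_trunc_left, trunc_basis_of_notMem hj,
      inner_zero_left]

theorem tr_compress_comp (he : Q.Enum e) (A B : H →L[ℂ] H) :
    Q.tr (Q.compress A ∘L B) = (Q.mat e A * Q.mat e B).trace := by
  have : Q.compress A ∘L B = Q.trunc ∘L (A ∘L Q.trunc ∘L B) := rfl
  rw [← mat_compress_comp he, this, tr_trunc_comp he]

theorem mat_updated (he : Q.Enum e) (i : ℕ) (ρ : H →L[ℂ] H) :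
    Q.mat e (Q.updated i ρ) = Q.mat e (Q.proj i) * (Q.mat e ρ * Q.mat e (Q.proj i)) := by
  rw [updated, mat_compress_comp he, mat_comp_compress he]

theorem tr_updated (he : Q.Enum e) (i : ℕ) (ρ : H →L[ℂ] H) :
    Q.tr (Q.updated i ρ) = (Q.mat e (Q.updated i ρ)).trace := by
  rw [mat_updated he, updated, tr_compress_comp he, mat_comp_compress he]

variable [CompleteSpace H]

theorem adjoint_compress (A : H →L[ℂ] H) :
    ContinuousLinearMap.adjoint (Q.compress A) = Q.compress (ContinuousLinearMap.adjoint A) := by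
  symm
  rw [ContinuousLinearMap.eq_adjoint_iff]
  intro f g
  simp only [compress, ContinuousLinearMap.comp_apply, inner_trunc_left,
    ContinuousLinearMap.adjoint_inner_left]

theorem evolved_eq (q : ℕ) (ρ : H →L[ℂ] H) : Q.evolved q ρ =
    Q.compress (ContinuousLinearMap.adjoint (Q.evol q)) ∘L (ρ ∘L Q.compress (Q.evol q)) := by
  rw [evolved, adjoint_compress]

theorem mat_evolved (he : Q.Enum e) (q : ℕ) (ρ : H →L[ℂ] H) :
    Q.mat e (Q.evolved q ρ) =
      (Q.mat e (Q.evol q))ᴴ * (Q.mat e ρ * Q.mat e (Q.evol q)) := by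
  rw [evolved_eq, mat_compress_comp he, mat_comp_compress he, mat_adjoint]

theorem tr_evolved (he : Q.Enum e) (q : ℕ) (ρ : H →L[ℂ] H) :
    Q.tr (Q.evolved q ρ) = (Q.mat e (Q.evolved q ρ)).trace := by
  rw [mat_evolved he, evolved_eq, tr_compress_comp he, mat_comp_compress he, mat_adjoint]

end Scheme

end SchemeMatrix

section SchemeConvergence

variable {d : Type*} [Fintype d] [DecidableEq d] {α : Type*} {l : Filter α}
  {H : Type*} [NormedAddCommGroup H] [InnerProductSpace ℂ H]
  {ι : Type*} {Q : Scheme H ι} {e : d → ι}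
  {K : α → Type*} [∀ n, NormedAddCommGroup (K n)] [∀ n, InnerProductSpace ℂ (K n)]
  {κ : α → Type*} {R : ∀ n, Scheme (K n) (κ n)}
  {r : ∀ n, d → κ n} {C : α → Matrix d d ℂ}

/-- Normalization by a nonzero trace is compatible with convergence up to a change of basis. -/
theorem GaugeTendsto.normalize (hC : Tendsto (fun n => (C n)ᴴ * C n) l (𝓝 1))
    {A : ∀ n, K n →L[ℂ] K n} {B : H →L[ℂ] H}
    (hA : ∀ n, (R n).tr (A n) = ((R n).mat (r n) (A n)).trace)
    (hB : Q.tr B = (Q.mat e B).trace) (hB0 : Q.tr B ≠ 0)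
    (h : GaugeTendsto l C (fun n => (R n).mat (r n) (A n)) (Q.mat e B)) :
    GaugeTendsto l C (fun n => (R n).mat (r n) ((R n).normalize (A n)))
      (Q.mat e (Q.normalize B)) := by
  simp only [Scheme.normalize, Scheme.mat_smul]
  refine GaugeTendsto.smul (Tendsto.inv₀ ?_ hB0) h
  simp only [hA, hB]
  exact h.trace hC

variable [CompleteSpace H] [∀ n, CompleteSpace (K n)]

/-- A family of schemes whose input matrices converge, up to asymptotically unitary changes of
basis, to those of a scheme `Q`, has converging probabilities: all operations of the scheme are
rational and invariant under unitary changes of basis. -/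
theorem tendsto_prob (he : Q.Enum e) (hr : ∀ n, (R n).Enum (r n))
    (hC : Tendsto (fun n => (C n)ᴴ * C n) l (𝓝 1))
    (hevol : ∀ q, GaugeTendsto l C (fun n => (R n).mat (r n) ((R n).evol q))
      (Q.mat e (Q.evol q)))
    {S : ℕ}
    (hproj : ∀ i < S, GaugeTendsto l C (fun n => (R n).mat (r n) ((R n).proj i))
      (Q.mat e (Q.proj i)))
    (hinit : GaugeTendsto l C (fun n => (R n).mat (r n) (R n).init) (Q.mat e Q.init))
    {y : ℕ → Option ℝ} {j : ℕ} (hlt : ∀ a, Q.aff a < S)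
    (haff : ∀ m < j, ∀ a, y m = some a → ∀ᶠ n in l, (R n).aff a = Q.aff a)
    (hdef : Q.StateDefined y j) {i : ℕ} (hi : i < S) :
    Tendsto (fun n => (R n).prob y j i) l (𝓝 (Q.prob y j i)) := by
  have hstep : ∀ (q : ℕ) (ρ : ∀ n, K n →L[ℂ] K n) (σ : H →L[ℂ] H),
      Q.tr (Q.evolved q σ) ≠ 0 →
      GaugeTendsto l C (fun n => (R n).mat (r n) (ρ n)) (Q.mat e σ) →
      GaugeTendsto l C (fun n => (R n).mat (r n) ((R n).normalize ((R n).evolved q (ρ n))))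
        (Q.mat e (Q.normalize (Q.evolved q σ))) := by
    intro q ρ σ h0 h
    refine GaugeTendsto.normalize hC (fun n => Scheme.tr_evolved (hr n) q _)
      (Scheme.tr_evolved he q _) h0 ?_
    simp only [Scheme.mat_evolved he, Scheme.mat_evolved (hr _)]
    exact ((hevol q).conjTranspose).mul hC (h.mul hC (hevol q))
  have hsnd : ∀ m n, ((R n).anchor y m).2 = (Q.anchor y m).2 := by
    intro m n
    induction m with
    | zero => rfl
    | succ m ih => cases hy : y m <;> simp [Scheme.anchor, hy, ih]
  have hanchor : ∀ m ≤ j, Q.AnchorDefined y m →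
      GaugeTendsto l C (fun n => (R n).mat (r n) ((R n).anchor y m).1)
        (Q.mat e (Q.anchor y m).1) := by
    intro m
    induction m with
    | zero => exact fun _ _ => hinit
    | succ m ih =>
      intro hm hd
      cases hy : y m with
      | none =>
        simp only [Scheme.AnchorDefined, hy] at hd
        simpa only [Scheme.anchor, hy] using ih (by omega) hd
      | some a =>
        simp only [Scheme.AnchorDefined, hy] at hd
        obtain ⟨hd1, hd2, hd3⟩ := hd
        have h1 := hstep _ _ _ hd2 (ih (by omega) hd1)
        have hp := hproj _ (hlt a)
        have h2 : GaugeTendsto l C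
            (fun n => (R n).mat (r n) ((R n).normalize ((R n).updated (Q.aff a)
              ((R n).normalize ((R n).evolved (Q.anchor y m).2 ((R n).anchor y m).1)))))
            (Q.mat e (Q.normalize (Q.updated (Q.aff a)
              (Q.normalize (Q.evolved (Q.anchor y m).2 (Q.anchor y m).1))))) := by
          refine GaugeTendsto.normalize hC (fun n => Scheme.tr_updated (hr n) _ _)
            (Scheme.tr_updated he _ _) hd3 ?_
          simp only [Scheme.mat_updated he, Scheme.mat_updated (hr _)]
          exact hp.mul hC (h1.mul hC hp)
        simp only [Scheme.anchor, hy]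
        refine Tendsto.congr' ?_ h2
        filter_upwards [haff m (by omega) a hy] with n hn
        rw [hn, hsnd]
  obtain ⟨hd1, hd2⟩ := hdef
  have hstate := hstep _ _ _ hd2 (hanchor j le_rfl hd1)
  have hfin := ((hproj i hi).mul hC hstate).trace hC
  refine (Complex.continuous_re.tendsto _).comp hfin |>.congr' ?_ |>.mono_right ?_
  · refine Eventually.of_forall fun n => ?_
    simp only [Function.comp, Scheme.prob, Scheme.state]
    rw [Scheme.tr_compress_comp (hr n), hsnd]
  · rw [Scheme.prob, Scheme.tr_compress_comp he]
    exact le_rfl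

end SchemeConvergence

/-! ### Perturbation of ordered eigenvalues through approximate eigenvectors -/

section SpectralLimit

/-- Coefficients `a N j m` of the `m`-th approximate eigenvector with respect to the `j`-th vector
of an orthonormal eigenbasis with `N` elements and eigenvalues `Λ N j`: the approximate
eigenvectors are asymptotically normalized, satisfy Bessel's inequality asymptotically, have
vanishing residuals for the eigenvalues `lam m`, and the squared Hilbert–Schmidt norms converge. -/
structure SpectralApprox (Λ : ℕ → ℕ → ℝ) (lam : ℕ → ℝ) (a : ℕ → ℕ → ℕ → ℂ) : Prop where
  antitoneOn : ∀ N, AntitoneOn (Λ N) (Set.Iio N)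
  antitone : Antitone lam
  nonneg : ∀ j, 0 ≤ lam j
  norm : ∀ m, Tendsto (fun N => ∑ j ∈ Finset.range N, ‖a N j m‖ ^ 2) atTop (𝓝 1)
  bessel : ∀ n, ∃ D : ℕ → ℝ, Tendsto D atTop (𝓝 1) ∧
    ∀ N, ∀ j < N, ∑ m ∈ Finset.range n, ‖a N j m‖ ^ 2 ≤ D N
  residual : ∀ m, Tendsto
    (fun N => ∑ j ∈ Finset.range N, (Λ N j - lam m) ^ 2 * ‖a N j m‖ ^ 2) atTop (𝓝 0)
  summable : Summable fun j => lam j ^ 2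
  hilbertSchmidt : Tendsto (fun N => ∑ j ∈ Finset.range N, Λ N j ^ 2) atTop
    (𝓝 (∑' j, lam j ^ 2))

variable {Λ : ℕ → ℕ → ℝ} {lam : ℕ → ℝ} {a : ℕ → ℕ → ℕ → ℂ}

/-- The mass of an approximate eigenvector on indices at distance at least `ε` from its
eigenvalue is controlled by the residual. -/
theorem sum_norm_sq_le_of_gap {N l : ℕ} {μ ε : ℝ} (hε : 0 < ε) (hl : l ≤ N) {Λ : ℕ → ℝ}
    {v : ℕ → ℂ} (hgap : ∀ j < N, l ≤ j → ε ≤ μ - Λ j) :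
    ∑ j ∈ Finset.range N, ‖v j‖ ^ 2 ≤ ∑ j ∈ Finset.range l, ‖v j‖ ^ 2 +
      (ε ^ 2)⁻¹ * ∑ j ∈ Finset.range N, (Λ j - μ) ^ 2 * ‖v j‖ ^ 2 := by
  have h1 : ∑ j ∈ Finset.range l, ‖v j‖ ^ 2 =
      ∑ j ∈ Finset.range N, if j < l then ‖v j‖ ^ 2 else 0 := by
    rw [← Finset.sum_filter]
    congr 1
    ext j
    simp only [Finset.mem_range, Finset.mem_filter]
    omega
  rw [h1, Finset.mul_sum, ← Finset.sum_add_distrib]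
  refine Finset.sum_le_sum fun j hj => ?_
  have hj' := Finset.mem_range.1 hj
  split_ifs with hjl
  · have : 0 ≤ (ε ^ 2)⁻¹ * ((Λ j - μ) ^ 2 * ‖v j‖ ^ 2) := by positivity
    linarith
  · have h2 := hgap j hj' (not_lt.1 hjl)
    have h3 : ε ^ 2 ≤ (Λ j - μ) ^ 2 := by nlinarith
    have h4 : 1 ≤ (ε ^ 2)⁻¹ * (Λ j - μ) ^ 2 := by
      rw [inv_mul_eq_div, one_le_div (by positivity)]; exact h3
    have h5 : 0 ≤ ‖v j‖ ^ 2 := by positivity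
    nlinarith

namespace SpectralApprox

/-- Lower semicontinuity of the ordered eigenvalues: if the `l`-th eigenvalue stayed below
`lam l`, then `l + 1` asymptotically orthonormal vectors would concentrate on `l` indices. -/
theorem eventually_lt (hA : SpectralApprox Λ lam a) {l : ℕ} {c : ℝ} (hc : c < lam l) :
    ∀ᶠ N in atTop, l < N → c < Λ N l := by
  obtain ⟨D, hD, hrow⟩ := hA.bessel (l + 1)
  set ε := lam l - c with hεdef
  have hε : 0 < ε := sub_pos.2 hc
  have hlim : Tendsto (fun N => (∑ m ∈ Finset.range (l + 1),
      (∑ j ∈ Finset.range N, ‖a N j m‖ ^ 2 - (ε ^ 2)⁻¹ *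
        ∑ j ∈ Finset.range N, (Λ N j - lam m) ^ 2 * ‖a N j m‖ ^ 2)) - l * D N) atTop
      (𝓝 ((∑ _m ∈ Finset.range (l + 1), (1 - (ε ^ 2)⁻¹ * 0)) - l * 1)) :=
    (tendsto_finsetSum _ fun m _ => (hA.norm m).sub ((hA.residual m).const_mul _)).sub
      (hD.const_mul _)
  have hpos : (0 : ℝ) < (∑ _m ∈ Finset.range (l + 1), (1 - (ε ^ 2)⁻¹ * 0)) - l * 1 := by
    simp
  filter_upwards [hlim.eventually_const_lt hpos] with N hN hlN
  by_contra hcon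
  push Not at hcon
  have hm : ∀ m ∈ Finset.range (l + 1), ∑ j ∈ Finset.range N, ‖a N j m‖ ^ 2 - (ε ^ 2)⁻¹ *
        ∑ j ∈ Finset.range N, (Λ N j - lam m) ^ 2 * ‖a N j m‖ ^ 2 ≤
        ∑ j ∈ Finset.range l, ‖a N j m‖ ^ 2 := by
    intro m hm
    have hml : m ≤ l := by have := Finset.mem_range.1 hm; omega
    have := sum_norm_sq_le_of_gap (μ := lam m) (Λ := Λ N) (v := fun j => a N j m) hε hlN.le
      (fun j hj hlj => by
        have h1 := hA.antitoneOn N (Set.mem_Iio.2 hlN) (Set.mem_Iio.2 hj) hlj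
        have h2 := hA.antitone hml
        linarith)
    linarith
  have h1 := Finset.sum_le_sum hm
  rw [Finset.sum_comm] at h1
  have h2 : ∑ j ∈ Finset.range l, ∑ m ∈ Finset.range (l + 1), ‖a N j m‖ ^ 2 ≤ l * D N := by
    calc _ ≤ ∑ _j ∈ Finset.range l, D N := Finset.sum_le_sum fun j hj =>
          hrow N j ((Finset.mem_range.1 hj).trans hlN)
      _ = l * D N := by simp
  linarith

/-- Upper semicontinuity of the ordered eigenvalues: no Hilbert–Schmidt norm can be left over
beyond the lower bounds of `eventually_lt`. -/
theorem eventually_gt (hA : SpectralApprox Λ lam a) {l : ℕ} {c : ℝ} (hc : lam l < c) :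
    ∀ᶠ N in atTop, l < N → Λ N l < c := by
  set ε := c - lam l with hεdef
  have hε : 0 < ε := sub_pos.2 hc
  set T := ∑' j, lam j ^ 2 with hT
  -- the tail of the limiting Hilbert–Schmidt sum beyond `J` is less than `ε ^ 2 / 4`
  obtain ⟨J, hJl, hJ⟩ : ∃ J, l < J ∧ T - ε ^ 2 / 4 < ∑ j ∈ Finset.range J, lam j ^ 2 := by
    have h1 := hA.summable.hasSum.tendsto_sum_nat
    have h2 := h1.eventually_const_lt (show T - ε ^ 2 / 4 < T by nlinarith)
    obtain ⟨J, hJ1, hJ2⟩ := ((eventually_gt_atTop l).and h2).exists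
    exact ⟨J, hJ1, hJ2⟩
  have hJ0 : (0 : ℝ) < J := by exact_mod_cast (by omega : 0 < J)
  set η := ε ^ 2 / (4 * J) with hη
  have hη0 : 0 < η := by positivity
  have hlow : ∀ i ∈ Finset.range J, ∀ᶠ N in atTop, i < N → lam i ^ 2 - η ≤ Λ N i ^ 2 := by
    intro i _
    have h0 := hA.nonneg i
    have hδ : 0 < η / (2 * (lam i + 1)) := by positivity
    filter_upwards [hA.eventually_lt (sub_lt_self (lam i) hδ)] with N hN hiN
    have h1 := hN hiN
    have h2 : 2 * lam i * (η / (2 * (lam i + 1))) ≤ η := by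
      rw [mul_div_assoc', div_le_iff₀ (by positivity)]
      nlinarith
    nlinarith [sq_nonneg (Λ N i - lam i)]
  filter_upwards [(Finset.eventually_all _).2 hlow, eventually_ge_atTop J,
    hA.hilbertSchmidt.eventually_lt_const (show T < T + ε ^ 2 / 4 by nlinarith)]
    with N h1 hJN h2 hlN
  by_contra hcon
  push Not at hcon
  have h0 := hA.nonneg l
  have h3 : lam l ^ 2 + ε ^ 2 ≤ Λ N l ^ 2 := by
    have : lam l + ε ≤ Λ N l := by linarith
    nlinarith
  have h4 : ∑ i ∈ Finset.range J, ((lam i ^ 2 - η) + if i = l then ε ^ 2 else 0) ≤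
      ∑ i ∈ Finset.range J, Λ N i ^ 2 := by
    refine Finset.sum_le_sum fun i hi => ?_
    split_ifs with hil
    · subst hil; linarith
    · have := h1 i hi (by have := Finset.mem_range.1 hi; omega)
      linarith
  have h5 : ∑ i ∈ Finset.range J, Λ N i ^ 2 ≤ ∑ i ∈ Finset.range N, Λ N i ^ 2 :=
    Finset.sum_le_sum_of_subset_of_nonneg (Finset.range_mono hJN)
      fun _ _ _ => sq_nonneg _
  rw [Finset.sum_add_distrib, Finset.sum_sub_distrib, Finset.sum_ite_eq' (Finset.range J) l,
    if_pos (Finset.mem_range.2 hJl), Finset.sum_const, Finset.card_range, nsmul_eq_mul] at h4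
  have h6 : (J : ℝ) * η = ε ^ 2 / 4 := by rw [hη]; field_simp
  nlinarith

/-- If the first `L` limiting eigenvalues do not split an eigenspace, the first `L` approximate
eigenvectors concentrate on the first `L` eigenvectors. -/
theorem tendsto_mass (hA : SpectralApprox Λ lam a) {L : ℕ} (hL : 0 < L)
    (hgap : lam L < lam (L - 1)) {m : ℕ} (hm : m < L) :
    Tendsto (fun N => ∑ j ∈ Finset.range L, ‖a N j m‖ ^ 2) atTop (𝓝 1) := by
  obtain ⟨c, hc1, hc2⟩ := exists_between hgap
  set ε := lam (L - 1) - c with hεdef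
  have hε : 0 < ε := sub_pos.2 hc2
  have hlow : Tendsto (fun N => ∑ j ∈ Finset.range N, ‖a N j m‖ ^ 2 - (ε ^ 2)⁻¹ *
        ∑ j ∈ Finset.range N, (Λ N j - lam m) ^ 2 * ‖a N j m‖ ^ 2) atTop (𝓝 1) := by
    simpa using (hA.norm m).sub ((hA.residual m).const_mul (ε ^ 2)⁻¹)
  refine tendsto_of_tendsto_of_tendsto_of_le_of_le' hlow (hA.norm m) ?_ ?_
  · filter_upwards [hA.eventually_gt hc1, eventually_gt_atTop L] with N hN hLN
    have := sum_norm_sq_le_of_gap (μ := lam m) (Λ := Λ N) (v := fun j => a N j m) hε hLN.le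
      (fun j hj hlj => by
        have h1 := hA.antitoneOn N (Set.mem_Iio.2 hLN) (Set.mem_Iio.2 hj) hlj
        have h2 := hA.antitone (show m ≤ L - 1 by omega)
        have h3 := hN hLN
        linarith)
    linarith
  · filter_upwards [eventually_ge_atTop L] with N hLN
    exact Finset.sum_le_sum_of_subset_of_nonneg (Finset.range_mono hLN)
      fun _ _ _ => sq_nonneg _

/-- If the leading eigenvalue is simple, the leading eigenvector has asymptotically no overlap with
the other approximate eigenvectors. -/
theorem tendsto_leading (hA : SpectralApprox Λ lam a) (hgap : lam 1 < lam 0) (m : ℕ) :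
    Tendsto (fun N => ‖a N 0 m‖) atTop (𝓝 (if m = 0 then 1 else 0)) := by
  have h0 : Tendsto (fun N => ‖a N 0 0‖ ^ 2) atTop (𝓝 1) := by
    simpa using hA.tendsto_mass one_pos hgap one_pos
  split_ifs with hm
  · subst hm
    simpa [Real.sqrt_sq] using h0.sqrt
  · obtain ⟨D, hD, hrow⟩ := hA.bessel (m + 1)
    have hlim : Tendsto (fun N => D N - ‖a N 0 0‖ ^ 2) atTop (𝓝 0) := by
      simpa using hD.sub h0
    have hsq : Tendsto (fun N => ‖a N 0 m‖ ^ 2) atTop (𝓝 0) := by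
      refine squeeze_zero' (Eventually.of_forall fun N => sq_nonneg _) ?_ hlim
      filter_upwards [eventually_gt_atTop 0] with N hN
      have h1 := hrow N 0 hN
      rw [Finset.sum_range_succ] at h1
      have h2 : ‖a N 0 0‖ ^ 2 ≤ ∑ k ∈ Finset.range m, ‖a N 0 k‖ ^ 2 :=
        Finset.single_le_sum (f := fun k => ‖a N 0 k‖ ^ 2) (fun _ _ => sq_nonneg _)
          (Finset.mem_range.2 (Nat.pos_of_ne_zero hm))
      linarith
    simpa [Real.sqrt_sq] using hsq.sqrt

end SpectralApprox

end SpectralLimit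

/-! ### Almost orthonormal families in varying Hilbert spaces -/

section Frames

/-- Bessel's inequality for a family with Gram matrix close to the identity. -/
theorem sum_norm_inner_sq_le {K : Type*} [NormedAddCommGroup K] [InnerProductSpace ℂ K]
    {d : Type*} [Fintype d] [DecidableEq d] (v : d → K) {f : K} (hf : ‖f‖ = 1) :
    ∑ m, ‖⟪f, v m⟫_ℂ‖ ^ 2 ≤
      1 + ∑ m, ∑ k, ‖v m‖ * ‖v k‖ * ‖⟪v m, v k⟫_ℂ - if m = k then 1 else 0‖ := by
  set c : d → ℂ := fun m => ⟪v m, f⟫_ℂ with hc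
  have hcn : ∀ m, ‖⟪f, v m⟫_ℂ‖ = ‖c m‖ := fun m => norm_inner_symm _ _
  set S := ∑ m, ‖c m‖ ^ 2 with hS
  set E := ∑ m, ∑ k, (starRingEnd ℂ) (c m) * c k * (⟪v m, v k⟫_ℂ - if m = k then 1 else 0)
    with hE
  have hSc : (S : ℂ) = ∑ m, (starRingEnd ℂ) (c m) * c m := by
    rw [hS]
    push_cast
    exact Finset.sum_congr rfl fun m _ => (Complex.conj_mul' _).symm
  have hff : ⟪f, f⟫_ℂ = 1 := by rw [inner_self_eq_norm_sq_to_K, hf]; simp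
  have key : ⟪f - ∑ m, c m • v m, f - ∑ m, c m • v m⟫_ℂ = 1 - (S : ℂ) + E := by
    have h1 : ⟪f, ∑ m, c m • v m⟫_ℂ = S := by
      rw [hSc, inner_sum]
      refine Finset.sum_congr rfl fun m _ => ?_
      rw [inner_smul_right, hc]
      simp only [inner_conj_symm]
      ring
    have h2 : ⟪∑ m, c m • v m, f⟫_ℂ = S := by
      rw [← inner_conj_symm, h1, Complex.conj_ofReal]
    have h3 : ⟪∑ m, c m • v m, ∑ m, c m • v m⟫_ℂ = S + E := by
      rw [hSc, hE, sum_inner, ← Finset.sum_add_distrib]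
      refine Finset.sum_congr rfl fun m _ => ?_
      rw [inner_sum]
      have : (starRingEnd ℂ) (c m) * c m =
          ∑ k, (starRingEnd ℂ) (c m) * c k * (if m = k then 1 else 0) := by
        simp
      rw [this, ← Finset.sum_add_distrib]
      refine Finset.sum_congr rfl fun k _ => ?_
      rw [inner_smul_left, inner_smul_right]
      ring
    rw [inner_sub_left, inner_sub_right, inner_sub_right, h1, h2, h3, hff]
    ring
  have hre : 0 ≤ 1 - S + E.re := by
    have h := inner_self_nonneg (𝕜 := ℂ) (x := f - ∑ m, c m • v m)
    rw [key] at h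
    simpa using h
  have hEle : E.re ≤ ∑ m, ∑ k, ‖v m‖ * ‖v k‖ * ‖⟪v m, v k⟫_ℂ - if m = k then 1 else 0‖ := by
    refine (Complex.re_le_norm E).trans ((norm_sum_le _ _).trans ?_)
    refine Finset.sum_le_sum fun m _ => (norm_sum_le _ _).trans ?_
    refine Finset.sum_le_sum fun k _ => ?_
    have hcm : ∀ m, ‖c m‖ ≤ ‖v m‖ := fun m => by
      simpa [hf] using norm_inner_le_norm (𝕜 := ℂ) (v m) f
    rw [norm_mul, norm_mul, RCLike.norm_conj]
    gcongr
    · exact hcm m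
    · exact hcm k
  simp only [hcn]
  linarith

variable {d α : Type*} {l : Filter α}
  {K : α → Type*} [∀ n, NormedAddCommGroup (K n)] [∀ n, InnerProductSpace ℂ (K n)]

/-- If `f n - g n → 0` in norm and the `g n` are bounded, bounded sesquilinear forms evaluated
along `f` and along `g` have the same limits. -/
theorem tendsto_inner_of_norm_sub {f g f' g' : ∀ n, K n} {A : ∀ n, K n →L[ℂ] K n} {c : ℂ}
    (hA : ∀ n (x y : K n), ‖⟪x, A n y⟫_ℂ‖ ≤ ‖x‖ * ‖y‖)
    (hf : Tendsto (fun n => ‖f n - g n‖) l (𝓝 0)) (hf' : Tendsto (fun n => ‖f' n - g' n‖) l (𝓝 0))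
    {b b' : ℝ} (hb : Tendsto (fun n => ‖f n‖) l (𝓝 b)) (hb' : Tendsto (fun n => ‖f' n‖) l (𝓝 b'))
    (h : Tendsto (fun n => ⟪f n, A n (f' n)⟫_ℂ) l (𝓝 c)) :
    Tendsto (fun n => ⟪g n, A n (g' n)⟫_ℂ) l (𝓝 c) := by
  have hdiff : Tendsto (fun n => ⟪f n, A n (f' n)⟫_ℂ - ⟪g n, A n (g' n)⟫_ℂ) l (𝓝 0) := by
    have hlim : Tendsto (fun n => ‖f n - g n‖ * ‖f' n‖ +
        (‖f n‖ + ‖f n - g n‖) * ‖f' n - g' n‖) l (𝓝 (0 * b' + (b + 0) * 0)) :=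
      (hf.mul hb').add ((hb.add hf).mul hf')
    rw [show (0 : ℝ) * b' + (b + 0) * 0 = 0 by ring] at hlim
    refine squeeze_zero_norm (fun n => ?_) hlim
    have h1 : ⟪f n, A n (f' n)⟫_ℂ - ⟪g n, A n (g' n)⟫_ℂ =
        ⟪f n - g n, A n (f' n)⟫_ℂ + ⟪g n, A n (f' n - g' n)⟫_ℂ := by
      rw [map_sub, inner_sub_left, inner_sub_right]; ring
    rw [h1]
    refine (norm_add_le _ _).trans (add_le_add (hA n _ _) ((hA n _ _).trans ?_))
    gcongr
    have := norm_sub_le (f n) (f n - g n)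
    simpa using this
  simpa using h.sub hdiff

variable {κ : α → Type*} {β : ∀ n, HilbertBasis (κ n) ℂ (K n)} {r : ∀ n, d → κ n}
  {v : ∀ n, d → K n}

theorem tendsto_norm_of_gram {m : d} (hgram : Tendsto (fun n => ⟪v n m, v n m⟫_ℂ) l (𝓝 1)) :
    Tendsto (fun n => ‖v n m‖) l (𝓝 1) := by
  have := ((Complex.continuous_re.tendsto _).comp hgram).sqrt
  simp only [Complex.one_re, Real.sqrt_one] at this
  refine this.congr fun n => ?_
  rw [norm_eq_sqrt_re_inner (𝕜 := ℂ) (v n m)]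
  rfl

/-- The matrix of coefficients of the vectors `v` in the basis vectors enumerated by `r`. -/
noncomputable def coeffMatrix {K : Type*} [NormedAddCommGroup K] [InnerProductSpace ℂ K]
    {κ : Type*} (β : HilbertBasis κ ℂ K) (r : d → κ) (v : d → K) : Matrix d d ℂ :=
  Matrix.of fun k m => ⟪β (r k), v m⟫_ℂ

variable [Fintype d]

theorem norm_sub_sum_sq {K : Type*} [NormedAddCommGroup K] [InnerProductSpace ℂ K]
    {κ : Type*} (β : HilbertBasis κ ℂ K) {r : d → κ} (hr : Function.Injective r) (v : K) :
    ‖v - ∑ k, ⟪β (r k), v⟫_ℂ • β (r k)‖ ^ 2 = ‖v‖ ^ 2 - ∑ k, ‖⟪β (r k), v⟫_ℂ‖ ^ 2 := by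
  have ho : Orthonormal ℂ (fun k => β (r k)) := β.orthonormal.comp r hr
  set w := ∑ k, ⟪β (r k), v⟫_ℂ • β (r k) with hw
  have h1 : ⟪w, v⟫_ℂ = ((∑ k, ‖⟪β (r k), v⟫_ℂ‖ ^ 2 : ℝ) : ℂ) := by
    rw [hw, sum_inner]
    push_cast
    refine Finset.sum_congr rfl fun k _ => ?_
    rw [inner_smul_left, Complex.conj_mul']
  have h2 : ⟪w, w⟫_ℂ = ((∑ k, ‖⟪β (r k), v⟫_ℂ‖ ^ 2 : ℝ) : ℂ) := by
    rw [hw, ho.inner_sum]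
    push_cast
    refine Finset.sum_congr rfl fun k _ => ?_
    rw [Complex.conj_mul']
  have h3 : ‖w‖ ^ 2 = ∑ k, ‖⟪β (r k), v⟫_ℂ‖ ^ 2 := by
    rw [norm_sq_eq_re_inner (𝕜 := ℂ) w, h2]
    exact Complex.ofReal_re _
  rw [norm_sub_sq (𝕜 := ℂ), ← inner_conj_symm, h1, h3]
  simp only [Complex.conj_ofReal, RCLike.re_to_complex, Complex.ofReal_re]
  ring

theorem conjTranspose_coeffMatrix_mul_mul {K : Type*} [NormedAddCommGroup K]
    [InnerProductSpace ℂ K] {κ : Type*} (Q : Scheme K κ) (r : d → κ) (v : d → K)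
    (A : K →L[ℂ] K) (m m' : d) :
    ((coeffMatrix Q.basis r v)ᴴ * Q.mat r A * coeffMatrix Q.basis r v) m m' =
      ⟪∑ k, ⟪Q.basis (r k), v m⟫_ℂ • Q.basis (r k),
        A (∑ k, ⟪Q.basis (r k), v m'⟫_ℂ • Q.basis (r k))⟫_ℂ := by
  simp only [Matrix.mul_apply, coeffMatrix, Scheme.mat, Matrix.of_apply,
    Matrix.conjTranspose_apply, map_sum, map_smul, sum_inner, inner_sum, inner_smul_left,
    inner_smul_right, RCLike.star_def, Finset.sum_mul, Finset.mul_sum]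
  refine Finset.sum_congr rfl fun k _ => Finset.sum_congr rfl fun k' _ => ?_
  ring

theorem tendsto_norm_sub_sum (hr : ∀ n, Function.Injective (r n)) (m : d)
    (hgram : Tendsto (fun n => ⟪v n m, v n m⟫_ℂ) l (𝓝 1))
    (hmass : Tendsto (fun n => ∑ k, ‖⟪β n (r n k), v n m⟫_ℂ‖ ^ 2) l (𝓝 1)) :
    Tendsto (fun n => ‖v n m - ∑ k, ⟪β n (r n k), v n m⟫_ℂ • β n (r n k)‖) l (𝓝 0) := by
  have hn : Tendsto (fun n => ‖v n m‖ ^ 2) l (𝓝 1) := by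
    have := (Complex.continuous_re.tendsto _).comp hgram
    refine this.congr fun n => ?_
    exact (norm_sq_eq_re_inner (𝕜 := ℂ) (v n m)).symm
  have h := (hn.sub hmass).sqrt
  rw [sub_self, Real.sqrt_zero] at h
  refine h.congr fun n => ?_
  rw [← norm_sub_sum_sq (β n) (hr n), Real.sqrt_sq (norm_nonneg _)]

/-- Matrix elements of contractions between asymptotically orthonormal vectors that concentrate on
the retained basis vectors give convergence of the retained matrices up to a change of basis. -/
theorem gaugeTendsto_of_inner {R : ∀ n, Scheme (K n) (κ n)}
    (hr : ∀ n, Function.Injective (r n)) (hgram : ∀ m, Tendsto (fun n => ⟪v n m, v n m⟫_ℂ) l (𝓝 1))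
    (hmass : ∀ m, Tendsto (fun n => ∑ k, ‖⟪(R n).basis (r n k), v n m⟫_ℂ‖ ^ 2) l (𝓝 1))
    {A : ∀ n, K n →L[ℂ] K n} (hA : ∀ n (x y : K n), ‖⟪x, A n y⟫_ℂ‖ ≤ ‖x‖ * ‖y‖)
    {B : Matrix d d ℂ}
    (h : ∀ m m', Tendsto (fun n => ⟪v n m, A n (v n m')⟫_ℂ) l (𝓝 (B m m'))) :
    GaugeTendsto l (fun n => coeffMatrix (R n).basis (r n) (v n))
      (fun n => (R n).mat (r n) (A n)) B := by
  refine tendsto_pi_nhds.2 fun m => tendsto_pi_nhds.2 fun m' => ?_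
  simp only [conjTranspose_coeffMatrix_mul_mul]
  exact tendsto_inner_of_norm_sub hA (tendsto_norm_sub_sum hr m (hgram m) (hmass m))
    (tendsto_norm_sub_sum hr m' (hgram m') (hmass m')) (tendsto_norm_of_gram (hgram m))
    (tendsto_norm_of_gram (hgram m')) (h m m')

theorem tendsto_conjTranspose_coeffMatrix_mul [DecidableEq d] {R : ∀ n, Scheme (K n) (κ n)}
    (hr : ∀ n, Function.Injective (r n))
    (hgram : ∀ m m', Tendsto (fun n => ⟪v n m, v n m'⟫_ℂ) l (𝓝 (if m = m' then 1 else 0)))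
    (hmass : ∀ m, Tendsto (fun n => ∑ k, ‖⟪(R n).basis (r n k), v n m⟫_ℂ‖ ^ 2) l (𝓝 1)) :
    Tendsto (fun n => (coeffMatrix (R n).basis (r n) (v n))ᴴ *
      coeffMatrix (R n).basis (r n) (v n)) l (𝓝 1) := by
  have h := gaugeTendsto_of_inner (A := fun n => ContinuousLinearMap.id ℂ (K n))
    (B := (1 : Matrix d d ℂ)) hr
    (fun m => by simpa using hgram m m) hmass (fun n x y => norm_inner_le_norm _ _)
    (fun m m' => by simpa [Matrix.one_apply] using hgram m m')
  refine Tendsto.congr (fun n => ?_) h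
  have : (R n).mat (r n) (ContinuousLinearMap.id ℂ (K n)) = 1 := by
    ext k k'
    have ho := orthonormal_iff_ite.1 ((R n).basis.orthonormal.comp (r n) (hr n)) k k'
    simpa [Scheme.mat, Matrix.one_apply] using ho
  simp only [this, mul_one]

end Frames

/-! ### Integration of functions that are continuous on a compact set of full measure -/

section CompactSupport

theorem ae_mem_of_compl_null {M : Type*} [MeasurableSpace M] {X : Set M} {ν : Measure M}
    (hν : ν Xᶜ = 0) : ∀ᵐ x ∂ν, x ∈ X := hν

variable {M : Type*} [MetricSpace M] {X : Set M} {E : Type*} [NormedAddCommGroup E]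

theorem continuousOn_kernel_left {k : M → M → E} (hk : ContinuousOn (Function.uncurry k) (X ×ˢ X))
    {x : M} (hx : x ∈ X) : ContinuousOn (k x) X :=
  hk.comp (by fun_prop : ContinuousOn (fun y => (x, y)) X) fun _ hy => ⟨hx, hy⟩

theorem continuousOn_kernel_right {k : M → M → E}
    (hk : ContinuousOn (Function.uncurry k) (X ×ˢ X))
    {y : M} (hy : y ∈ X) : ContinuousOn (fun x => k x y) X :=
  hk.comp (by fun_prop : ContinuousOn (fun x => (x, y)) X) fun _ hx => ⟨hx, hy⟩

theorem exists_boundedContinuous_extension (hX : IsCompact X) {f : M → ℂ}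
    (hf : ContinuousOn f X) : ∃ g : BoundedContinuousFunction M ℂ, ∀ x ∈ X, g x = f x := by
  have : CompactSpace X := isCompact_iff_compactSpace.1 hX
  obtain ⟨C, hC⟩ := hX.exists_bound_of_continuousOn hf
  obtain ⟨u, hu⟩ := ContinuousMap.exists_restrict_eq hX.isClosed
    (⟨_, hf.domRestrict⟩ : C(X, ℂ))
  -- radial truncation of an arbitrary extension by `t ↦ max C' ‖t‖`
  have hu' : ∀ x ∈ X, u x = f x := fun x hx => DFunLike.congr_fun hu ⟨x, hx⟩
  have hpos : ∀ x, 0 < max (max C 1) ‖u x‖ := fun x =>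
    lt_of_lt_of_le (lt_of_lt_of_le one_pos (le_max_right C 1)) (le_max_left _ _)
  refine ⟨BoundedContinuousFunction.ofNormedAddCommGroup
    (fun x => ((max C 1 / max (max C 1) ‖u x‖ : ℝ) : ℂ) * u x) ?_ (max C 1) ?_, ?_⟩
  · have : Continuous fun x => max C 1 / max (max C 1) ‖u x‖ :=
      continuous_const.div (by fun_prop) fun x => (hpos x).ne'
    fun_prop
  · intro x
    have h1 : (0 : ℝ) < max C 1 := lt_of_lt_of_le one_pos (le_max_right C 1)
    rw [norm_mul, Complex.norm_real, Real.norm_of_nonneg (div_pos h1 (hpos x)).le,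
      div_mul_eq_mul_div, div_le_iff₀ (hpos x)]
    exact mul_le_mul_of_nonneg_left (le_max_right _ _) h1.le
  · intro x hx
    have h1 : (0 : ℝ) < max C 1 := lt_of_lt_of_le one_pos (le_max_right C 1)
    have h2 : ‖u x‖ ≤ max C 1 := by rw [hu' x hx]; exact (hC x hx).trans (le_max_left _ _)
    simp only [BoundedContinuousFunction.coe_ofNormedAddCommGroup]
    rw [max_eq_left h2, div_self h1.ne', Complex.ofReal_one, one_mul, hu' x hx]

variable [MeasurableSpace M] [BorelSpace M] {ν : Measure M}

theorem aestronglyMeasurable_of_continuousOn (hX : IsCompact X) (hν : ν Xᶜ = 0) {f : M → E}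
    (hf : ContinuousOn f X) : AEStronglyMeasurable f ν := by
  rw [← Measure.restrict_eq_self_of_ae_mem (ae_mem_of_compl_null hν)]
  exact hf.aestronglyMeasurable_of_isCompact hX hX.measurableSet

theorem memLp_of_continuousOn [IsFiniteMeasure ν] (hX : IsCompact X) (hν : ν Xᶜ = 0) {f : M → E}
    (hf : ContinuousOn f X) (p : ℝ≥0∞) : MemLp f p ν := by
  obtain ⟨C, hC⟩ := hX.exists_bound_of_continuousOn hf
  refine MemLp.of_bound (aestronglyMeasurable_of_continuousOn hX hν hf) C ?_
  filter_upwards [ae_mem_of_compl_null hν] with x hx using hC x hx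

theorem integrable_of_continuousOn [IsFiniteMeasure ν] (hX : IsCompact X) (hν : ν Xᶜ = 0)
    {f : M → E} (hf : ContinuousOn f X) : Integrable f ν :=
  memLp_one_iff_integrable.1 (memLp_of_continuousOn hX hν hf 1)

theorem integral_eq_integral_subtype [NormedSpace ℝ E] (hX : IsCompact X) (hν : ν Xᶜ = 0)
    (f : M → E) : ∫ x, f x ∂ν = ∫ x : X, f x ∂(ν.comap (↑)) := by
  rw [integral_subtype_comap hX.measurableSet,
    Measure.restrict_eq_self_of_ae_mem (ae_mem_of_compl_null hν)]

theorem integrable_subtype (hX : IsCompact X) {f : M → E} (hf : Integrable f ν) :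
    Integrable (fun x : X => f x) (ν.comap (↑)) :=
  (integrableOn_iff_comap_subtypeVal hX.measurableSet).1 hf.integrableOn

theorem continuousOn_integral_kernel [NormedSpace ℝ E] [IsFiniteMeasure ν] (hX : IsCompact X)
    (hν : ν Xᶜ = 0) {k : M → M → E} (hk : ContinuousOn (Function.uncurry k) (X ×ˢ X)) :
    ContinuousOn (fun x => ∫ y, k x y ∂ν) X := by
  obtain ⟨C, hC⟩ := (hX.prod hX).exists_bound_of_continuousOn hk
  refine continuousOn_of_dominated (bound := fun _ => C)
    (fun x hx => aestronglyMeasurable_of_continuousOn hX hν (continuousOn_kernel_left hk hx))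
    (fun x hx => ?_) (integrable_const C) ?_
  · filter_upwards [ae_mem_of_compl_null hν] with y hy using hC (x, y) ⟨hx, hy⟩
  · filter_upwards [ae_mem_of_compl_null hν] with y hy using continuousOn_kernel_right hk hy

theorem continuousOn_kernelInt (hX : IsCompact X)
    (hν : ν Xᶜ = 0) {k : M → M → ℝ} (hk : ContinuousOn (Function.uncurry k) (X ×ˢ X))
    {f : M → ℂ} (hf : Integrable f ν) :
    ContinuousOn (kernelInt k ν f) X := by
  obtain ⟨C, hC⟩ := (hX.prod hX).exists_bound_of_continuousOn hk
  refine continuousOn_of_dominated (bound := fun y => C * ‖f y‖)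
    (fun x hx => ?_) (fun x hx => ?_) (hf.norm.const_mul C) ?_
  · exact (aestronglyMeasurable_of_continuousOn hX hν (Complex.continuous_ofReal.comp_continuousOn
      (continuousOn_kernel_left hk hx))).mul hf.1
  · filter_upwards [ae_mem_of_compl_null hν] with y hy
    rw [norm_mul, Complex.norm_real]
    exact mul_le_mul_of_nonneg_right (hC (x, y) ⟨hx, hy⟩) (norm_nonneg _)
  · filter_upwards [ae_mem_of_compl_null hν] with y hy
    exact (Complex.continuous_ofReal.comp_continuousOn
      (continuousOn_kernel_right hk hy)).mul continuousOn_const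

theorem integrable_kernel_mul (hX : IsCompact X) (hν : ν Xᶜ = 0) {k : M → M → ℝ} (hk : IsKernelOn X k)
    {f : M → ℝ} (hf : Integrable f ν) {x : M} (hx : x ∈ X) :
    Integrable (fun y => k x y * f y) ν := by
  have hc := continuousOn_kernel_left hk.1 hx
  obtain ⟨C, hC⟩ := hX.exists_bound_of_continuousOn hc
  refine hf.bdd_mul (c := C) (aestronglyMeasurable_of_continuousOn hX hν hc) ?_
  filter_upwards [ae_mem_of_compl_null hν] with y hy using hC y hy

/-- The integral operator of a symmetric kernel is symmetric. The product of the `σ`-algebras of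
`M` need not contain the open sets of `M × M`, so Fubini's theorem is used on the compact set. -/
theorem integral_mul_kernelInt [IsFiniteMeasure ν] (hX : IsCompact X) (hν : ν Xᶜ = 0)
    {k : M → M → ℝ} (hk : IsKernelOn X k) {f g : M → ℂ} (hf : Integrable f ν)
    (hg : Integrable g ν) :
    ∫ x, g x * kernelInt k ν f x ∂ν = ∫ x, kernelInt k ν g x * f x ∂ν := by
  have : CompactSpace X := isCompact_iff_compactSpace.1 hX
  set τ : Measure X := ν.comap (↑) with hτ
  have hkc : Continuous fun z : X × X => (k z.1 z.2 : ℂ) := by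
    have : Continuous fun z : X × X => (⟨(z.1 : M), (z.2 : M)⟩ : M × M) := by fun_prop
    exact Complex.continuous_ofReal.comp
      (hk.1.comp_continuous this fun z => ⟨z.1.2, z.2.2⟩)
  have hint : Integrable (Function.uncurry fun x y : X => g x * ((k x y : ℂ) * f y))
      (τ.prod τ) := by
    have h1 : Integrable (fun z : X × X => g z.1 * f z.2) (τ.prod τ) :=
      (integrable_subtype hX hg).mul_prod (integrable_subtype hX hf)
    obtain ⟨C, hC⟩ := isCompact_univ.exists_bound_of_continuousOn hkc.continuousOn
    have h2 := h1.bdd_mul (c := C) hkc.aestronglyMeasurable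
      (Eventually.of_forall fun z => hC z trivial)
    refine h2.congr (Eventually.of_forall fun z => ?_)
    simp only [Function.uncurry]
    ring
  simp only [kernelInt, integral_eq_integral_subtype hX hν]
  simp only [← integral_const_mul, ← integral_mul_const]
  rw [integral_integral_swap hint]
  refine integral_congr_ae (Eventually.of_forall fun y => ?_)
  refine integral_congr_ae (Eventually.of_forall fun x => ?_)
  simp only [hk.2.1 _ y.2 _ x.2]
  ring

end CompactSupport

/-! ### Weak convergence tested on functions that are continuous on a compact set -/

section WeakConvergence

variable {M : Type*} [MetricSpace M] [MeasurableSpace M] {X : Set M}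
  {ν : ℕ → Measure M} {μ : Measure M}

/-- Weak convergence of subprobability measures that are carried by a compact set. -/
structure WeakConvOn (X : Set M) (ν : ℕ → Measure M) (μ : Measure M) : Prop where
  isCompact : IsCompact X
  finite : ∀ N, IsFiniteMeasure (ν N)
  prob : IsProbabilityMeasure μ
  mass_le : ∀ N, (ν N).real Set.univ ≤ 1
  null : ∀ N, ν N Xᶜ = 0
  null_limit : μ Xᶜ = 0
  tendsto : ∀ f : BoundedContinuousFunction M ℂ,
    Tendsto (fun N => ∫ x, f x ∂(ν N)) atTop (𝓝 (∫ x, f x ∂μ))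

namespace WeakConvOn

theorem tendsto_integral (h : WeakConvOn X ν μ) {f : M → ℂ} (hf : ContinuousOn f X) :
    Tendsto (fun N => ∫ x, f x ∂(ν N)) atTop (𝓝 (∫ x, f x ∂μ)) := by
  obtain ⟨g, hg⟩ := exists_boundedContinuous_extension h.isCompact hf
  have h1 : ∀ τ : Measure M, τ Xᶜ = 0 → ∫ x, g x ∂τ = ∫ x, f x ∂τ := fun τ hτ =>
    integral_congr_ae (by filter_upwards [ae_mem_of_compl_null hτ] with x hx using hg x hx)
  have := h.tendsto g
  rw [h1 μ h.null_limit] at this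
  exact this.congr fun N => h1 _ (h.null N)

theorem tendsto_integral_real (h : WeakConvOn X ν μ) {f : M → ℝ} (hf : ContinuousOn f X) :
    Tendsto (fun N => ∫ x, f x ∂(ν N)) atTop (𝓝 (∫ x, f x ∂μ)) := by
  have h1 := h.tendsto_integral (f := fun x => (f x : ℂ))
    (Complex.continuous_ofReal.comp_continuousOn hf)
  have h2 := (Complex.continuous_re.tendsto _).comp h1
  simp only [integral_complex_ofReal, Complex.ofReal_re] at h2
  exact h2.congr fun N => by simp

variable [BorelSpace M]

/-- Weak convergence is uniform over a compact family of test functions, and remains so when the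
family is approximated uniformly. -/
theorem tendstoUniformlyOn_integral (h : WeakConvOn X ν μ) {k : M → M → ℂ} {kN : ℕ → M → M → ℂ}
    (hk : ContinuousOn (Function.uncurry k) (X ×ˢ X))
    (hkN : ∀ᶠ N in atTop, ContinuousOn (Function.uncurry (kN N)) (X ×ˢ X))
    (hconv : TendstoUniformlyOn (fun N (z : M × M) => kN N z.1 z.2) (fun z => k z.1 z.2) atTop
      (X ×ˢ X)) :
    TendstoUniformlyOn (fun N x => ∫ y, kN N x y ∂(ν N)) (fun x => ∫ y, k x y ∂μ) atTop X := by
  have := h.finite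
  have := h.prob
  have hX := h.isCompact
  -- integrals of functions that are uniformly close are close
  have hclose : ∀ (τ : Measure M) [IsFiniteMeasure τ], τ.real Set.univ ≤ 1 → τ Xᶜ = 0 →
      ∀ (f g : M → ℂ) (ε : ℝ), 0 ≤ ε → ContinuousOn f X → ContinuousOn g X →
      (∀ y ∈ X, ‖f y - g y‖ ≤ ε) → ‖∫ y, f y ∂τ - ∫ y, g y ∂τ‖ ≤ ε := by
    intro τ _ hτ1 hτ f g ε hε hf hg hfg
    rw [← integral_sub (integrable_of_continuousOn hX hτ hf) (integrable_of_continuousOn hX hτ hg)]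
    refine (norm_integral_le_of_norm_le_const (C := ε) ?_).trans
      (mul_le_of_le_one_right hε hτ1)
    filter_upwards [ae_mem_of_compl_null hτ] with y hy using hfg y hy
  rw [Metric.tendstoUniformlyOn_iff] at hconv ⊢
  intro ε hε
  obtain ⟨δ, hδ, hδk⟩ := Metric.uniformContinuousOn_iff.1
    ((hX.prod hX).uniformContinuousOn_of_continuous hk) (ε / 5) (by positivity)
  obtain ⟨t, htX, htf, htc⟩ := hX.finite_cover_balls hδ
  have hpt : ∀ᶠ N in atTop, ∀ x ∈ t, ‖∫ y, k x y ∂(ν N) - ∫ y, k x y ∂μ‖ < ε / 5 := by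
    refine (htf.eventually_all).2 fun x hx => ?_
    have := h.tendsto_integral (continuousOn_kernel_left hk (htX hx))
    filter_upwards [(Metric.tendsto_nhds.1 this) (ε / 5) (by positivity)] with N hN
    rwa [dist_eq_norm] at hN
  filter_upwards [hpt, hkN, hconv (ε / 5) (by positivity)] with N h1 h2 h3 x hx
  obtain ⟨z, hz, hxz⟩ := Set.mem_iUnion₂.1 (htc hx)
  have hzX := htX hz
  have hkxz : ∀ y ∈ X, ‖k x y - k z y‖ ≤ ε / 5 := fun y hy => by
    have := hδk (x, y) ⟨hx, hy⟩ (z, y) ⟨hzX, hy⟩ (by simpa [Prod.dist_eq, hδ] using hxz)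
    rw [dist_eq_norm] at this
    exact this.le
  have e1 : ‖∫ y, kN N x y ∂(ν N) - ∫ y, k x y ∂(ν N)‖ ≤ ε / 5 :=
    hclose (ν N) (h.mass_le N) (h.null N) _ _ _ (by positivity) (continuousOn_kernel_left h2 hx)
      (continuousOn_kernel_left hk hx) fun y hy => by
        have := h3 (x, y) ⟨hx, hy⟩
        rw [dist_comm, dist_eq_norm] at this
        exact this.le
  have e2 : ‖∫ y, k x y ∂(ν N) - ∫ y, k z y ∂(ν N)‖ ≤ ε / 5 :=
    hclose (ν N) (h.mass_le N) (h.null N) _ _ _ (by positivity) (continuousOn_kernel_left hk hx)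
      (continuousOn_kernel_left hk hzX) hkxz
  have e3 := h1 z hz
  have e4 : ‖∫ y, k x y ∂μ - ∫ y, k z y ∂μ‖ ≤ ε / 5 :=
    hclose μ (by simp) h.null_limit _ _ _ (by positivity) (continuousOn_kernel_left hk hx)
      (continuousOn_kernel_left hk hzX) hkxz
  rw [dist_comm, dist_eq_norm]
  have : ∫ y, kN N x y ∂(ν N) - ∫ y, k x y ∂μ =
      (∫ y, kN N x y ∂(ν N) - ∫ y, k x y ∂(ν N)) + (∫ y, k x y ∂(ν N) - ∫ y, k z y ∂(ν N)) +
      (∫ y, k z y ∂(ν N) - ∫ y, k z y ∂μ) - (∫ y, k x y ∂μ - ∫ y, k z y ∂μ) := by ring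
  rw [this]
  refine (norm_sub_le _ _).trans_lt ?_
  have h5 := norm_add₃_le (a := ∫ y, kN N x y ∂(ν N) - ∫ y, k x y ∂(ν N))
    (b := ∫ y, k x y ∂(ν N) - ∫ y, k z y ∂(ν N)) (c := ∫ y, k z y ∂(ν N) - ∫ y, k z y ∂μ)
  linarith

/-- Integrals of uniformly converging functions converge. -/
theorem tendsto_integral_of_tendstoUniformlyOn (h : WeakConvOn X ν μ) {f : M → ℂ}
    {fN : ℕ → M → ℂ} (hf : ContinuousOn f X) (hfN : ∀ᶠ N in atTop, ContinuousOn (fN N) X)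
    (hconv : TendstoUniformlyOn fN f atTop X) :
    Tendsto (fun N => ∫ x, fN N x ∂(ν N)) atTop (𝓝 (∫ x, f x ∂μ)) := by
  rcases X.eq_empty_or_nonempty with hXe | ⟨x, hx⟩
  · exact absurd h.null_limit (by simp [hXe, h.prob.measure_univ])
  have hu := h.tendstoUniformlyOn_integral (k := fun _ y => f y) (kN := fun N _ y => fN N y)
    (hf.comp continuousOn_snd fun z hz => hz.2)
    (hfN.mono fun N hN => hN.comp continuousOn_snd fun z hz => hz.2)
    (by
      rw [Metric.tendstoUniformlyOn_iff] at hconv ⊢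
      exact fun ε hε => (hconv ε hε).mono fun N hN z hz => hN z.2 hz.2)
  exact hu.tendsto_at hx

end WeakConvOn

end WeakConvergence

/-! ### Eigenbases of kernel integral operators -/

section Eigenbases

variable {M : Type*} [MeasurableSpace M] {ν : Measure M} {ι : Type*} {k : M → M → ℝ}

theorem inner_toLp_eq_integral {f : M → ℂ} (hf : MemLp f 2 ν) (g : Lp ℂ 2 ν) :
    ⟪g, hf.toLp f⟫_ℂ = ∫ x, (starRingEnd ℂ) (g x) * f x ∂ν := by
  rw [L2.inner_def]
  refine integral_congr_ae ?_
  filter_upwards [hf.coeFn_toLp] with x hx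
  rw [hx, RCLike.inner_apply, mul_comm]

theorem integral_norm_sq_eq (f : Lp ℂ 2 ν) : ∫ x, ‖f x‖ ^ 2 ∂ν = ‖f‖ ^ 2 := by
  rw [norm_sq_eq_re_inner (𝕜 := ℂ) f, L2.inner_def]
  have : ∀ x, ⟪f x, f x⟫_ℂ = ((‖f x‖ ^ 2 : ℝ) : ℂ) := fun x => by
    rw [inner_self_eq_norm_sq_to_K]; simp
  simp only [this]
  rw [integral_complex_ofReal]
  simp

theorem integral_norm_sq_toLp {f : M → ℂ} (hf : MemLp f 2 ν) :
    ‖hf.toLp f‖ ^ 2 = ∫ x, ‖f x‖ ^ 2 ∂ν := by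
  rw [← integral_norm_sq_eq]
  refine integral_congr_ae ?_
  filter_upwards [hf.coeFn_toLp] with x hx
  rw [hx]

theorem hasSum_norm_inner_sq {K : Type*} [NormedAddCommGroup K] [InnerProductSpace ℂ K]
    (b : HilbertBasis ι ℂ K) (f : K) : HasSum (fun j => ‖⟪b j, f⟫_ℂ‖ ^ 2) (‖f‖ ^ 2) := by
  have h := (b.hasSum_inner_mul_inner f f).mapL Complex.reCLM
  have h2 : Complex.reCLM ⟪f, f⟫_ℂ = ‖f‖ ^ 2 := (norm_sq_eq_re_inner (𝕜 := ℂ) f).symm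
  rw [h2] at h
  refine h.congr_fun fun j => ?_
  rw [← inner_conj_symm f (b j), Complex.conj_mul']
  simp [← Complex.ofReal_pow]

theorem kernelInt_ofReal (f : M → ℝ) (x : M) :
    kernelInt k ν (fun y => (f y : ℂ)) x = ((∫ y, k x y * f y ∂ν : ℝ) : ℂ) := by
  rw [kernelInt, ← integral_complex_ofReal]
  simp

theorem kernelInt_conj (f : M → ℂ) (x : M) :
    kernelInt k ν (fun y => (starRingEnd ℂ) (f y)) x = (starRingEnd ℂ) (kernelInt k ν f x) := by
  rw [kernelInt, kernelInt, ← integral_conj]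
  simp

variable [IsFiniteMeasure ν]

theorem integrable_Lp_two (f : Lp ℂ 2 ν) : Integrable f ν :=
  (Lp.memLp f).integrable (by norm_num)

variable [MetricSpace M] [BorelSpace M] {X : Set M} {b : HilbertBasis ι ℂ (Lp ℂ 2 ν)}
  {lam : ι → ℝ}

/-- Eigenfunctions diagonalize the integral operator of a symmetric kernel. -/
theorem inner_kernelInt (hX : IsCompact X) (hν : ν Xᶜ = 0) (hk : IsKernelOn X k) {c : ℝ}
    {g : Lp ℂ 2 ν} (hg : IsEigen k ν c g) {f : M → ℂ} (hf : Integrable f ν) :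
    ∫ x, (starRingEnd ℂ) (g x) * kernelInt k ν f x ∂ν =
      c * ∫ x, (starRingEnd ℂ) (g x) * f x ∂ν := by
  have hgc : Integrable (fun x => (starRingEnd ℂ) (g x)) ν :=
    (integrable_Lp_two g).congr' (Complex.continuous_conj.comp_aestronglyMeasurable
      (integrable_Lp_two g).1) (Eventually.of_forall fun x => by simp)
  rw [integral_mul_kernelInt hX hν hk hf hgc, ← integral_const_mul]
  refine integral_congr_ae ?_
  filter_upwards [hg] with x hx
  rw [kernelInt_conj, hx, map_mul, Complex.conj_ofReal]
  ring

/-- The squared Hilbert–Schmidt norm of the integral operator is the sum of the squared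
eigenvalues: Parseval's identity for the sections `k x`, integrated over `x`. -/
theorem hasSum_eigenvalue_sq [Countable ι] (hX : IsCompact X) (hν : ν Xᶜ = 0)
    (hk : IsKernelOn X k) (hb : ∀ j, IsEigen k ν (lam j) (b j)) :
    HasSum (fun j => lam j ^ 2) (∫ x, ∫ y, k x y ^ 2 ∂ν ∂ν) := by
  have hsec : ∀ x ∈ X, HasSum (fun j => ‖kernelInt k ν (b j) x‖ ^ 2) (∫ y, k x y ^ 2 ∂ν) := by
    intro x hx
    have hm : MemLp (fun y => (k x y : ℂ)) 2 ν := memLp_of_continuousOn hX hν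
      (Complex.continuous_ofReal.comp_continuousOn (continuousOn_kernel_left hk.1 hx)) 2
    have h := hasSum_norm_inner_sq b (hm.toLp _)
    rw [integral_norm_sq_toLp] at h
    simp only [Complex.norm_real, Real.norm_eq_abs, sq_abs] at h
    refine h.congr_fun fun j => ?_
    rw [inner_toLp_eq_integral, ← Complex.norm_conj (kernelInt k ν (b j) x), ← kernelInt_conj,
      kernelInt]
    simp only [mul_comm]
  have hae : ∀ᵐ x ∂ν, HasSum (fun j => lam j ^ 2 * ‖b j x‖ ^ 2) (∫ y, k x y ^ 2 ∂ν) := by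
    filter_upwards [ae_mem_of_compl_null hν, ae_all_iff.2 hb] with x hx hbx
    refine (hsec x hx).congr_fun fun j => ?_
    rw [hbx j, norm_mul, Complex.norm_real, mul_pow, Real.norm_eq_abs, sq_abs]
  have hk2 : ContinuousOn (Function.uncurry fun x y => k x y ^ 2) (X ×ˢ X) := hk.1.pow 2
  have hint : Integrable (fun x => ∫ y, k x y ^ 2 ∂ν) ν :=
    integrable_of_continuousOn hX hν (continuousOn_integral_kernel hX hν hk2)
  have hG : ENNReal.ofReal (∫ x, ∫ y, k x y ^ 2 ∂ν ∂ν) = ∑' j, ENNReal.ofReal (lam j ^ 2) := by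
    rw [ofReal_integral_eq_lintegral_ofReal hint
      (Eventually.of_forall fun x => integral_nonneg fun y => sq_nonneg _)]
    have h1 : ∫⁻ x, ENNReal.ofReal (∫ y, k x y ^ 2 ∂ν) ∂ν =
        ∫⁻ x, ∑' j, ENNReal.ofReal (lam j ^ 2 * ‖b j x‖ ^ 2) ∂ν := by
      refine lintegral_congr_ae ?_
      filter_upwards [hae] with x hx
      rw [← hx.tsum_eq, ENNReal.ofReal_tsum_of_nonneg (fun j => by positivity) hx.summable]
    have hbi : ∀ j, Integrable (fun x => ‖b j x‖ ^ 2) ν := fun j => (Lp.memLp (b j)).norm.integrable_sq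
    rw [h1, lintegral_tsum fun j => ((hbi j).const_mul _).aemeasurable.ennreal_ofReal]
    refine tsum_congr fun j => ?_
    rw [← ofReal_integral_eq_lintegral_ofReal ((hbi j).const_mul _)
      (Eventually.of_forall fun x => by positivity), integral_const_mul, integral_norm_sq_eq,
      b.orthonormal.1 j]
    simp
  have hne : ∑' j, ENNReal.ofReal (lam j ^ 2) ≠ ∞ := by rw [← hG]; exact ENNReal.ofReal_ne_top
  have h := ENNReal.hasSum_toReal hne
  rw [← ENNReal.tsum_toReal_eq (fun j => ENNReal.ofReal_ne_top), ← hG, ENNReal.toReal_ofReal (integral_nonneg fun x => integral_nonneg fun y => sq_nonneg _)]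
    at h
  exact h.congr_fun fun j => (ENNReal.toReal_ofReal (sq_nonneg _)).symm

/-- A function that is nearly an eigenfunction, uniformly on `X`, has a small residual. -/
theorem sum_residual_le [Fintype ι] (hX : IsCompact X) (hν : ν Xᶜ = 0) (hν1 : ν.real Set.univ ≤ 1)
    (hk : IsKernelOn X k) (hb : ∀ j, IsEigen k ν (lam j) (b j)) {f : M → ℂ}
    (hf : ContinuousOn f X) {c ε : ℝ} (h : ∀ x ∈ X, ‖kernelInt k ν f x - c * f x‖ ≤ ε)
    {v : Lp ℂ 2 ν} (hv : v =ᵐ[ν] f) :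
    ∑ j, (lam j - c) ^ 2 * ‖⟪b j, v⟫_ℂ‖ ^ 2 ≤ ε ^ 2 := by
  have hfi := integrable_of_continuousOn hX hν hf
  have hr : ContinuousOn (fun x => kernelInt k ν f x - c * f x) X :=
    (continuousOn_kernelInt hX hν hk.1 hfi).sub (continuousOn_const.mul hf)
  have hrm := memLp_of_continuousOn hX hν hr 2
  have hcoef : ∀ j, ⟪b j, hrm.toLp _⟫_ℂ = ((lam j - c : ℝ) : ℂ) * ⟪b j, v⟫_ℂ := by
    intro j
    have hbv : ⟪b j, v⟫_ℂ = ∫ x, (starRingEnd ℂ) (b j x) * f x ∂ν := by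
      rw [L2.inner_def]
      refine integral_congr_ae ?_
      filter_upwards [hv] with x hx
      rw [hx, RCLike.inner_apply, mul_comm]
    have hI : ∀ g : M → ℂ, ContinuousOn g X →
        Integrable (fun x => (starRingEnd ℂ) (b j x) * g x) ν := by
      intro g hg
      have h2 := L2.integrable_inner (𝕜 := ℂ) (b j) ((memLp_of_continuousOn hX hν hg 2).toLp g)
      refine h2.congr ?_
      filter_upwards [(memLp_of_continuousOn hX hν hg 2).coeFn_toLp] with x hx
      rw [hx, RCLike.inner_apply, mul_comm]
    rw [inner_toLp_eq_integral]
    simp only [mul_sub]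
    rw [integral_sub (hI _ (continuousOn_kernelInt hX hν hk.1 hfi))
      (hI (fun x => (c : ℂ) * f x) (continuousOn_const.mul hf)), inner_kernelInt hX hν hk (hb j) hfi, hbv]
    have : ∀ x, (starRingEnd ℂ) (b j x) * ((c : ℂ) * f x) =
      c * ((starRingEnd ℂ) (b j x) * f x) := fun x => by ring
    simp only [this, integral_const_mul]
    push_cast
    ring
  have hsum := (hasSum_norm_inner_sq b (hrm.toLp _)).unique (hasSum_fintype _)
  have hterm : ∀ j, (lam j - c) ^ 2 * ‖⟪b j, v⟫_ℂ‖ ^ 2 = ‖⟪b j, hrm.toLp _⟫_ℂ‖ ^ 2 := fun j => by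
    rw [hcoef j, norm_mul, Complex.norm_real, mul_pow, Real.norm_eq_abs, sq_abs]
  simp only [hterm]
  rw [← hsum, integral_norm_sq_toLp]
  have hle : ∫ x, ‖kernelInt k ν f x - c * f x‖ ^ 2 ∂ν ≤ ∫ _x, ε ^ 2 ∂ν := by
    refine integral_mono_ae (integrable_of_continuousOn hX hν (hr.norm.pow 2))
      (integrable_const _) ?_
    filter_upwards [ae_mem_of_compl_null hν] with x hx
    exact pow_le_pow_left₀ (norm_nonneg _) (h x hx) 2
  refine hle.trans ?_
  rw [integral_const, smul_eq_mul]
  exact mul_le_of_le_one_left (sq_nonneg _) hν1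

end Eigenbases

/-! ### The top of the spectrum of an ergodic Markov kernel -/

section Markov

variable {M : Type*} [MetricSpace M] [MeasurableSpace M] [BorelSpace M] {X : Set M}
  {ν : Measure M} [IsProbabilityMeasure ν] {k : M → M → ℝ}

theorem integral_kernelInt_of_markov (hX : IsCompact X) (hν : ν Xᶜ = 0) (hk : IsKernelOn X k)
    (hm : KernelMarkov k ν) {f : M → ℂ} (hf : Integrable f ν) :
    ∫ x, kernelInt k ν f x ∂ν = ∫ x, f x ∂ν := by
  have h := integral_mul_kernelInt hX hν hk hf (integrable_const (1 : ℂ))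
  simp only [one_mul] at h
  rw [h]
  refine integral_congr_ae ?_
  filter_upwards [hm.2] with x hx
  have h1 := kernelInt_ofReal (k := k) (ν := ν) (fun _ => 1) x
  simp only [Complex.ofReal_one, mul_one] at h1
  rw [h1, hx, Complex.ofReal_one, one_mul]

/-- Real eigenfunctions of a Markov operator `G` have eigenvalues at most `1`:
`|c| |f| = |G f| ≤ G |f|`, and `G` preserves integrals. -/
theorem le_one_of_real_eigen (hX : IsCompact X) (hν : ν Xᶜ = 0) (hk : IsKernelOn X k)
    (hm : KernelMarkov k ν) {f : M → ℝ} (hf : MemLp f 2 ν) {c : ℝ}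
    (he : ∀ᵐ x ∂ν, ∫ y, k x y * f y ∂ν = c * f x) (hne : ¬ f =ᵐ[ν] 0) : c ≤ 1 := by
  have hfi : Integrable f ν := hf.integrable (by norm_num)
  have hpos : ∀ g : M → ℝ, MemLp g 2 ν → 0 ≤ᵐ[ν] g → ∀ᵐ x ∂ν, 0 ≤ ∫ y, k x y * g y ∂ν := by
    intro g hg hg0
    have h1 := hm.1 (hg.toLp g) (by
      filter_upwards [hg0, hg.coeFn_toLp] with x hx hx'
      rw [hx']; exact hx)
    filter_upwards [h1] with x hx
    have : ∫ y, k x y * (hg.toLp g) y ∂ν = ∫ y, k x y * g y ∂ν := by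
      refine integral_congr_ae ?_
      filter_upwards [hg.coeFn_toLp] with y hy
      rw [hy]
    rwa [this] at hx
  have hle : ∀ᵐ x ∂ν, c * |f x| ≤ ∫ y, k x y * |f y| ∂ν := by
    filter_upwards [hpos (fun y => |f y| - f y) (hf.abs.sub hf)
        (Eventually.of_forall fun y => sub_nonneg.2 (le_abs_self _)),
      hpos (fun y => |f y| + f y) (hf.abs.add hf)
        (Eventually.of_forall fun y => by have := neg_abs_le (f y); simp only [Pi.zero_apply]; linarith),
      he, ae_mem_of_compl_null hν] with x h1 h2 h3 hx
    have i1 := integrable_kernel_mul hX hν hk hfi hx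
    have i2 := integrable_kernel_mul hX hν hk hfi.abs hx
    simp only [mul_sub] at h1
    simp only [mul_add] at h2
    rw [integral_sub i2 i1, h3] at h1
    rw [integral_add i2 i1, h3] at h2
    rcases abs_cases (f x) with ⟨h, _⟩ | ⟨h, _⟩ <;> rw [h] <;> linarith
  have hI : ∫ x, ∫ y, k x y * |f y| ∂ν ∂ν = ∫ x, |f x| ∂ν := by
    have h := integral_kernelInt_of_markov hX hν hk hm (f := fun y => ((|f y| : ℝ) : ℂ))
      hfi.abs.ofReal
    simp only [kernelInt_ofReal, integral_complex_ofReal] at h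
    exact_mod_cast h
  have hcont : Integrable (fun x => ∫ y, k x y * |f y| ∂ν) ν := by
    have h := integrable_of_continuousOn hX hν (continuousOn_kernelInt hX hν hk.1
      (f := fun y => ((|f y| : ℝ) : ℂ)) hfi.abs.ofReal)
    have h2 := h.re
    simpa [kernelInt_ofReal] using h2
  have hfin := integral_mono_ae (hfi.abs.const_mul c) hcont hle
  rw [integral_const_mul, hI] at hfin
  have hposI : 0 < ∫ x, |f x| ∂ν := by
    refine lt_of_le_of_ne (integral_nonneg fun x => abs_nonneg _) fun h0 => hne ?_
    have := (integral_eq_zero_iff_of_nonneg (fun x => abs_nonneg _) hfi.abs).1 h0.symm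
    filter_upwards [this] with x hx
    simpa using hx
  nlinarith

theorem eigenvalue_le_one (hX : IsCompact X) (hν : ν Xᶜ = 0) (hk : IsKernelOn X k)
    (hm : KernelMarkov k ν) {f : Lp ℂ 2 ν} (hf : f ≠ 0) {c : ℝ} (he : IsEigen k ν c f) :
    c ≤ 1 := by
  have hfi := integrable_Lp_two f
  have hki : ∀ x ∈ X, Integrable (fun y => (k x y : ℂ) * f y) ν := by
    intro x hx
    have hc := Complex.continuous_ofReal.comp_continuousOn (continuousOn_kernel_left hk.1 hx)
    obtain ⟨C, hC⟩ := hX.exists_bound_of_continuousOn hc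
    refine hfi.bdd_mul (c := C) (aestronglyMeasurable_of_continuousOn hX hν hc) ?_
    filter_upwards [ae_mem_of_compl_null hν] with y hy using hC y hy
  by_cases hre : (fun x => (f x).re) =ᵐ[ν] 0
  · refine le_one_of_real_eigen hX hν hk hm (f := fun x => (f x).im) (Lp.memLp f).im ?_ ?_
    · filter_upwards [he, ae_mem_of_compl_null hν] with x hx hxX
      have h := congrArg Complex.im hx
      rw [kernelInt] at h
      have h2 : (∫ y, (k x y : ℂ) * f y ∂ν).im = ∫ y, ((k x y : ℂ) * f y).im ∂ν :=
        (integral_im (hki x hxX)).symm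
      rw [h2] at h
      simpa using h
    · intro him
      refine hf ((Lp.eq_zero_iff_ae_eq_zero).2 ?_)
      filter_upwards [hre, him] with x h1 h2
      exact Complex.ext (by simpa using h1) (by simpa using h2)
  · refine le_one_of_real_eigen hX hν hk hm (f := fun x => (f x).re) (Lp.memLp f).re ?_ hre
    filter_upwards [he, ae_mem_of_compl_null hν] with x hx hxX
    have h := congrArg Complex.re hx
    rw [kernelInt] at h
    have h2 : (∫ y, (k x y : ℂ) * f y ∂ν).re = ∫ y, ((k x y : ℂ) * f y).re ∂ν :=
      (integral_re (hki x hxX)).symm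
    rw [h2] at h
    simpa using h

/-- For an ergodic Markov kernel the leading eigenfunction is constant and the leading
eigenvalue is simple. -/
theorem leading_eigenfunction (hX : IsCompact X) (hν : ν Xᶜ = 0) (hk : IsKernelOn X k)
    (hm : KernelMarkov k ν) (he : KernelErgodic k ν) {b : HilbertBasis ℕ ℂ (Lp ℂ 2 ν)}
    {lam : ℕ → ℝ} (hb : IsEigenbasis k ν b lam) :
    lam 1 < lam 0 ∧ ∃ c : ℂ, ‖c‖ = 1 ∧ Lp.const 2 ν (1 : ℂ) = c • b 0 := by
  have hbne : ∀ j, b j ≠ 0 := fun j h0 => by simpa [h0] using b.orthonormal.1 j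
  have hle : ∀ j, lam j ≤ 1 := fun j => eigenvalue_le_one hX hν hk hm (hbne j) (hb.1 j)
  set u : Lp ℂ 2 ν := Lp.const 2 ν (1 : ℂ) with hu
  have huae : u =ᵐ[ν] fun _ => (1 : ℂ) := Lp.coeFn_const 2 ν (1 : ℂ)
  have hu1 : ‖u‖ = 1 := by
    have h := integral_norm_sq_eq u
    have h2 : ∫ x, ‖u x‖ ^ 2 ∂ν = 1 := by
      have : ∫ x, ‖u x‖ ^ 2 ∂ν = ∫ _x, (1 : ℝ) ∂ν := by
        refine integral_congr_ae ?_
        filter_upwards [huae] with x hx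
        simp [hx]
      simpa using this
    rw [h2] at h
    nlinarith [norm_nonneg u]
  have hinner : ∀ j, ⟪b j, u⟫_ℂ = ∫ x, (starRingEnd ℂ) (b j x) * 1 ∂ν := by
    intro j
    rw [L2.inner_def]
    refine integral_congr_ae ?_
    filter_upwards [huae] with x hx
    rw [hx, RCLike.inner_apply, mul_comm]
  have hcoef : ∀ j, ⟪b j, u⟫_ℂ = lam j * ⟪b j, u⟫_ℂ := by
    intro j
    have h := inner_kernelInt hX hν hk (hb.1 j) (integrable_const (1 : ℂ))
    rw [← hinner] at h
    rw [← h, hinner]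
    refine integral_congr_ae ?_
    filter_upwards [hm.2] with x hx
    have h1 := kernelInt_ofReal (k := k) (ν := ν) (fun _ => 1) x
    simp only [Complex.ofReal_one, mul_one] at h1
    rw [h1, hx, Complex.ofReal_one]
  obtain ⟨j, hj⟩ : ∃ j, ⟪b j, u⟫_ℂ ≠ 0 := by
    by_contra hcon
    push Not at hcon
    have h := hasSum_norm_inner_sq b u
    simp only [hcon, norm_zero, hu1] at h
    have h0 : HasSum (fun _ : ℕ => (0 : ℝ) ^ 2) 0 := by simp
    have := h.unique h0
    norm_num at this
  have hlamj : lam j = 1 := by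
    have h : (lam j : ℂ) = 1 := mul_right_cancel₀ hj (by rw [one_mul]; exact (hcoef j).symm)
    exact_mod_cast h
  have h0 : lam 0 = 1 := le_antisymm (hle 0) (hlamj ▸ hb.2 (Nat.zero_le j))
  have hconst : ∀ i, lam i = 1 → ∃ c : ℂ, b i = c • u := by
    intro i hi
    obtain ⟨c, hc⟩ := he (b i) (hi ▸ hb.1 i)
    refine ⟨c, Lp.ext ?_⟩
    filter_upwards [hc, Lp.coeFn_smul c u, huae] with x h1 h2 h3
    rw [h1, h2, Pi.smul_apply, h3, smul_eq_mul, mul_one]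
  obtain ⟨c, hc⟩ := hconst 0 h0
  have hcn : ‖c‖ = 1 := by
    have h := b.orthonormal.1 0
    rwa [hc, norm_smul, hu1, mul_one] at h
  have hcne : c ≠ 0 := fun h => by simp [h] at hcn
  refine ⟨lt_of_le_of_ne (hb.2 zero_le_one) fun h1 => ?_, c⁻¹, by simp [hcn], ?_⟩
  · obtain ⟨c', hc'⟩ := hconst 1 (h1.trans h0)
    have horth := b.orthonormal.2 (show (0 : ℕ) ≠ 1 by norm_num)
    have hn := b.orthonormal.1 1
    simp only at horth
    rw [hc, hc', inner_smul_left, inner_smul_right, inner_self_eq_norm_sq_to_K, hu1] at horth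
    rw [hc', norm_smul, hu1, mul_one] at hn
    have hc'ne : c' ≠ 0 := fun h => by simp [h] at hn
    simp [hcne, hc'ne] at horth
  · rw [hc, smul_smul, inv_mul_cancel₀ hcne, one_smul]

end Markov

/-! ### Quantiles under weak convergence -/

section Quantiles

variable {M : Type*} [MeasurableSpace M] {X : Set M} {h : M → ℝ} {τ : Measure M}

theorem bddBelow_quantile_set (hτ : τ Xᶜ = 0) {C : ℝ} (hC : ∀ x ∈ X, |h x| ≤ C) {s : ℝ}
    (hs : 0 < s) : BddBelow {a : ℝ | s ≤ cdfOf τ h a} := by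
  refine ⟨-C, fun a ha => ?_⟩
  by_contra hcon
  have h0 : cdfOf τ h a = 0 := by
    have : τ {x | h x ≤ a} = 0 := measure_mono_null (t := Xᶜ) (fun x hx hxX => by
      have h1 := abs_le.1 (hC x hxX)
      have h2 : h x ≤ a := hx
      linarith) hτ
    simp [cdfOf, Measure.real, this]
  have : s ≤ cdfOf τ h a := ha
  linarith

theorem quantile_le (hτ : τ Xᶜ = 0) {C : ℝ} (hC : ∀ x ∈ X, |h x| ≤ C) {s a : ℝ}
    (hs : 0 < s) (ha : s ≤ cdfOf τ h a) : quantile τ h s ≤ a :=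
  csInf_le (bddBelow_quantile_set hτ hC hs) ha

theorem cdfOf_lt_of_lt_quantile (hτ : τ Xᶜ = 0) {C : ℝ} (hC : ∀ x ∈ X, |h x| ≤ C) {s a : ℝ}
    (hs : 0 < s) (ha : a < quantile τ h s) : cdfOf τ h a < s := by
  by_contra hcon
  exact absurd (quantile_le hτ hC hs (not_lt.1 hcon)) (not_le.2 ha)

variable [IsFiniteMeasure τ]

theorem cdfOf_mono (τ : Measure M) [IsFiniteMeasure τ] (h : M → ℝ) : Monotone (cdfOf τ h) :=
  fun _ _ hab => measureReal_mono fun _ hx => le_trans hx hab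

theorem le_quantile {s a a' : ℝ} (ha : cdfOf τ h a < s) (ha' : s ≤ cdfOf τ h a') :
    a ≤ quantile τ h s :=
  le_csInf ⟨a', ha'⟩ fun _ hb => le_of_lt ((cdfOf_mono τ h).reflect_lt (ha.trans_le hb))

theorem le_cdfOf_of_quantile_lt [IsProbabilityMeasure τ] (hτ : τ Xᶜ = 0) {C : ℝ}
    (hC : ∀ x ∈ X, |h x| ≤ C) {s a : ℝ} (hs : s ≤ 1) (ha : quantile τ h s < a) :
    s ≤ cdfOf τ h a := by
  have hne : (C : ℝ) ∈ {a : ℝ | s ≤ cdfOf τ h a} := by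
    have : τ {x | h x ≤ C}ᶜ = 0 := measure_mono_null (t := Xᶜ) (fun x hx hxX =>
      hx ((le_abs_self _).trans (hC x hxX))) hτ
    have h1 : τ {x | h x ≤ C} = 1 := by
      rw [← measure_univ (μ := τ)]
      exact measure_of_measure_compl_eq_zero this
    simpa [cdfOf, Measure.real, h1] using hs
  obtain ⟨a', ha', hlt⟩ := exists_lt_of_csInf_lt ⟨C, hne⟩ ha
  exact le_trans ha' (cdfOf_mono τ h hlt.le)

/-- The distribution function takes the value `s` at the `s`-quantile if that is not an atom. -/
theorem cdfOf_quantile [IsProbabilityMeasure τ] (hτ : τ Xᶜ = 0) {C : ℝ}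
    (hC : ∀ x ∈ X, |h x| ≤ C) (hh : Measurable h) {s : ℝ} (hs0 : 0 < s) (hs1 : s ≤ 1)
    (hatom : τ {x | h x = quantile τ h s} = 0) : cdfOf τ h (quantile τ h s) = s := by
  set ξ := quantile τ h s with hξ
  have hu : Tendsto (fun n : ℕ => 1 / ((n : ℝ) + 1)) atTop (𝓝 0) :=
    tendsto_one_div_add_atTop_nhds_zero_nat
  have hmono : Antitone fun n : ℕ => 1 / ((n : ℝ) + 1) := fun a b hab =>
    one_div_le_one_div_of_le (by positivity) (by exact_mod_cast Nat.succ_le_succ hab)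
  have hpos : ∀ n : ℕ, 0 < 1 / ((n : ℝ) + 1) := fun n => by positivity
  refine le_antisymm ?_ ?_
  · have hlt : τ.real {x | h x ≤ ξ} = τ.real {x | h x < ξ} := by
      refine measureReal_congr ?_
      have hae : ∀ᵐ x ∂τ, ¬ h x = ξ := measure_eq_zero_iff_ae_notMem.1 hatom
      rw [eventuallyEq_set]
      filter_upwards [hae] with x hx
      exact ⟨fun h1 => lt_of_le_of_ne h1 hx, fun h1 => le_of_lt h1⟩
    have hU : {x | h x < ξ} = ⋃ n : ℕ, {x | h x ≤ ξ - 1 / ((n : ℝ) + 1)} := by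
      ext x
      simp only [Set.mem_ofPred_eq, Set.mem_iUnion]
      constructor
      · intro hx
        obtain ⟨n, hn⟩ := (hu.eventually_lt_const (sub_pos.2 hx)).exists
        exact ⟨n, by linarith⟩
      · rintro ⟨n, hn⟩
        have := hpos n
        linarith
    have hlim := tendsto_measure_iUnion_atTop (μ := τ)
      (s := fun n : ℕ => {x | h x ≤ ξ - 1 / ((n : ℝ) + 1)})
      (fun a b hab x hx => by
        have h1 := hmono hab
        simp only [Set.mem_ofPred_eq] at hx ⊢
        linarith)
    rw [← hU] at hlim
    have hlim' := (ENNReal.tendsto_toReal (measure_ne_top τ _)).comp hlim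
    rw [cdfOf, hlt]
    refine le_of_tendsto hlim' (Eventually.of_forall fun n => ?_)
    have := hpos n
    exact (cdfOf_lt_of_lt_quantile hτ hC hs0 (show ξ - 1 / ((n : ℝ) + 1) < ξ by linarith)).le
  · have hI : {x | h x ≤ ξ} = ⋂ n : ℕ, {x | h x ≤ ξ + 1 / ((n : ℝ) + 1)} := by
      ext x
      simp only [Set.mem_ofPred_eq, Set.mem_iInter]
      constructor
      · intro hx n
        have := hpos n
        linarith
      · intro hx
        have h2 : Tendsto (fun n : ℕ => ξ + 1 / ((n : ℝ) + 1)) atTop (𝓝 (ξ + 0)) :=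
          hu.const_add ξ
        rw [add_zero] at h2
        exact ge_of_tendsto' h2 hx
    have hlim := tendsto_measure_iInter_atTop (μ := τ)
      (s := fun n : ℕ => {x | h x ≤ ξ + 1 / ((n : ℝ) + 1)})
      (fun n => (measurableSet_le hh measurable_const).nullMeasurableSet)
      (fun a b hab x hx => by
        have h1 := hmono hab
        simp only [Set.mem_ofPred_eq] at hx ⊢
        linarith) ⟨0, measure_ne_top τ _⟩
    rw [← hI] at hlim
    have hlim' := (ENNReal.tendsto_toReal (measure_ne_top τ _)).comp hlim
    refine ge_of_tendsto hlim' (Eventually.of_forall fun n => ?_)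
    have := hpos n
    exact le_cdfOf_of_quantile_lt hτ hC hs1 (show ξ < ξ + 1 / ((n : ℝ) + 1) by linarith)

end Quantiles

section Gaps

variable {M : Type*} [MetricSpace M] [MeasurableSpace M] [OpensMeasurableSpace M] {h : M → ℝ}

/-- Values of a continuous observable of an ergodic flow have no gaps: orbits are connected, so a
null set `{c < h < d}` would split the state space into two invariant parts. -/
theorem null_of_gap {Φ : Flow ℝ M} {μ : Measure M}
    (hinv : ∀ t : ℝ, MeasurePreserving (Φ t) μ μ) {Δt : ℝ} (herg : Ergodic (Φ Δt) μ)
    (hh : Continuous h) {c d : ℝ} (hcd : c < d) (hgap : μ {x | c < h x ∧ h x < d} = 0) :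
    μ {x | h x ≤ c} = 0 ∨ μ {x | h x ≤ c}ᶜ = 0 := by
  have hrat : ∀ᵐ z ∂μ, ∀ q : ℚ, ¬ (c < h (Φ (q : ℝ) z) ∧ h (Φ (q : ℝ) z) < d) :=
    ae_all_iff.2 fun q =>
      (hinv q).quasiMeasurePreserving.ae (measure_eq_zero_iff_ae_notMem.1 hgap)
  have hreal : ∀ᵐ z ∂μ, ∀ t : ℝ, ¬ (c < h (Φ t z) ∧ h (Φ t z) < d) := by
    filter_upwards [hrat] with z hz t ht
    have hcont : Continuous fun t : ℝ => h (Φ t z) :=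
      hh.comp (Φ.continuous continuous_id continuous_const)
    have hopen : IsOpen ((fun t : ℝ => h (Φ t z)) ⁻¹' Set.Ioo c d) := isOpen_Ioo.preimage hcont
    obtain ⟨q, hq⟩ := Rat.denseRange_cast.exists_mem_open hopen ⟨t, ht⟩
    exact hz q hq
  have hside : ∀ᵐ z ∂μ, ∀ s t : ℝ, h (Φ s z) ≤ c → h (Φ t z) ≤ c := by
    filter_upwards [hreal] with z hz s t hs
    by_contra hcon
    have hd : d ≤ h (Φ t z) := not_lt.1 fun hlt => hz t ⟨not_le.1 hcon, hlt⟩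
    have hcont : Continuous fun t : ℝ => h (Φ t z) :=
      hh.comp (Φ.continuous continuous_id continuous_const)
    obtain ⟨r, hr⟩ := mem_range_of_exists_le_of_exists_ge hcont (c := (c + d) / 2)
      ⟨s, by linarith⟩ ⟨t, by linarith⟩
    simp only at hr
    exact hz r (by constructor <;> linarith)
  have hmeas : MeasurableSet {x | h x ≤ c} := measurableSet_le hh.measurable measurable_const
  have hpre : Φ Δt ⁻¹' {x | h x ≤ c} =ᵐ[μ] {x | h x ≤ c} := by
    rw [eventuallyEq_set]
    filter_upwards [hside] with z hz
    have h0 := hz 0 Δt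
    have h1 := hz Δt 0
    rw [Flow.map_zero_apply] at h0 h1
    exact ⟨h1, h0⟩
  rcases herg.quasiErgodic.ae_empty_or_univ₀ hmeas.nullMeasurableSet hpre with h1 | h1
  · left; exact ae_eq_empty.1 h1
  · right; exact ae_eq_univ.1 h1

end Gaps

section Ramps

/-- The continuous cutoff function that is `1` on `(-∞, c]`, `0` on `[d, ∞)` and affine on
`[c, d]`. -/
noncomputable def ramp (c d t : ℝ) : ℝ := max 0 (min 1 ((d - t) / (d - c)))

theorem continuous_ramp (c d : ℝ) : Continuous (ramp c d) := by
  unfold ramp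
  fun_prop

theorem ramp_nonneg (c d t : ℝ) : 0 ≤ ramp c d t := le_max_left _ _

theorem ramp_le_one (c d t : ℝ) : ramp c d t ≤ 1 := max_le zero_le_one (min_le_left _ _)

theorem ramp_of_le {c d t : ℝ} (hcd : c < d) (ht : t ≤ c) : ramp c d t = 1 := by
  have : 1 ≤ (d - t) / (d - c) := (one_le_div (sub_pos.2 hcd)).2 (by linarith)
  rw [ramp, min_eq_left this, max_eq_right zero_le_one]

theorem ramp_of_ge {c d t : ℝ} (hcd : c < d) (ht : d ≤ t) : ramp c d t = 0 := by
  have : (d - t) / (d - c) ≤ 0 := div_nonpos_of_nonpos_of_nonneg (by linarith) (by linarith)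
  rw [ramp, min_eq_right (this.trans zero_le_one), max_eq_left this]

variable {M : Type*} [MetricSpace M] [MeasurableSpace M] [OpensMeasurableSpace M] {h : M → ℝ}
  {τ : Measure M}

theorem cdfOf_eq_integral (hh : Continuous h) (a : ℝ) :
    cdfOf τ h a = ∫ x, ({x | h x ≤ a}.indicator (fun _ => (1 : ℝ))) x ∂τ := by
  rw [integral_indicator (measurableSet_le hh.measurable measurable_const)]
  simp [cdfOf]

variable [IsFiniteMeasure τ]

theorem integrable_ramp (τ : Measure M) [IsFiniteMeasure τ] (hh : Continuous h) (c d : ℝ) :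
    Integrable (fun x => ramp c d (h x)) τ :=
  Integrable.of_bound ((continuous_ramp c d).comp hh).aestronglyMeasurable 1
    (Eventually.of_forall fun x => by
      rw [Real.norm_of_nonneg (ramp_nonneg _ _ _)]; exact ramp_le_one _ _ _)

theorem cdfOf_le_integral_ramp (hh : Continuous h) {c d : ℝ} (hcd : c < d) :
    cdfOf τ h c ≤ ∫ x, ramp c d (h x) ∂τ := by
  rw [cdfOf_eq_integral hh]
  refine integral_mono ((integrable_const _).indicator
    (measurableSet_le hh.measurable measurable_const)) (integrable_ramp τ hh c d) fun x => ?_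
  by_cases hx : h x ≤ c
  · rw [Set.indicator_of_mem (show x ∈ {x | h x ≤ c} from hx), ramp_of_le hcd hx]
  · rw [Set.indicator_of_notMem (show x ∉ {x | h x ≤ c} from hx)]
    exact ramp_nonneg _ _ _

theorem integral_ramp_le_cdfOf (hh : Continuous h) {c d : ℝ} (hcd : c < d) :
    ∫ x, ramp c d (h x) ∂τ ≤ cdfOf τ h d := by
  rw [cdfOf_eq_integral hh]
  refine integral_mono (integrable_ramp τ hh c d) ((integrable_const _).indicator
    (measurableSet_le hh.measurable measurable_const)) fun x => ?_
  by_cases hx : h x ≤ d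
  · rw [Set.indicator_of_mem (show x ∈ {x | h x ≤ d} from hx)]
    exact ramp_le_one _ _ _
  · rw [Set.indicator_of_notMem (show x ∉ {x | h x ≤ d} from hx),
      ramp_of_ge hcd (not_le.1 hx).le]

end Ramps

section QuantileLimits

variable {M : Type*} [MetricSpace M] [MeasurableSpace M] [BorelSpace M] {X : Set M} {h : M → ℝ}
  {ν : ℕ → Measure M} {μ : Measure M}

/-- Quantiles converge under weak convergence at levels at which the limiting distribution
function increases strictly. -/
theorem WeakConvOn.tendsto_quantile (hw : WeakConvOn X ν μ) (hh : Continuous h) {s : ℝ}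
    (hs0 : 0 < s) (hinc : ∀ a, quantile μ h s < a → s < cdfOf μ h a) :
    Tendsto (fun N => quantile (ν N) h s) atTop (𝓝 (quantile μ h s)) := by
  have := hw.finite
  have := hw.prob
  obtain ⟨C, hC⟩ := hw.isCompact.exists_bound_of_continuousOn hh.continuousOn
  have hup : ∀ a, quantile μ h s < a → ∀ᶠ N in atTop, s ≤ cdfOf (ν N) h a := by
    intro a ha
    obtain ⟨a', h1, h2⟩ := exists_between ha
    have hlim := hw.tendsto_integral_real
      (((continuous_ramp a' a).comp hh).continuousOn (s := X))
    have h3 : s < ∫ x, ramp a' a (h x) ∂μ := (hinc a' h1).trans_le (cdfOf_le_integral_ramp hh h2)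
    filter_upwards [hlim.eventually_const_lt h3] with N hN
    exact hN.le.trans (integral_ramp_le_cdfOf hh h2)
  have hlow : ∀ a, a < quantile μ h s → ∀ᶠ N in atTop, cdfOf (ν N) h a < s := by
    intro a ha
    obtain ⟨a', h1, h2⟩ := exists_between ha
    have hlim := hw.tendsto_integral_real
      (((continuous_ramp a a').comp hh).continuousOn (s := X))
    have h3 : ∫ x, ramp a a' (h x) ∂μ < s := (integral_ramp_le_cdfOf hh h1).trans_lt
      (cdfOf_lt_of_lt_quantile hw.null_limit hC hs0 h2)
    filter_upwards [hlim.eventually_lt_const h3] with N hN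
    exact (cdfOf_le_integral_ramp hh h1).trans_lt hN
  refine tendsto_order.2 ⟨fun a ha => ?_, fun a ha => ?_⟩
  · obtain ⟨a', h1, h2⟩ := exists_between ha
    filter_upwards [hlow a' h2, hup (quantile μ h s + 1) (by linarith)] with N h3 h4
    exact h1.trans_le (le_quantile h3 h4)
  · obtain ⟨a', h1, h2⟩ := exists_between ha
    filter_upwards [hup a' h1] with N h3
    exact (quantile_le (hw.null N) hC hs0 h3).trans_lt h2

/-- Integrals over sublevel sets with converging levels converge, if the limiting level is not
an atom. -/
theorem WeakConvOn.tendsto_setIntegral_lt (hw : WeakConvOn X ν μ) (hh : Continuous h)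
    {g : M → ℂ} (hg : ContinuousOn g X) {c : ℕ → ℝ} {c₀ : ℝ} (hc : Tendsto c atTop (𝓝 c₀))
    (hatom : μ {x | h x = c₀} = 0) :
    Tendsto (fun N => ∫ x in {x | h x < c N}, g x ∂(ν N)) atTop
      (𝓝 (∫ x in {x | h x < c₀}, g x ∂μ)) := by
  have := hw.finite
  have := hw.prob
  obtain ⟨B, hB⟩ := hw.isCompact.exists_bound_of_continuousOn hg
  have hB' : ∀ x ∈ X, ‖g x‖ ≤ max B 1 := fun x hx => (hB x hx).trans (le_max_left _ _)
  set A := max B 1 with hA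
  have hA0 : 0 < A := lt_of_lt_of_le one_pos (le_max_right _ _)
  -- `W δ` is a bump function that is `1` on `[c₀ - δ, c₀ + δ]` and `0` off `[c₀ - 2δ, c₀ + 2δ]`
  set W : ℝ → ℝ → ℝ := fun δ t =>
    ramp (c₀ + δ) (c₀ + 2 * δ) t - ramp (c₀ - 2 * δ) (c₀ - δ) t with hW
  have hWc : ∀ δ, ContinuousOn (fun x => W δ (h x)) X := fun δ =>
    (((continuous_ramp _ _).comp hh).sub ((continuous_ramp _ _).comp hh)).continuousOn
  have hW1 : ∀ δ > 0, ∀ t, |t - c₀| ≤ δ → W δ t = 1 := fun δ hδ t ht => by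
    have := abs_le.1 ht
    simp only [hW]
    rw [ramp_of_le (by linarith) (by linarith), ramp_of_ge (by linarith) (by linarith), sub_zero]
  have hWn : ∀ δ > 0, ∀ t, 0 ≤ W δ t := fun δ hδ t => by
    simp only [hW]
    rcases le_total t (c₀ + δ) with ht | ht
    · rw [ramp_of_le (by linarith) ht]
      exact sub_nonneg.2 (ramp_le_one _ _ _)
    · rw [ramp_of_ge (c := c₀ - 2 * δ) (by linarith) (by linarith), sub_zero]
      exact ramp_nonneg _ _ _
  have hWz : ∀ δ > 0, ∀ t, 2 * δ ≤ |t - c₀| → W δ t = 0 := fun δ hδ t ht => by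
    simp only [hW]
    rcases le_abs.1 ht with h1 | h1
    · rw [ramp_of_ge (by linarith) (by linarith), ramp_of_ge (by linarith) (by linarith), sub_zero]
    · rw [ramp_of_le (by linarith) (by linarith), ramp_of_le (by linarith) (by linarith), sub_self]
  have hWle : ∀ δ > 0, ∀ t, W δ t ≤ 1 := fun δ _ t => by
    have h1 := ramp_le_one (c₀ + δ) (c₀ + 2 * δ) t
    have h2 := ramp_nonneg (c₀ - 2 * δ) (c₀ - δ) t
    simp only [hW]
    linarith
  -- the mass near the level `c₀` is small
  have hsmall : Tendsto (fun n : ℕ => ∫ x, W (1 / ((n : ℝ) + 1)) (h x) ∂μ) atTop (𝓝 0) := by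
    have h0 : ∫ _x, (0 : ℝ) ∂μ = 0 := integral_zero _ _
    rw [← h0]
    refine tendsto_integral_of_dominated_convergence (fun _ => 1)
      (fun n => aestronglyMeasurable_of_continuousOn hw.isCompact hw.null_limit (hWc _))
      (integrable_const 1) (fun n => Eventually.of_forall fun x => ?_) ?_
    · rw [Real.norm_of_nonneg (hWn _ (by positivity) _)]
      exact hWle _ (by positivity) _
    · have hae : ∀ᵐ x ∂μ, ¬ h x = c₀ := measure_eq_zero_iff_ae_notMem.1 hatom
      filter_upwards [hae] with x hx
      have hpos : 0 < |h x - c₀| / 2 := by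
        have := abs_pos.2 (sub_ne_zero.2 hx)
        linarith
      refine tendsto_const_nhds.congr' ?_
      filter_upwards [tendsto_one_div_add_atTop_nhds_zero_nat.eventually_lt_const hpos] with n hn
      exact (hWz _ (by positivity) _ (by linarith)).symm
  -- comparison of the indicator with the cutoff function
  have hcomp : ∀ (τ : Measure M) [IsFiniteMeasure τ], τ Xᶜ = 0 → ∀ δ > 0, ∀ c, |c - c₀| ≤ δ →
      ‖∫ x in {x | h x < c}, g x ∂τ - ∫ x, (ramp (c₀ - δ) (c₀ + δ) (h x) : ℂ) * g x ∂τ‖ ≤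
        A * ∫ x, W δ (h x) ∂τ := by
    intro τ _ hτ δ hδ c hc
    have hmeas : MeasurableSet {x | h x < c} := measurableSet_lt hh.measurable measurable_const
    have hgi := integrable_of_continuousOn hw.isCompact hτ hg
    have hr : ContinuousOn (fun x => (ramp (c₀ - δ) (c₀ + δ) (h x) : ℂ) * g x) X :=
      (Complex.continuous_ofReal.comp ((continuous_ramp _ _).comp hh)).continuousOn.mul hg
    rw [← integral_indicator hmeas, ← integral_sub (hgi.indicator hmeas)
      (integrable_of_continuousOn hw.isCompact hτ hr), ← integral_const_mul]
    refine norm_integral_le_of_norm_le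
      ((integrable_of_continuousOn hw.isCompact hτ (hWc δ)).const_mul A) ?_
    filter_upwards [ae_mem_of_compl_null hτ] with x hx
    have hfac : ({x | h x < c}.indicator g x : ℂ) - (ramp (c₀ - δ) (c₀ + δ) (h x) : ℂ) * g x =
        (((if h x < c then 1 else 0) - ramp (c₀ - δ) (c₀ + δ) (h x) : ℝ) : ℂ) * g x := by
      by_cases hxc : h x < c
      · simp [Set.indicator, hxc, sub_mul]
      · simp [Set.indicator, hxc]
    rw [hfac, norm_mul, Complex.norm_real, mul_comm]
    refine mul_le_mul (hB' x hx) ?_ (norm_nonneg _) hA0.le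
    have hc' := abs_le.1 hc
    rcases le_or_gt (|h x - c₀|) δ with h1 | h1
    · rw [hW1 δ hδ _ h1, Real.norm_eq_abs]
      have h2 := ramp_nonneg (c₀ - δ) (c₀ + δ) (h x)
      have h3 := ramp_le_one (c₀ - δ) (c₀ + δ) (h x)
      split_ifs <;> rw [abs_le] <;> constructor <;> linarith
    · have h0 : ((if h x < c then 1 else 0) - ramp (c₀ - δ) (c₀ + δ) (h x) : ℝ) = 0 := by
        rcases lt_abs.1 h1 with h2 | h2
        · rw [if_neg (by linarith), ramp_of_ge (by linarith) (by linarith), sub_zero]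
        · rw [if_pos (by linarith), ramp_of_le (by linarith) (by linarith), sub_self]
      rw [h0, norm_zero]
      exact hWn δ hδ _
  rw [Metric.tendsto_nhds]
  intro ε hε
  obtain ⟨n, hn⟩ := (hsmall.eventually_lt_const (show 0 < ε / (4 * A) by positivity)).exists
  set δ : ℝ := 1 / ((n : ℝ) + 1) with hδdef
  have hδ : 0 < δ := by positivity
  have hlim1 := hw.tendsto_integral_real (hWc δ)
  have hlim2 := hw.tendsto_integral (f := fun x => (ramp (c₀ - δ) (c₀ + δ) (h x) : ℂ) * g x)
    ((Complex.continuous_ofReal.comp ((continuous_ramp _ _).comp hh)).continuousOn.mul hg)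
  filter_upwards [hlim1.eventually_lt_const hn,
    (Metric.tendsto_nhds.1 hlim2) (ε / 4) (by positivity),
    (Metric.tendsto_nhds.1 hc) δ hδ] with N h1 h2 h3
  rw [Real.dist_eq] at h3
  rw [dist_eq_norm] at h2 ⊢
  have e1 := hcomp (ν N) (hw.null N) δ hδ (c N) h3.le
  have e2 := hcomp μ hw.null_limit δ hδ c₀ (by simpa using hδ.le)
  have hA4 : A * (ε / (4 * A)) = ε / 4 := by field_simp
  have e3 := mul_lt_mul_of_pos_left h1 hA0
  have e4 := mul_lt_mul_of_pos_left hn hA0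
  rw [hA4] at e3 e4
  set a₁ := ∫ x in {x | h x < c N}, g x ∂(ν N)
  set a₂ := ∫ x, (ramp (c₀ - δ) (c₀ + δ) (h x) : ℂ) * g x ∂(ν N)
  set a₃ := ∫ x, (ramp (c₀ - δ) (c₀ + δ) (h x) : ℂ) * g x ∂μ
  set a₄ := ∫ x in {x | h x < c₀}, g x ∂μ
  have : a₁ - a₄ = (a₁ - a₂) + (a₂ - a₃) - (a₄ - a₃) := by ring
  rw [this]
  have h5 := norm_sub_le ((a₁ - a₂) + (a₂ - a₃)) (a₄ - a₃)
  have h6 := norm_add_le (a₁ - a₂) (a₂ - a₃)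
  linarith

end QuantileLimits

/-! ### Partition elements and the spectral projectors of the quantized observable -/

section Bins

variable {M : Type*} [MeasurableSpace M] {S : ℕ} {τ : Measure M} {h : M → ℝ}

theorem exists_mem_bin (hS : 0 < S) (τ : Measure M) (h : M → ℝ) (a : ℝ) :
    ∃ i < S, a ∈ bin S τ h i := by
  classical
  have hP : ∃ i, i + 1 < S → a < bdry S τ h (i + 1) := ⟨S, fun h => by omega⟩
  refine ⟨Nat.find hP, ?_, ?_, Nat.find_spec hP⟩
  · have : Nat.find hP ≤ S - 1 := Nat.find_min' hP fun h => by omega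
    omega
  · intro h0
    have h1 := Nat.find_min hP (Nat.sub_lt h0 one_pos)
    push Not at h1
    rw [Nat.sub_add_cancel (show 1 ≤ Nat.find hP from h0)] at h1
    exact h1.2

theorem affil_lt (hS : 0 < S) (τ : Measure M) (h : M → ℝ) (a : ℝ) : affil S τ h a < S :=
  (Nat.sInf_mem (s := {i | i < S ∧ a ∈ bin S τ h i}) (exists_mem_bin hS τ h a)).1

/-- If all partition elements are nonempty, the boundary points are ordered. -/
theorem bdry_le_bdry (hne : ∀ i < S, (bin S τ h i).Nonempty) {i j : ℕ} (hi : 0 < i) (hij : i ≤ j)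
    (hj : j < S) : bdry S τ h i ≤ bdry S τ h j := by
  induction j, hij using Nat.le_induction with
  | base => exact le_rfl
  | succ j hij ih =>
    obtain ⟨a, ha1, ha2⟩ := hne j (by omega)
    exact (ih (by omega)).trans ((ha1 (by omega)).trans (ha2 hj).le)

theorem bin_eq_of_mem (hne : ∀ i < S, (bin S τ h i).Nonempty) {i j : ℕ} (hi : i < S) (hj : j < S)
    {a : ℝ} (hai : a ∈ bin S τ h i) (haj : a ∈ bin S τ h j) : i = j := by
  have key : ∀ i j, i < S → j < S → a ∈ bin S τ h i → a ∈ bin S τ h j → ¬ i < j := by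
    intro i j _ hj hai haj hij
    have h1 := hai.2 (by omega)
    have h2 := haj.1 (by omega)
    have h3 := bdry_le_bdry hne (Nat.succ_pos i) hij hj
    exact absurd (h1.trans_le (h3.trans h2)) (lt_irrefl _)
  have h1 := key i j hi hj hai haj
  have h2 := key j i hj hi haj hai
  omega

/-- Conditional means over different partition elements of positive mass are different. -/
theorem binMean_lt [IsFiniteMeasure τ] (hint : Integrable h τ)
    (hpos : ∀ i < S, τ (h ⁻¹' bin S τ h i) ≠ 0) {i j : ℕ} (hij : i < j) (hj : j < S) :
    binMean S τ h i < binMean S τ h j := by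
  have hne : ∀ i < S, (bin S τ h i).Nonempty := fun i hi => by
    obtain ⟨x, hx⟩ := nonempty_of_measure_ne_zero (hpos i hi)
    exact ⟨h x, hx⟩
  obtain ⟨x, hx, hx'⟩ := exists_setAverage_le (hpos i (by omega)) (measure_ne_top τ _)
    hint.integrableOn
  obtain ⟨z, hz, hz'⟩ := exists_le_setAverage (hpos j hj) (measure_ne_top τ _) hint.integrableOn
  have h1 : h x < bdry S τ h (i + 1) := hx.2 (by omega)
  have h2 : bdry S τ h j ≤ h z := hz.1 (by omega)
  have h3 := bdry_le_bdry hne (Nat.succ_pos i) hij hj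
  exact hx'.trans_lt (h1.trans_le (h3.trans (h2.trans hz')))

theorem preimage_quantized [IsFiniteMeasure τ] (hS : 0 < S) (hint : Integrable h τ)
    (hpos : ∀ i < S, τ (h ⁻¹' bin S τ h i) ≠ 0) {i : ℕ} (hi : i < S) :
    quantized S τ h ⁻¹' {binMean S τ h i} = h ⁻¹' bin S τ h i := by
  have hne : ∀ i < S, (bin S τ h i).Nonempty := fun i hi => by
    obtain ⟨x, hx⟩ := nonempty_of_measure_ne_zero (hpos i hi)
    exact ⟨h x, hx⟩
  have hq : ∀ x, ∀ j < S, h x ∈ bin S τ h j → quantized S τ h x = binMean S τ h j := by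
    intro x j hj hx
    rw [quantized, Finset.sum_eq_single j]
    · exact Set.indicator_of_mem (s := h ⁻¹' bin S τ h j) hx _
    · intro k hk hkj
      refine Set.indicator_of_notMem (s := h ⁻¹' bin S τ h k) (fun hxk => hkj ?_) _
      exact bin_eq_of_mem hne (Finset.mem_range.1 hk) hj hxk hx
    · exact fun hn => absurd (Finset.mem_range.2 hj) hn
  ext x
  obtain ⟨j, hj, hx⟩ := exists_mem_bin hS τ h (h x)
  rw [Set.mem_preimage, Set.mem_singleton_iff, hq x j hj hx]
  constructor
  · intro heq
    rcases lt_trichotomy i j with hlt | rfl | hlt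
    · exact absurd heq (binMean_lt hint hpos hlt hj).ne'
    · exact hx
    · exact absurd heq (binMean_lt hint hpos hlt hi).ne
  · intro hxi
    rw [bin_eq_of_mem hne hi hj hxi hx]

/-- Membership in the partition element of a value that is not a boundary point is stable. -/
theorem eventually_affil_eq {ν : ℕ → Measure M} {μ : Measure M}
    (hconv : ∀ k, 0 < k → k < S →
      Tendsto (fun N => bdry S (ν N) h k) atTop (𝓝 (bdry S μ h k)))
    {a : ℝ} (ha : ∀ k, 0 < k → k < S → a ≠ bdry S μ h k) :
    ∀ᶠ N in atTop, affil S (ν N) h a = affil S μ h a := by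
  have h1 : ∀ᶠ N in atTop, ∀ k ∈ Finset.range S, 0 < k →
      (bdry S (ν N) h k ≤ a ↔ bdry S μ h k ≤ a) := by
    refine (Finset.eventually_all _).2 fun k hk => ?_
    rcases Nat.eq_zero_or_pos k with rfl | hk0
    · exact Eventually.of_forall fun _ h0 => absurd h0 (lt_irrefl 0)
    have hkS := Finset.mem_range.1 hk
    rcases lt_or_gt_of_ne (ha k hk0 hkS) with hlt | hgt
    · filter_upwards [(hconv k hk0 hkS).eventually_const_lt hlt] with N hN _
      exact iff_of_false (not_le.2 hN) (not_le.2 hlt)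
    · filter_upwards [(hconv k hk0 hkS).eventually_lt_const hgt] with N hN _
      exact iff_of_true hN.le hgt.le
  filter_upwards [h1] with N hN
  have hset : {i | i < S ∧ a ∈ bin S (ν N) h i} = {i | i < S ∧ a ∈ bin S μ h i} := by
    ext i
    refine and_congr_right fun hi => ?_
    refine and_congr (imp_congr_right fun h0 => hN i (Finset.mem_range.2 hi) h0)
      (imp_congr_right fun h0 => ?_)
    have := hN (i + 1) (Finset.mem_range.2 h0) (Nat.succ_pos i)
    rw [← not_le, ← not_le, this]
  rw [affil, affil, hset]

/-- The part of state space below the `i`-th boundary point, empty for `i = 0` and everything for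
`i = S`. -/
def lowerSet (S : ℕ) (τ : Measure M) (h : M → ℝ) (i : ℕ) : Set M :=
  {x | 0 < i ∧ (i < S → h x < bdry S τ h i)}

theorem lowerSet_zero : lowerSet S τ h 0 = ∅ := by
  ext x; simp [lowerSet]

theorem lowerSet_last (hS : 0 < S) : lowerSet S τ h S = Set.univ := by
  ext x; simp [lowerSet, hS]

theorem lowerSet_of_lt {i : ℕ} (h0 : 0 < i) (hi : i < S) :
    lowerSet S τ h i = {x | h x < bdry S τ h i} := by
  ext x; simp [lowerSet, h0, hi]

theorem preimage_bin_eq_diff {i : ℕ} (hi : i < S) :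
    h ⁻¹' bin S τ h i = lowerSet S τ h (i + 1) \ lowerSet S τ h i := by
  ext x
  simp only [bin, lowerSet, Set.mem_preimage, Set.mem_ofPred_eq, Set.mem_sdiff, hi, forall_const,
    Nat.succ_pos, true_and, not_and, not_lt]
  exact and_comm

theorem measurableSet_lowerSet (hh : Measurable h) (S : ℕ) (τ : Measure M) (i : ℕ) :
    MeasurableSet (lowerSet S τ h i) := by
  rcases Nat.eq_zero_or_pos i with rfl | h0
  · rw [lowerSet_zero]; exact MeasurableSet.empty
  by_cases hi : i < S
  · rw [lowerSet_of_lt h0 hi]; exact measurableSet_lt hh measurable_const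
  · have : lowerSet S τ h i = Set.univ := by ext x; simp [lowerSet, h0, hi]
    rw [this]; exact MeasurableSet.univ

theorem lowerSet_subset {i : ℕ} (hi : i < S)
    (hle : 0 < i → i + 1 < S → bdry S τ h i ≤ bdry S τ h (i + 1)) :
    lowerSet S τ h i ⊆ lowerSet S τ h (i + 1) := fun _ hx =>
  ⟨Nat.succ_pos i, fun h1 => (hx.2 hi).trans_le (hle hx.1 h1)⟩

theorem setIntegral_bin (hh : Measurable h) {g : M → ℂ} (hg : Integrable g τ) {i : ℕ} (hi : i < S)
    (hle : 0 < i → i + 1 < S → bdry S τ h i ≤ bdry S τ h (i + 1)) :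
    ∫ x in h ⁻¹' bin S τ h i, g x ∂τ =
      ∫ x in lowerSet S τ h (i + 1), g x ∂τ - ∫ x in lowerSet S τ h i, g x ∂τ := by
  rw [preimage_bin_eq_diff hi, setIntegral_sdiff (measurableSet_lowerSet hh S τ i) hg.integrableOn
    (lowerSet_subset hi hle)]

theorem inner_indicatorOp [IsFiniteMeasure τ] {A : Set M} (hA : MeasurableSet A)
    (f g : Lp ℂ 2 τ) :
    ⟪f, indicatorOp τ hA g⟫_ℂ = ∫ x in A, (starRingEnd ℂ) (f x) * g x ∂τ := by
  rw [L2.inner_def, ← integral_indicator hA]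
  refine integral_congr_ae ?_
  have h1 := (ContinuousLinearMap.mul ℂ ℂ).coeFn_holder (r := 2)
    (indicatorConstLp ∞ hA (measure_ne_top τ A) (1 : ℂ)) g
  have h2 : indicatorOp τ hA g = (ContinuousLinearMap.mul ℂ ℂ).holder 2
    (indicatorConstLp ∞ hA (measure_ne_top τ A) (1 : ℂ)) g := rfl
  rw [← h2] at h1
  filter_upwards [h1, indicatorConstLp_coeFn (p := ∞) (hs := hA) (hμs := measure_ne_top τ A)
    (c := (1 : ℂ))] with x hx1 hx2
  rw [hx1, hx2, RCLike.inner_apply]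
  by_cases hxA : x ∈ A
  · simp [hxA, mul_comm]
  · simp [hxA]

theorem norm_inner_indicatorOp_le [IsFiniteMeasure τ] {A : Set M} (hA : MeasurableSet A)
    (f g : Lp ℂ 2 τ) : ‖⟪f, indicatorOp τ hA g⟫_ℂ‖ ≤ ‖f‖ * ‖g‖ := by
  have hB : ‖ContinuousLinearMap.mul ℂ ℂ‖ ≤ 1 := ContinuousLinearMap.opNorm_mul_le ℂ ℂ
  have h1 : ‖indicatorOp τ hA g‖ ≤ ‖g‖ := by
    have h2 := (ContinuousLinearMap.mul ℂ ℂ).norm_holder_apply_apply_le (r := 2)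
      (indicatorConstLp ∞ hA (measure_ne_top τ A) (1 : ℂ)) g
    have h3 : ‖indicatorConstLp ∞ hA (measure_ne_top τ A) (1 : ℂ)‖ ≤ 1 := by
      refine (norm_indicatorConstLp_le).trans ?_
      simp
    refine h2.trans ?_
    calc _ ≤ 1 * 1 * ‖g‖ := by gcongr
      _ = ‖g‖ := by ring
  exact (norm_inner_le_norm _ _).trans (mul_le_mul_of_nonneg_left h1 (norm_nonneg _))

end Bins

section BinLimits

variable {M : Type*} [MetricSpace M] [MeasurableSpace M] [BorelSpace M] {X : Set M} {h : M → ℝ}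
  {ν : ℕ → Measure M} {μ : Measure M} {S : ℕ}

theorem WeakConvOn.tendsto_setIntegral_lowerSet (hw : WeakConvOn X ν μ) (hh : Continuous h)
    (hS : 0 < S)
    (hconv : ∀ k, 0 < k → k < S →
      Tendsto (fun N => bdry S (ν N) h k) atTop (𝓝 (bdry S μ h k)))
    (hatom : ∀ k, 0 < k → k < S → μ {x | h x = bdry S μ h k} = 0)
    {g : M → ℂ} (hg : ContinuousOn g X) {i : ℕ} (hi : i ≤ S) :
    Tendsto (fun N => ∫ x in lowerSet S (ν N) h i, g x ∂(ν N)) atTop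
      (𝓝 (∫ x in lowerSet S μ h i, g x ∂μ)) := by
  rcases Nat.eq_zero_or_pos i with rfl | h0
  · simp [lowerSet_zero]
  rcases hi.eq_or_lt with rfl | hi
  · simp only [lowerSet_last hS, Measure.restrict_univ]
    exact hw.tendsto_integral hg
  · simp only [lowerSet_of_lt h0 hi]
    exact hw.tendsto_setIntegral_lt hh hg (hconv i h0 hi) (hatom i h0 hi)

theorem WeakConvOn.tendsto_setIntegral_bin (hw : WeakConvOn X ν μ) (hh : Continuous h)
    (hS : 0 < S)
    (hconv : ∀ k, 0 < k → k < S →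
      Tendsto (fun N => bdry S (ν N) h k) atTop (𝓝 (bdry S μ h k)))
    (hatom : ∀ k, 0 < k → k < S → μ {x | h x = bdry S μ h k} = 0)
    (hlt : ∀ k, 0 < k → k + 1 < S → bdry S μ h k < bdry S μ h (k + 1))
    {g : M → ℂ} (hg : ContinuousOn g X) {i : ℕ} (hi : i < S) :
    Tendsto (fun N => ∫ x in h ⁻¹' bin S (ν N) h i, g x ∂(ν N)) atTop
      (𝓝 (∫ x in h ⁻¹' bin S μ h i, g x ∂μ)) := by
  have := hw.finite
  have := hw.prob
  have hle : ∀ᶠ N in atTop, 0 < i → i + 1 < S → bdry S (ν N) h i ≤ bdry S (ν N) h (i + 1) := by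
    by_cases hc : 0 < i ∧ i + 1 < S
    · have := (hconv i hc.1 hi).eventually_lt (hconv (i + 1) (Nat.succ_pos i) hc.2)
        (hlt i hc.1 hc.2)
      filter_upwards [this] with N hN _ _ using hN.le
    · exact Eventually.of_forall fun _ h1 h2 => absurd ⟨h1, h2⟩ hc
  have hlim := (hw.tendsto_setIntegral_lowerSet hh hS hconv hatom hg (Nat.succ_le_of_lt hi)).sub
    (hw.tendsto_setIntegral_lowerSet hh hS hconv hatom hg hi.le)
  rw [setIntegral_bin hh.measurable (integrable_of_continuousOn hw.isCompact hw.null_limit hg) hi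
    fun h1 h2 => (hlt i h1 h2).le]
  refine hlim.congr' ?_
  filter_upwards [hle] with N hN
  exact (setIntegral_bin hh.measurable
    (integrable_of_continuousOn hw.isCompact (hw.null N) hg) hi hN).symm

variable [IsProbabilityMeasure μ]

theorem bdry_lt_bdry (hX : IsCompact X) (hμ : μ Xᶜ = 0) (hh : Continuous h)
    (hatom : ∀ k, 0 < k → k < S → μ {x | h x = bdry S μ h k} = 0) {i j : ℕ} (hi : 0 < i)
    (hij : i < j) (hj : j < S) : bdry S μ h i < bdry S μ h j := by
  obtain ⟨C, hC⟩ := hX.exists_bound_of_continuousOn hh.continuousOn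
  have hcdf : ∀ k, 0 < k → k < S → cdfOf μ h (bdry S μ h k) = (k : ℝ) / S := fun k hk hkS =>
    cdfOf_quantile hμ hC hh.measurable
      (div_pos (by exact_mod_cast hk) (by exact_mod_cast hk.trans hkS))
      ((div_le_one (by exact_mod_cast hk.trans hkS)).2 (by exact_mod_cast hkS.le))
      (hatom k hk hkS)
  have hS : (0 : ℝ) < S := by exact_mod_cast hi.trans (hij.trans hj)
  refine (cdfOf_mono μ h).reflect_lt ?_
  rw [hcdf i hi (hij.trans hj), hcdf j (hi.trans hij) hj]
  exact div_lt_div_of_pos_right (by exact_mod_cast hij) hS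

/-- If the boundary points are not atoms, all elements of the quantile partition have mass
`1 / S`. -/
theorem measure_bin (hX : IsCompact X) (hμ : μ Xᶜ = 0) (hh : Continuous h) (hS : 0 < S)
    (hatom : ∀ k, 0 < k → k < S → μ {x | h x = bdry S μ h k} = 0) {i : ℕ} (hi : i < S) :
    μ.real (h ⁻¹' bin S μ h i) = 1 / S := by
  obtain ⟨C, hC⟩ := hX.exists_bound_of_continuousOn hh.continuousOn
  have hS' : (0 : ℝ) < S := by exact_mod_cast hS
  have hlow : ∀ k ≤ S, μ.real (lowerSet S μ h k) = (k : ℝ) / S := by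
    intro k hk
    rcases Nat.eq_zero_or_pos k with rfl | h0
    · simp [lowerSet_zero]
    rcases hk.eq_or_lt with rfl | hk
    · rw [lowerSet_last hS, div_self hS'.ne']
      simp
    · rw [lowerSet_of_lt h0 hk, ← cdfOf_quantile hμ hC hh.measurable
        (show (0 : ℝ) < k / S by positivity)
        ((div_le_one hS').2 (by exact_mod_cast hk.le)) (hatom k h0 hk)]
      refine measureReal_congr ?_
      rw [eventuallyEq_set]
      filter_upwards [measure_eq_zero_iff_ae_notMem.1 (hatom k h0 hk)] with x hx
      exact ⟨fun h1 => le_of_lt h1, fun h1 => lt_of_le_of_ne h1 hx⟩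
  have hsub : lowerSet S μ h i ⊆ lowerSet S μ h (i + 1) := lowerSet_subset hi fun h1 h2 =>
    (bdry_lt_bdry hX hμ hh hatom h1 (Nat.lt_succ_self i) h2).le
  rw [preimage_bin_eq_diff hi, measureReal_sdiff hsub (measurableSet_lowerSet hh.measurable S μ i),
    hlow _ (Nat.succ_le_of_lt hi), hlow _ hi.le, ← sub_div]
  push_cast
  ring

theorem bin_measure_ne_zero (hX : IsCompact X) (hμ : μ Xᶜ = 0) (hh : Continuous h) (hS : 0 < S)
    (hatom : ∀ k, 0 < k → k < S → μ {x | h x = bdry S μ h k} = 0) {i : ℕ} (hi : i < S) :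
    μ (h ⁻¹' bin S μ h i) ≠ 0 := fun h0 => by
  have h1 := measure_bin hX hμ hh hS hatom hi
  rw [Measure.real, h0, ENNReal.toReal_zero] at h1
  have : (0 : ℝ) < 1 / S := by positivity
  exact this.ne h1

end BinLimits

section ProjectorLimits

variable {M : Type*} [MetricSpace M] [MeasurableSpace M] [BorelSpace M] {X : Set M} {h : M → ℝ}
  {ν : ℕ → Measure M} {μ : Measure M} {S : ℕ}

theorem inner_binProj {τ : Measure M} [IsFiniteMeasure τ] (hh : Continuous h) (hS : 0 < S)
    (hint : Integrable h τ) (hpos : ∀ i < S, τ (h ⁻¹' bin S τ h i) ≠ 0) {i : ℕ} (hi : i < S)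
    (φ ψ : BoundedContinuousFunction M ℂ) :
    ⟪φ.toLp 2 τ ℂ, binProj S τ hh.measurable i (ψ.toLp 2 τ ℂ)⟫_ℂ =
      ∫ x in h ⁻¹' bin S τ h i, (starRingEnd ℂ) (φ x) * ψ x ∂τ := by
  rw [binProj, specProj, inner_indicatorOp, preimage_quantized hS hint hpos hi]
  refine integral_congr_ae (ae_restrict_of_ae ?_)
  filter_upwards [φ.coeFn_toLp 2 τ ℂ, ψ.coeFn_toLp 2 τ ℂ] with x h1 h2
  rw [h1, h2]

/-- Matrix elements of the spectral projectors converge between continuous functions. -/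
theorem WeakConvOn.tendsto_inner_binProj [∀ N, IsFiniteMeasure (ν N)] [IsProbabilityMeasure μ]
    (hw : WeakConvOn X ν μ) (hh : Continuous h) (hS : 0 < S)
    (hconv : ∀ k, 0 < k → k < S →
      Tendsto (fun N => bdry S (ν N) h k) atTop (𝓝 (bdry S μ h k)))
    (hatom : ∀ k, 0 < k → k < S → μ {x | h x = bdry S μ h k} = 0) {i : ℕ} (hi : i < S)
    (φ ψ : BoundedContinuousFunction M ℂ) :
    Tendsto (fun N => ⟪φ.toLp 2 (ν N) ℂ, binProj S (ν N) hh.measurable i (ψ.toLp 2 (ν N) ℂ)⟫_ℂ)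
      atTop (𝓝 ⟪φ.toLp 2 μ ℂ, binProj S μ hh.measurable i (ψ.toLp 2 μ ℂ)⟫_ℂ) := by
  have hint : ∀ (τ : Measure M) [IsFiniteMeasure τ], τ Xᶜ = 0 → Integrable h τ := fun τ _ hτ =>
    integrable_of_continuousOn hw.isCompact hτ hh.continuousOn
  have hlt : ∀ k, 0 < k → k + 1 < S → bdry S μ h k < bdry S μ h (k + 1) := fun k h0 hk =>
    bdry_lt_bdry hw.isCompact hw.null_limit hh hatom h0 (Nat.lt_succ_self k) hk
  have hpos : ∀ j < S, μ (h ⁻¹' bin S μ h j) ≠ 0 := fun j hj =>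
    bin_measure_ne_zero hw.isCompact hw.null_limit hh hS hatom hj
  have hposN : ∀ᶠ N in atTop, ∀ j ∈ Finset.range S, ν N (h ⁻¹' bin S (ν N) h j) ≠ 0 := by
    refine (Finset.eventually_all _).2 fun j hj => ?_
    have hlim := hw.tendsto_setIntegral_bin hh hS hconv hatom hlt
      (continuousOn_const (c := (1 : ℂ))) (Finset.mem_range.1 hj)
    have hne : ∫ _x in h ⁻¹' bin S μ h j, (1 : ℂ) ∂μ ≠ 0 := by
      rw [setIntegral_const, measure_bin hw.isCompact hw.null_limit hh hS hatom
        (Finset.mem_range.1 hj)]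
      simp [hS.ne']
    filter_upwards [hlim.eventually_ne hne] with N hN h0
    rw [Measure.restrict_eq_zero.2 h0, integral_zero_measure] at hN
    exact hN rfl
  rw [inner_binProj hh hS (hint μ hw.null_limit) hpos hi]
  refine (hw.tendsto_setIntegral_bin hh hS hconv hatom hlt
    (g := fun x => (starRingEnd ℂ) (φ x) * ψ x) (by fun_prop) hi).congr' ?_
  filter_upwards [hposN] with N hN
  exact (inner_binProj hh hS (hint _ (hw.null N))
    (fun j hj => hN j (Finset.mem_range.2 hj)) hi φ ψ).symm

end ProjectorLimits

/-! ### Sampling measures and shift operators -/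

section Sampling

variable {M : Type*} [MeasurableSpace M] {x : ℕ → M} {N : ℕ}

theorem samplingMeasure_null {X : Set M} (hx : ∀ n, x n ∈ X) (hX : MeasurableSet X) (N : ℕ) :
    samplingMeasure x N Xᶜ = 0 := by
  simp [samplingMeasure, Measure.finsetSum_apply, Measure.dirac_apply' _ hX.compl, hx]

variable [MeasurableSingletonClass M]

theorem integral_samplingMeasure {E : Type*} [NormedAddCommGroup E] [NormedSpace ℝ E]
    [CompleteSpace E] (x : ℕ → M) (N : ℕ) (f : M → E) :
    ∫ z, f z ∂(samplingMeasure x N) = (N : ℝ)⁻¹ • ∑ n ∈ Finset.range N, f (x n) := by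
  rw [samplingMeasure, integral_smul_measure, integral_finsetSum_measure]
  · simp [integral_dirac]
  · exact fun n _ => integrable_dirac (by simp)

theorem samplingMeasure_real_univ_le (x : ℕ → M) (N : ℕ) :
    (samplingMeasure x N).real Set.univ ≤ 1 := by
  have h := integral_samplingMeasure x N (fun _ => (1 : ℝ))
  simp only [integral_const, smul_eq_mul, mul_one, Finset.sum_const, Finset.card_range,
    nsmul_eq_mul] at h
  rw [h]
  exact inv_mul_le_one

theorem norm_sq_samplingMeasure (f : Lp ℂ 2 (samplingMeasure x N)) :
    ‖f‖ ^ 2 = (N : ℝ)⁻¹ * ∑ n ∈ Finset.range N, ‖f (x n)‖ ^ 2 := by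
  rw [← integral_norm_sq_eq, integral_samplingMeasure, smul_eq_mul]

/-- An orthonormal basis with `N` elements forces the `N` sampling points to be distinct. -/
theorem injOn_of_basis (b : HilbertBasis (Fin N) ℂ (Lp ℂ 2 (samplingMeasure x N))) :
    Set.InjOn x (Set.Iio N) := by
  classical
  set T := (Finset.range N).image x with hT
  have hmem : ∀ t : T, ∃ n < N, x n = t := fun t => by
    obtain ⟨n, hn, hnt⟩ := Finset.mem_image.1 t.2
    exact ⟨n, Finset.mem_range.1 hn, hnt⟩
  let ev : Lp ℂ 2 (samplingMeasure x N) →ₗ[ℂ] (T → ℂ) :=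
    { toFun := fun f t => f t
      map_add' := fun f g => by
        ext t
        obtain ⟨n, hn, hnt⟩ := hmem t
        have h1 := coe_eq_of_ae hn (Lp.coeFn_add f g)
        rw [hnt] at h1
        exact h1
      map_smul' := fun c f => by
        ext t
        obtain ⟨n, hn, hnt⟩ := hmem t
        have h1 := coe_eq_of_ae hn (Lp.coeFn_smul c f)
        rw [hnt] at h1
        exact h1 }
  have hev : LinearMap.ker ev = ⊥ := by
    refine LinearMap.ker_eq_bot'.2 fun f hf => ?_
    have h0 : ‖f‖ ^ 2 = 0 := by
      rw [norm_sq_samplingMeasure, Finset.sum_eq_zero, mul_zero]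
      intro n hn
      have h1 : f (x n) = 0 := congrFun hf ⟨x n, Finset.mem_image_of_mem x hn⟩
      simp [h1]
    simpa using h0
  have hli := b.orthonormal.linearIndependent.map' ev hev
  have hcard := hli.fintype_card_le_finrank
  rw [Module.finrank_fintype_fun_eq_card, Fintype.card_fin, Fintype.card_coe, hT] at hcard
  have hc : ((Finset.range N).image x).card = (Finset.range N).card := by
    refine le_antisymm Finset.card_image_le ?_
    simpa using hcard
  have hinj := Finset.card_image_iff.1 hc
  simpa [Finset.coe_range] using hinj

theorem inner_shiftOp (hx : Set.InjOn x (Set.Iio N)) (q : ℕ)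
    (f g : Lp ℂ 2 (samplingMeasure x N)) :
    ⟪f, shiftOp x N q g⟫_ℂ =
      (N : ℂ)⁻¹ * ∑ n ∈ Finset.range (N - q), (starRingEnd ℂ) (f (x n)) * g (x (n + q)) := by
  rw [shiftOp, _root_.sum_apply, inner_sum, Finset.mul_sum]
  refine Finset.sum_congr rfl fun n hn => ?_
  have hn' : n + q < N := by have := Finset.mem_range.1 hn; omega
  have hN : (N : ℂ) ≠ 0 := by exact_mod_cast (by omega : N ≠ 0)
  rw [_root_.smul_apply, InnerProductSpace.rankOne_apply, inner_smul_right, inner_smul_right,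
    inner_pointInd hn' hx, ← inner_conj_symm, inner_pointInd (by omega) hx, map_mul, map_inv₀,
    Complex.conj_natCast]
  field_simp

theorem norm_inner_shiftOp_le (hx : Set.InjOn x (Set.Iio N)) (q : ℕ)
    (f g : Lp ℂ 2 (samplingMeasure x N)) : ‖⟪f, shiftOp x N q g⟫_ℂ‖ ≤ ‖f‖ * ‖g‖ := by
  set F := ∑ n ∈ Finset.range N, ‖f (x n)‖ ^ 2 with hF
  set G := ∑ n ∈ Finset.range N, ‖g (x n)‖ ^ 2 with hG
  have h1 : ‖∑ n ∈ Finset.range (N - q), (starRingEnd ℂ) (f (x n)) * g (x (n + q))‖ ≤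
      √F * √G := by
    have hsum : ∑ n ∈ Finset.range (N - q), ‖f (x n)‖ * ‖g (x (n + q))‖ ≤
        √(∑ n ∈ Finset.range (N - q), ‖f (x n)‖ ^ 2) *
          √(∑ n ∈ Finset.range (N - q), ‖g (x (n + q))‖ ^ 2) :=
      Real.sum_mul_le_sqrt_mul_sqrt _ _ _
    have hFle : ∑ n ∈ Finset.range (N - q), ‖f (x n)‖ ^ 2 ≤ F :=
      Finset.sum_le_sum_of_subset_of_nonneg (Finset.range_mono (Nat.sub_le N q))
        fun _ _ _ => sq_nonneg _
    have hGle : ∑ n ∈ Finset.range (N - q), ‖g (x (n + q))‖ ^ 2 ≤ G := by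
      have h2 := Finset.sum_Ico_eq_sum_range (fun n => ‖g (x n)‖ ^ 2) q N
      simp only [add_comm q] at h2
      rw [← h2]
      refine Finset.sum_le_sum_of_subset_of_nonneg (fun n hn => ?_) fun _ _ _ => sq_nonneg _
      exact Finset.mem_range.2 (Finset.mem_Ico.1 hn).2
    refine (norm_sum_le _ _).trans ?_
    simp only [norm_mul, RCLike.norm_conj]
    refine hsum.trans ?_
    gcongr
  have hn : ∀ u : Lp ℂ 2 (samplingMeasure x N),
      ‖u‖ = √((N : ℝ)⁻¹) * √(∑ n ∈ Finset.range N, ‖u (x n)‖ ^ 2) := fun u => by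
    rw [← Real.sqrt_mul (by positivity), ← norm_sq_samplingMeasure, Real.sqrt_sq (norm_nonneg _)]
  rw [inner_shiftOp hx, norm_mul, norm_inv, Complex.norm_natCast, hn f, hn g]
  have h3 : √((N : ℝ)⁻¹) * √((N : ℝ)⁻¹) = (N : ℝ)⁻¹ := Real.mul_self_sqrt (by positivity)
  calc (N : ℝ)⁻¹ * _ ≤ (N : ℝ)⁻¹ * (√F * √G) := by gcongr
    _ = √((N : ℝ)⁻¹) * √F * (√((N : ℝ)⁻¹) * √G) := by rw [mul_mul_mul_comm, h3]

end Sampling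

section Koopman

variable {M : Type*} [MetricSpace M] [MeasurableSpace M] [BorelSpace M]

theorem inner_koopman {μ : Measure M} [IsFiniteMeasure μ] {T : M → M}
    (hT : MeasurePreserving T μ μ) (φ ψ : BoundedContinuousFunction M ℂ) :
    ⟪φ.toLp 2 μ ℂ, koopman hT (ψ.toLp 2 μ ℂ)⟫_ℂ = ∫ z, (starRingEnd ℂ) (φ z) * ψ (T z) ∂μ := by
  rw [L2.inner_def]
  refine integral_congr_ae ?_
  have h1 : koopman hT (ψ.toLp 2 μ ℂ) =ᵐ[μ] ψ.toLp 2 μ ℂ ∘ T :=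
    Lp.coeFn_compMeasurePreserving _ hT
  filter_upwards [h1, φ.coeFn_toLp 2 μ ℂ,
    hT.quasiMeasurePreserving.ae_eq_comp (ψ.coeFn_toLp 2 μ ℂ)] with z hz1 hz2 hz3
  rw [hz1, hz2, hz3, RCLike.inner_apply, mul_comm]
  rfl

/-- Matrix elements of the shift operators converge to those of the Koopman operator: up to `q`
boundary terms they are averages of a continuous function along the orbit. -/
theorem tendsto_inner_shiftOp {Φ : Flow ℝ M} {Δt : ℝ} {x₀ : M} {μ : Measure M}
    [IsFiniteMeasure μ] (hinv : ∀ t : ℝ, MeasurePreserving (Φ t) μ μ)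
    (hx₀ : InBasin Φ Δt μ x₀) (hinj : ∀ N, Set.InjOn (orbit Φ Δt x₀) (Set.Iio N)) (q : ℕ)
    (φ ψ : BoundedContinuousFunction M ℂ) :
    Tendsto (fun N => ⟪φ.toLp 2 (samplingMeasure (orbit Φ Δt x₀) N) ℂ,
        shiftOp (orbit Φ Δt x₀) N q (ψ.toLp 2 (samplingMeasure (orbit Φ Δt x₀) N) ℂ)⟫_ℂ) atTop
      (𝓝 ⟪φ.toLp 2 μ ℂ, koopman (hinv ((q : ℝ) * Δt)) (ψ.toLp 2 μ ℂ)⟫_ℂ) := by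
  set x := orbit Φ Δt x₀ with hx
  have hstep : ∀ n, x (n + q) = Φ ((q : ℝ) * Δt) (x n) := fun n => by
    rw [hx, orbit, orbit, ← Flow.map_add]
    congr 1
    push_cast
    ring
  have hcont : Continuous (Φ ((q : ℝ) * Δt)) := Φ.continuous continuous_const continuous_id
  set u : BoundedContinuousFunction M ℂ := star φ * ψ.compContinuous ⟨_, hcont⟩ with hu
  have hux : ∀ z, u z = (starRingEnd ℂ) (φ z) * ψ (Φ ((q : ℝ) * Δt) z) := fun z => rfl
  have hlim := hx₀ u
  rw [inner_koopman]
  have hdiff : Tendsto (fun N : ℕ => ∫ z, u z ∂(samplingMeasure x N) -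
      ⟪φ.toLp 2 (samplingMeasure x N) ℂ,
        shiftOp x N q (ψ.toLp 2 (samplingMeasure x N) ℂ)⟫_ℂ) atTop (𝓝 0) := by
    have hbound : Tendsto (fun N : ℕ => (q * ‖u‖) * (N : ℝ)⁻¹) atTop (𝓝 0) := by
      simpa using (tendsto_inv_atTop_nhds_zero_nat (𝕜 := ℝ)).const_mul (q * ‖u‖)
    refine squeeze_zero_norm' ?_ hbound
    filter_upwards [eventually_ge_atTop q] with N hN
    have h1 : ⟪φ.toLp 2 (samplingMeasure x N) ℂ,
        shiftOp x N q (ψ.toLp 2 (samplingMeasure x N) ℂ)⟫_ℂ =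
        (N : ℂ)⁻¹ * ∑ n ∈ Finset.range (N - q), u (x n) := by
      rw [inner_shiftOp (hinj N)]
      congr 1
      refine Finset.sum_congr rfl fun n hn => ?_
      have hn' := Finset.mem_range.1 hn
      rw [coe_eq_of_ae (show n < N by omega) (φ.coeFn_toLp 2 _ ℂ),
        coe_eq_of_ae (show n + q < N by omega) (ψ.coeFn_toLp 2 _ ℂ), hux, hstep]
    have h2 : ∫ z, u z ∂(samplingMeasure x N) = (N : ℂ)⁻¹ * ∑ n ∈ Finset.range N, u (x n) := by
      rw [integral_samplingMeasure, Complex.real_smul]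
      push_cast
      rfl
    have h3 : ∑ n ∈ Finset.range N, u (x n) = ∑ n ∈ Finset.range (N - q), u (x n) +
        ∑ n ∈ Finset.range q, u (x (N - q + n)) := by
      rw [← Finset.sum_range_add, Nat.sub_add_cancel hN]
    rw [h1, h2, h3, ← mul_sub, add_sub_cancel_left, norm_mul, norm_inv, Complex.norm_natCast,
      mul_comm]
    refine mul_le_mul_of_nonneg_right ?_ (by positivity)
    refine (norm_sum_le _ _).trans ?_
    calc _ ≤ ∑ _n ∈ Finset.range q, ‖u‖ := Finset.sum_le_sum fun n _ => u.norm_coe_le_norm _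
      _ = q * ‖u‖ := by simp
  have := hlim.sub hdiff
  rw [sub_zero] at this
  refine (this.congr fun N => ?_)
  ring

end Koopman

/-! ### Spectral approximation of a kernel integral operator along sampling measures -/

theorem contRep_ae_eq {Z : Type*} [MeasurableSpace Z] {τ : Measure Z} {k : Z → Z → ℝ} {c : ℝ}
    {f : Lp ℂ 2 τ} (hf : IsEigen k τ c f) (hc : c ≠ 0) : contRep k τ c f =ᵐ[τ] f := by
  filter_upwards [hf] with x hx
  rw [contRep, hx, inv_mul_cancel_left₀ (by exact_mod_cast hc)]

section KernelLimits

variable {M : Type*} [MetricSpace M] [MeasurableSpace M] [BorelSpace M] {X : Set M}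
  {ν : ℕ → Measure M} {μ : Measure M} {kN : ℕ → M → M → ℝ} {k : M → M → ℝ}

/-- Kernels that converge uniformly on a compact set, together with weakly converging measures
that are carried by it. -/
structure KernelConvOn (X : Set M) (ν : ℕ → Measure M) (μ : Measure M) (kN : ℕ → M → M → ℝ)
    (k : M → M → ℝ) : Prop extends WeakConvOn X ν μ where
  kernelN : ∀ N, 0 < N → IsKernelOn X (kN N)
  kernel : IsKernelOn X k
  uniform : TendstoUniformlyOn (fun N (z : M × M) => kN N z.1 z.2) (fun z => k z.1 z.2) atTop
    (X ×ˢ X)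

namespace KernelConvOn

theorem tendstoUniformlyOn_kernelInt (hk : KernelConvOn X ν μ kN k) {f : M → ℂ}
    (hf : ContinuousOn f X) :
    TendstoUniformlyOn (fun N => kernelInt (kN N) (ν N) f) (kernelInt k μ f) atTop X := by
  have hprod : ∀ {g : M → M → ℝ}, IsKernelOn X g →
      ContinuousOn (Function.uncurry fun x y => (g x y : ℂ) * f y) (X ×ˢ X) := fun hg =>
    (Complex.continuous_ofReal.comp_continuousOn hg.1).mul
      (hf.comp continuousOn_snd fun z hz => hz.2)
  refine hk.tendstoUniformlyOn_integral (hprod hk.kernel) ?_ ?_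
  · filter_upwards [eventually_gt_atTop 0] with N hN using hprod (hk.kernelN N hN)
  · obtain ⟨C, hC⟩ := hk.isCompact.exists_bound_of_continuousOn hf
    have hC1 : 0 < max C 1 := lt_of_lt_of_le one_pos (le_max_right _ _)
    have hu := hk.uniform
    rw [Metric.tendstoUniformlyOn_iff] at hu ⊢
    intro ε hε
    filter_upwards [hu (ε / max C 1) (by positivity)] with N hN z hz
    have h1 := hN z hz
    rw [Real.dist_eq] at h1
    rw [dist_eq_norm, ← sub_mul, norm_mul, ← Complex.ofReal_sub, Complex.norm_real,
      Real.norm_eq_abs]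
    calc _ ≤ |k z.1 z.2 - kN N z.1 z.2| * max C 1 :=
          mul_le_mul_of_nonneg_left ((hC z.2 hz.2).trans (le_max_left _ _)) (abs_nonneg _)
      _ < ε / max C 1 * max C 1 := mul_lt_mul_of_pos_right h1 hC1
      _ = ε := div_mul_cancel₀ ε hC1.ne'

/-- Squared Hilbert–Schmidt norms converge. -/
theorem tendsto_integral_sq (hk : KernelConvOn X ν μ kN k) :
    Tendsto (fun N => ∫ x, ∫ y, kN N x y ^ 2 ∂(ν N) ∂(ν N)) atTop
      (𝓝 (∫ x, ∫ y, k x y ^ 2 ∂μ ∂μ)) := by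
  have := hk.finite
  have := hk.prob
  have hsq : ∀ {g : M → M → ℝ}, IsKernelOn X g →
      ContinuousOn (Function.uncurry fun x y => ((g x y ^ 2 : ℝ) : ℂ)) (X ×ˢ X) := fun hg =>
    Complex.continuous_ofReal.comp_continuousOn (hg.1.pow 2)
  have hunif : TendstoUniformlyOn (fun N (z : M × M) => ((kN N z.1 z.2 ^ 2 : ℝ) : ℂ))
      (fun z => ((k z.1 z.2 ^ 2 : ℝ) : ℂ)) atTop (X ×ˢ X) := by
    obtain ⟨C, hC⟩ := (hk.isCompact.prod hk.isCompact).exists_bound_of_continuousOn hk.kernel.1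
    have hC1 : 0 < max C 1 := lt_of_lt_of_le one_pos (le_max_right _ _)
    have hu := hk.uniform
    rw [Metric.tendstoUniformlyOn_iff] at hu ⊢
    intro ε hε
    set δ := min 1 (ε / (3 * max C 1)) with hδ
    have hδ0 : 0 < δ := lt_min one_pos (by positivity)
    filter_upwards [hu δ hδ0] with N hN z hz
    have h1 := hN z hz
    rw [Real.dist_eq] at h1
    have h2 : |k z.1 z.2| ≤ max C 1 := (hC z hz).trans (le_max_left _ _)
    have h3 : |k z.1 z.2 + kN N z.1 z.2| ≤ 3 * max C 1 := by
      have h4 : k z.1 z.2 + kN N z.1 z.2 = 2 * k z.1 z.2 - (k z.1 z.2 - kN N z.1 z.2) := by ring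
      rw [h4]
      refine (abs_sub _ _).trans ?_
      rw [abs_mul, abs_two]
      have h5 : δ ≤ max C 1 := (min_le_left _ _).trans (le_max_right _ _)
      linarith
    rw [dist_eq_norm, ← Complex.ofReal_sub, Complex.norm_real, Real.norm_eq_abs, sq_sub_sq,
      abs_mul, mul_comm]
    calc _ ≤ |k z.1 z.2 - kN N z.1 z.2| * (3 * max C 1) :=
          mul_le_mul_of_nonneg_left h3 (abs_nonneg _)
      _ < δ * (3 * max C 1) := mul_lt_mul_of_pos_right h1 (by positivity)
      _ ≤ ε / (3 * max C 1) * (3 * max C 1) :=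
          mul_le_mul_of_nonneg_right (min_le_right _ _) (by positivity)
      _ = ε := div_mul_cancel₀ ε (by positivity)
  have hU := hk.tendstoUniformlyOn_integral (hsq hk.kernel)
    (by filter_upwards [eventually_gt_atTop 0] with N hN using hsq (hk.kernelN N hN)) hunif
  have hlim := hk.tendsto_integral_of_tendstoUniformlyOn
    (continuousOn_integral_kernel hk.isCompact hk.null_limit (hsq hk.kernel))
    (by
      filter_upwards [eventually_gt_atTop 0] with N hN
      exact continuousOn_integral_kernel hk.isCompact (hk.null N) (hsq (hk.kernelN N hN))) hU
  simp only [integral_complex_ofReal] at hlim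
  have h2 := (Complex.continuous_re.tendsto _).comp hlim
  simpa only [Function.comp_def, Complex.ofReal_re] using h2

variable [IsProbabilityMeasure μ] {b : HilbertBasis ℕ ℂ (Lp ℂ 2 μ)} {lam : ℕ → ℝ}
  {φ : ℕ → BoundedContinuousFunction M ℂ}

theorem exists_extension (hk : KernelConvOn X ν μ kN k) (b : HilbertBasis ℕ ℂ (Lp ℂ 2 μ))
    (lam : ℕ → ℝ) : ∃ φ : ℕ → BoundedContinuousFunction M ℂ,
      ∀ m, ∀ x ∈ X, φ m x = contRep k μ (lam m) (b m) x := by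
  have h : ∀ m, ∃ φ : BoundedContinuousFunction M ℂ,
      ∀ x ∈ X, φ x = contRep k μ (lam m) (b m) x := fun m =>
    exists_boundedContinuous_extension hk.isCompact (continuousOn_const.mul
      (continuousOn_kernelInt hk.isCompact hk.null_limit hk.kernel.1 (integrable_Lp_two (b m))))
  choose φ hφ using h
  exact ⟨φ, hφ⟩

theorem toLp_extension (hk : KernelConvOn X ν μ kN k) (hb : IsEigenbasis k μ b lam)
    (hlam : ∀ j, 0 < lam j) (hφ : ∀ m, ∀ x ∈ X, φ m x = contRep k μ (lam m) (b m) x) (m : ℕ) :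
    (φ m).toLp 2 μ ℂ = b m := by
  refine Lp.ext ?_
  filter_upwards [(φ m).coeFn_toLp 2 μ ℂ, contRep_ae_eq (hb.1 m) (hlam m).ne',
    ae_mem_of_compl_null hk.null_limit] with x h1 h2 hx
  rw [h1, hφ m x hx, h2]

theorem eventually_residual (hk : KernelConvOn X ν μ kN k) (hb : IsEigenbasis k μ b lam)
    (hlam : ∀ j, 0 < lam j) (hφ : ∀ m, ∀ x ∈ X, φ m x = contRep k μ (lam m) (b m) x) (m : ℕ)
    {ε : ℝ} (hε : 0 < ε) :
    ∀ᶠ N in atTop, ∀ x ∈ X, ‖kernelInt (kN N) (ν N) (φ m) x - lam m * φ m x‖ ≤ ε := by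
  have hu := hk.tendstoUniformlyOn_kernelInt (φ m).continuous.continuousOn
  rw [Metric.tendstoUniformlyOn_iff] at hu
  filter_upwards [hu ε hε] with N hN x hx
  have h1 := hN x hx
  have h2 : kernelInt k μ (φ m) x = lam m * φ m x := by
    have h3 : kernelInt k μ (φ m) x = kernelInt k μ (b m) x := by
      refine integral_congr_ae ?_
      rw [← hk.toLp_extension hb hlam hφ m]
      filter_upwards [(φ m).coeFn_toLp 2 μ ℂ] with y hy
      rw [hy]
    rw [h3, hφ m x hx, contRep, mul_inv_cancel_left₀ (by exact_mod_cast (hlam m).ne')]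
  rw [dist_comm, dist_eq_norm, h2] at h1
  exact h1.le

variable [∀ N, IsFiniteMeasure (ν N)] {bN : ∀ N, HilbertBasis (Fin N) ℂ (Lp ℂ 2 (ν N))}
  {lamN : ∀ N, Fin N → ℝ}

theorem tendsto_gram (hk : KernelConvOn X ν μ kN k) (hb : IsEigenbasis k μ b lam)
    (hlam : ∀ j, 0 < lam j) (hφ : ∀ m, ∀ x ∈ X, φ m x = contRep k μ (lam m) (b m) x) (m m' : ℕ) :
    Tendsto (fun N => ⟪(φ m).toLp 2 (ν N) ℂ, (φ m').toLp 2 (ν N) ℂ⟫_ℂ) atTop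
      (𝓝 (if m = m' then 1 else 0)) := by
  have hlim := hk.tendsto_integral (f := fun x => φ m' x * (starRingEnd ℂ) (φ m x)) (by fun_prop)
  rw [← BoundedContinuousFunction.inner_toLp, hk.toLp_extension hb hlam hφ,
    hk.toLp_extension hb hlam hφ, orthonormal_iff_ite.1 b.orthonormal] at hlim
  exact hlim.congr fun N => (BoundedContinuousFunction.inner_toLp _ _ _).symm

/-- The coefficients of the continuous eigenfunctions of the limiting kernel in the eigenbases of
the approximating kernels, set to `0` for indices `j ≥ N`. -/
noncomputable def coeff (bN : ∀ N, HilbertBasis (Fin N) ℂ (Lp ℂ 2 (ν N)))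
    (φ : ℕ → BoundedContinuousFunction M ℂ) (N j m : ℕ) : ℂ :=
  if hj : j < N then ⟪bN N ⟨j, hj⟩, (φ m).toLp 2 (ν N) ℂ⟫_ℂ else 0

theorem sum_coeff (f : ℕ → ℂ → ℝ) (N m : ℕ) :
    ∑ j ∈ Finset.range N, f j (coeff bN φ N j m) =
      ∑ j : Fin N, f j ⟪bN N j, (φ m).toLp 2 (ν N) ℂ⟫_ℂ := by
  rw [Finset.sum_range]
  refine Finset.sum_congr rfl fun j _ => ?_
  rw [coeff, dif_pos j.2]

/-- Eigenvalues of the approximating kernels, extended by zero. -/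
noncomputable def extendedEigenvalue (lamN : ∀ N, Fin N → ℝ) (N j : ℕ) : ℝ :=
  if hj : j < N then lamN N ⟨j, hj⟩ else 0

theorem extendedEigenvalue_fin (N : ℕ) (j : Fin N) : extendedEigenvalue lamN N j = lamN N j := by
  rw [extendedEigenvalue, dif_pos j.2]

theorem spectralApprox (hk : KernelConvOn X ν μ kN k) (hb : IsEigenbasis k μ b lam)
    (hlam : ∀ j, 0 < lam j) (hφ : ∀ m, ∀ x ∈ X, φ m x = contRep k μ (lam m) (b m) x)
    (hbN : ∀ N, IsEigenbasis (kN N) (ν N) (bN N) (lamN N)) :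
    SpectralApprox (extendedEigenvalue lamN) lam (coeff bN φ) where
  antitoneOn N i hi j hj hij := by
    rw [extendedEigenvalue, extendedEigenvalue, dif_pos (Set.mem_Iio.1 hi),
      dif_pos (Set.mem_Iio.1 hj)]
    exact (hbN N).2 hij
  antitone := hb.2
  nonneg j := (hlam j).le
  norm m := by
    have h1 := (tendsto_norm_of_gram (v := fun N m => (φ m).toLp 2 (ν N) ℂ) (m := m)
      (by simpa using hk.tendsto_gram hb hlam hφ m m)).pow 2
    rw [one_pow] at h1
    refine h1.congr fun N => ?_
    rw [sum_coeff (bN := bN) (fun _ c => ‖c‖ ^ 2)]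
    exact (hasSum_norm_inner_sq (bN N) _).unique (hasSum_fintype _)
  bessel n := by
    refine ⟨fun N => 1 + ∑ m : Fin n, ∑ l : Fin n, ‖(φ m).toLp 2 (ν N) ℂ‖ *
      ‖(φ l).toLp 2 (ν N) ℂ‖ * ‖⟪(φ m).toLp 2 (ν N) ℂ, (φ l).toLp 2 (ν N) ℂ⟫_ℂ -
        if m = l then 1 else 0‖, ?_, ?_⟩
    · have hn : ∀ m : Fin n, Tendsto (fun N => ‖(φ m).toLp 2 (ν N) ℂ‖) atTop (𝓝 1) := fun m =>
        tendsto_norm_of_gram (v := fun N (m : ℕ) => (φ m).toLp 2 (ν N) ℂ) (m := (m : ℕ))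
          (by simpa using hk.tendsto_gram hb hlam hφ m m)
      have hg : ∀ m l : Fin n, Tendsto (fun N => ‖⟪(φ m).toLp 2 (ν N) ℂ,
          (φ l).toLp 2 (ν N) ℂ⟫_ℂ - if m = l then 1 else 0‖) atTop (𝓝 0) := fun m l => by
        have h1 := ((hk.tendsto_gram hb hlam hφ m l).sub_const (if m = l then 1 else 0)).norm
        simpa [Fin.ext_iff] using h1
      have h2 := (tendsto_finsetSum Finset.univ fun m _ =>
        tendsto_finsetSum Finset.univ fun l _ => ((hn m).mul (hn l)).mul (hg m l)).const_add 1
      simpa using h2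
    · intro N j hj
      rw [Finset.sum_range]
      have h1 := sum_norm_inner_sq_le (fun m : Fin n => (φ m).toLp 2 (ν N) ℂ)
        ((bN N).orthonormal.1 ⟨j, hj⟩)
      simpa only [coeff, dif_pos hj] using h1
  residual m := by
    rw [Metric.tendsto_nhds]
    intro ε hε
    filter_upwards [hk.eventually_residual hb hlam hφ m (ε := √(ε / 2)) (by positivity),
      eventually_gt_atTop 0] with N hN hN0
    have h1 := sum_residual_le hk.isCompact (hk.null N) (hk.mass_le N) (hk.kernelN N hN0)
      (hbN N).1 (φ m).continuous.continuousOn hN ((φ m).coeFn_toLp 2 (ν N) ℂ)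
    rw [Real.sq_sqrt (by positivity)] at h1
    have h2 : ∑ j ∈ Finset.range N, (extendedEigenvalue lamN N j - lam m) ^ 2 *
        ‖coeff bN φ N j m‖ ^ 2 =
        ∑ j : Fin N, (lamN N j - lam m) ^ 2 * ‖⟪bN N j, (φ m).toLp 2 (ν N) ℂ⟫_ℂ‖ ^ 2 := by
      rw [sum_coeff (bN := bN) (fun j c => (extendedEigenvalue lamN N j - lam m) ^ 2 * ‖c‖ ^ 2)]
      simp only [extendedEigenvalue_fin]
    rw [h2, Real.dist_eq, sub_zero, abs_of_nonneg (by positivity)]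
    linarith
  summable := (hasSum_eigenvalue_sq hk.isCompact hk.null_limit hk.kernel hb.1).summable
  hilbertSchmidt := by
    rw [(hasSum_eigenvalue_sq hk.isCompact hk.null_limit hk.kernel hb.1).tsum_eq]
    refine hk.tendsto_integral_sq.congr' ?_
    filter_upwards [eventually_gt_atTop 0] with N hN
    rw [Finset.sum_range]
    simp only [extendedEigenvalue_fin]
    exact (hasSum_eigenvalue_sq hk.isCompact (hk.null N) (hk.kernelN N hN) (hbN N).1).unique
      (hasSum_fintype _)

/-- Uniform convergence of an eigenfunction gives convergence of the corresponding coefficient. -/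
theorem tendsto_coeff_self (hk : KernelConvOn X ν μ kN k) (hb : IsEigenbasis k μ b lam)
    (hlam : ∀ j, 0 < lam j) (hφ : ∀ m, ∀ x ∈ X, φ m x = contRep k μ (lam m) (b m) x)
    (hbN : ∀ N, IsEigenbasis (kN N) (ν N) (bN N) (lamN N)) (hlamN : ∀ N j, 0 < lamN N j)
    {m : ℕ} (hunif : ∀ ε > (0 : ℝ), ∀ᶠ N in atTop, ∀ hl : m < N, ∀ x ∈ X,
      ‖contRep (kN N) (ν N) (lamN N ⟨m, hl⟩) (bN N ⟨m, hl⟩) x - contRep k μ (lam m) (b m) x‖ < ε) :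
    Tendsto (fun N => coeff bN φ N m m) atTop (𝓝 1) := by
  have hgram : Tendsto (fun N => ⟪(φ m).toLp 2 (ν N) ℂ, (φ m).toLp 2 (ν N) ℂ⟫_ℂ) atTop (𝓝 1) := by
    simpa using hk.tendsto_gram hb hlam hφ m m
  have hnorm := tendsto_norm_of_gram (v := fun N m => (φ m).toLp 2 (ν N) ℂ) (m := m) hgram
  have hdiff : Tendsto (fun N => coeff bN φ N m m -
      ⟪(φ m).toLp 2 (ν N) ℂ, (φ m).toLp 2 (ν N) ℂ⟫_ℂ) atTop (𝓝 0) := by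
    rw [Metric.tendsto_nhds]
    intro ε hε
    filter_upwards [hunif (ε / 2) (by positivity), eventually_gt_atTop m,
      hnorm.eventually_lt_const (show (1 : ℝ) < 2 by norm_num)] with N h1 hN h2
    rw [coeff, dif_pos hN, ← inner_sub_left, dist_zero_right]
    have h3 : ‖bN N ⟨m, hN⟩ - (φ m).toLp 2 (ν N) ℂ‖ ^ 2 ≤ (ε / 2) ^ 2 := by
      rw [← integral_norm_sq_eq]
      have h4 : ∫ x, ‖(bN N ⟨m, hN⟩ - (φ m).toLp 2 (ν N) ℂ : Lp ℂ 2 (ν N)) x‖ ^ 2 ∂(ν N) ≤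
          ∫ _x, (ε / 2) ^ 2 ∂(ν N) := by
        refine integral_mono_ae (Lp.memLp _).norm.integrable_sq (integrable_const _) ?_
        filter_upwards [Lp.coeFn_sub (bN N ⟨m, hN⟩) ((φ m).toLp 2 (ν N) ℂ),
          (φ m).coeFn_toLp 2 (ν N) ℂ, contRep_ae_eq ((hbN N).1 ⟨m, hN⟩) (hlamN N _).ne',
          ae_mem_of_compl_null (hk.null N)] with x e1 e2 e3 hx
        rw [e1, Pi.sub_apply, e2, ← e3, hφ m x hx]
        exact pow_le_pow_left₀ (norm_nonneg _) (h1 hN x hx).le 2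
      refine h4.trans ?_
      rw [integral_const, smul_eq_mul]
      exact mul_le_of_le_one_left (sq_nonneg _) (hk.mass_le N)
    have h5 := (sq_le_sq₀ (norm_nonneg _) (by positivity)).1 h3
    calc _ ≤ ‖bN N ⟨m, hN⟩ - (φ m).toLp 2 (ν N) ℂ‖ * ‖(φ m).toLp 2 (ν N) ℂ‖ :=
          norm_inner_le_norm _ _
      _ ≤ ε / 2 * ‖(φ m).toLp 2 (ν N) ℂ‖ := mul_le_mul_of_nonneg_right h5 (norm_nonneg _)
      _ < ε / 2 * 2 := mul_lt_mul_of_pos_left h2 (by positivity)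
      _ = ε := by ring
  simpa using hdiff.add hgram

end KernelConvOn

theorem SpectralApprox.tendsto_mass_of_diag {Λ : ℕ → ℕ → ℝ} {lam : ℕ → ℝ} {a : ℕ → ℕ → ℕ → ℂ}
    (hA : SpectralApprox Λ lam a) {L m : ℕ} (hm : m < L)
    (hdiag : Tendsto (fun N => a N m m) atTop (𝓝 1)) :
    Tendsto (fun N => ∑ j ∈ Finset.range L, ‖a N j m‖ ^ 2) atTop (𝓝 1) := by
  have hlow : Tendsto (fun N => ‖a N m m‖ ^ 2) atTop (𝓝 1) := by simpa using hdiag.norm.pow 2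
  refine tendsto_of_tendsto_of_tendsto_of_le_of_le' hlow (hA.norm m) ?_ ?_
  · exact Eventually.of_forall fun N => Finset.single_le_sum (f := fun j => ‖a N j m‖ ^ 2)
      (fun _ _ => sq_nonneg _) (Finset.mem_range.2 hm)
  · filter_upwards [eventually_ge_atTop L] with N hLN
    exact Finset.sum_le_sum_of_subset_of_nonneg (Finset.range_mono hLN) fun _ _ _ => sq_nonneg _

end KernelLimits

/-! ### Boundary points, stationary states and the limit of the schemes -/

/-- By ergodicity there is no gap in the distribution of the observable at an inner quantile. -/
theorem lt_cdfOf_of_quantile_lt {M : Type*} [MetricSpace M] [MeasurableSpace M] [BorelSpace M]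
    {Φ : Flow ℝ M} {μ : Measure M} [IsProbabilityMeasure μ]
    (hinv : ∀ t : ℝ, MeasurePreserving (Φ t) μ μ) {Δt : ℝ} (herg : Ergodic (Φ Δt) μ)
    {h : M → ℝ} (hh : Continuous h) {s : ℝ} (hs0 : 0 < s) (hs1 : s < 1)
    (hs : cdfOf μ h (quantile μ h s) = s) {a : ℝ} (ha : quantile μ h s < a) :
    s < cdfOf μ h a := by
  by_contra! hle
  set ξ := quantile μ h s with hξ
  have hmeas : MeasurableSet {x | h x ≤ ξ} := measurableSet_le hh.measurable measurable_const
  have hsub : {x | h x ≤ ξ} ⊆ {x | h x ≤ a} := fun x (hx : h x ≤ ξ) => hx.trans ha.le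
  have hgap : μ {x | ξ < h x ∧ h x < a} = 0 := by
    have h1 : μ.real ({x | h x ≤ a} \ {x | h x ≤ ξ}) = 0 := by
      refine le_antisymm ?_ measureReal_nonneg
      rw [measureReal_sdiff hsub hmeas]
      change cdfOf μ h a - cdfOf μ h ξ ≤ 0
      linarith
    refine measure_mono_null ?_ ((measureReal_eq_zero_iff).1 h1)
    exact fun x hx => ⟨hx.2.le, not_le.2 hx.1⟩
  rcases null_of_gap hinv herg hh ha hgap with h0 | h1
  · rw [cdfOf, measureReal_def, h0] at hs
    simp only [ENNReal.toReal_zero] at hs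
    exact hs0.ne hs
  · have h2 := (prob_compl_eq_zero_iff hmeas).1 h1
    rw [cdfOf, measureReal_def, h2] at hs
    simp only [ENNReal.toReal_one] at hs
    exact hs1.ne' hs

theorem IsKernelOn.comp {Z W : Type*} [TopologicalSpace Z] [TopologicalSpace W]
    {k : W → W → ℝ} (hk : IsKernelOn Set.univ k) {F : Z → W} (hF : Continuous F) (A : Set Z) :
    IsKernelOn A fun x y => k (F x) (F y) := by
  have hc : Continuous (Function.uncurry k) := by
    rw [← continuousOn_univ, ← Set.univ_prod_univ]
    exact hk.1
  refine ⟨?_, fun x _ y _ => hk.2.1 _ trivial _ trivial, fun n x _ =>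
    hk.2.2 n (fun i => F (x i)) fun _ => trivial⟩
  exact (hc.comp ((hF.comp continuous_fst).prodMk (hF.comp continuous_snd))).continuousOn

theorem KernelStrictlyPositive.eigenvalue_pos {M ι : Type*} [MeasurableSpace M] [Preorder ι]
    {k : M → M → ℝ} {ν : Measure M} (hk : KernelStrictlyPositive k ν)
    {b : HilbertBasis ι ℂ (Lp ℂ 2 ν)} {lam : ι → ℝ} (hb : IsEigenbasis k ν b lam) (j : ι) :
    0 < lam j :=
  hk _ (b j) (fun h0 => by simpa [h0] using b.orthonormal.1 j) (hb.1 j)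

section Coefficients

variable {M : Type*} [MetricSpace M] [MeasurableSpace M] [BorelSpace M] {X : Set M}
  {ν : ℕ → Measure M} {μ : Measure M} {kN : ℕ → M → M → ℝ} {k : M → M → ℝ}
  [IsProbabilityMeasure μ] {b : HilbertBasis ℕ ℂ (Lp ℂ 2 μ)} {lam : ℕ → ℝ}
  {φ : ℕ → BoundedContinuousFunction M ℂ}
  [∀ N, IsFiniteMeasure (ν N)] {bN : ∀ N, HilbertBasis (Fin N) ℂ (Lp ℂ 2 (ν N))}
  {lamN : ∀ N, Fin N → ℝ}

/-- At an admissible spectral resolution the leading approximating eigenvectors capture the whole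
mass of each leading limiting eigenfunction. -/
theorem KernelConvOn.tendsto_mass (hk : KernelConvOn X ν μ kN k) (hb : IsEigenbasis k μ b lam)
    (hlam : ∀ j, 0 < lam j) (hφ : ∀ m, ∀ x ∈ X, φ m x = contRep k μ (lam m) (b m) x)
    (hbN : ∀ N, IsEigenbasis (kN N) (ν N) (bN N) (lamN N)) (hlamN : ∀ N j, 0 < lamN N j)
    {L : ℕ} (hL : 0 < L)
    (hcase : lam L < lam (L - 1) ∨ ∀ l < L, ∀ ε > (0 : ℝ), ∀ᶠ N in atTop, ∀ hl : l < N, ∀ x ∈ X,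
      ‖contRep (kN N) (ν N) (lamN N ⟨l, hl⟩) (bN N ⟨l, hl⟩) x - contRep k μ (lam l) (b l) x‖ < ε)
    (m : Fin L) :
    Tendsto (fun n => ∑ j : Fin L, ‖⟪bN (n + L) (Fin.castLE (Nat.le_add_left L n) j),
      (φ m).toLp 2 (ν (n + L)) ℂ⟫_ℂ‖ ^ 2) atTop (𝓝 1) := by
  have hA := hk.spectralApprox hb hlam hφ hbN
  have h1 : Tendsto (fun N => ∑ j ∈ Finset.range L, ‖coeff bN φ N j m‖ ^ 2) atTop (𝓝 1) := by
    rcases hcase with hgap | hunif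
    · exact hA.tendsto_mass hL hgap m.2
    · exact hA.tendsto_mass_of_diag m.2
        (hk.tendsto_coeff_self hb hlam hφ hbN hlamN (hunif m m.2))
  refine ((tendsto_add_atTop_iff_nat L).2 h1).congr fun n => ?_
  rw [Finset.sum_range]
  refine Finset.sum_congr rfl fun j _ => ?_
  rw [coeff, dif_pos (j.2.trans_le (Nat.le_add_left L n))]
  rfl

theorem KernelConvOn.tendsto_leading (hk : KernelConvOn X ν μ kN k) (hb : IsEigenbasis k μ b lam)
    (hlam : ∀ j, 0 < lam j) (hφ : ∀ m, ∀ x ∈ X, φ m x = contRep k μ (lam m) (b m) x)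
    (hbN : ∀ N, IsEigenbasis (kN N) (ν N) (bN N) (lamN N)) (hgap : lam 1 < lam 0)
    {L : ℕ} (hL : 0 < L) (m : ℕ) :
    Tendsto (fun n => ‖⟪bN (n + L) ⟨0, hL.trans_le (Nat.le_add_left L n)⟩,
      (φ m).toLp 2 (ν (n + L)) ℂ⟫_ℂ‖) atTop (𝓝 (if m = 0 then 1 else 0)) := by
  refine ((tendsto_add_atTop_iff_nat L).2
    ((hk.spectralApprox hb hlam hφ hbN).tendsto_leading hgap m)).congr fun n => ?_
  rw [coeff, dif_pos (hL.trans_le (Nat.le_add_left L n))]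

end Coefficients

section RankOne

variable {K : Type*} [NormedAddCommGroup K] [InnerProductSpace ℂ K]

theorem inner_rankOne (u x y : K) :
    ⟪x, InnerProductSpace.rankOne ℂ u u y⟫_ℂ = ⟪u, y⟫_ℂ * ⟪x, u⟫_ℂ := by
  rw [InnerProductSpace.rankOne_apply, inner_smul_right]

theorem norm_inner_rankOne_le {u : K} (hu : ‖u‖ = 1) (x y : K) :
    ‖⟪x, InnerProductSpace.rankOne ℂ u u y⟫_ℂ‖ ≤ ‖x‖ * ‖y‖ := by
  rw [inner_rankOne, norm_mul, mul_comm]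
  have h1 := norm_inner_le_norm (𝕜 := ℂ) u y
  have h2 := norm_inner_le_norm (𝕜 := ℂ) x u
  rw [hu, one_mul] at h1
  rw [hu, mul_one] at h2
  exact mul_le_mul h2 h1 (norm_nonneg _) (norm_nonneg _)

end RankOne

/-- Only the moduli of the coefficients along `u n` are known to converge, because the phase of
`u n` is arbitrary; this is enough for the matrix elements of the projection onto `u n`. -/
theorem tendsto_inner_rankOne {α : Type*} {l : Filter α} {K : α → Type*}
    [∀ n, NormedAddCommGroup (K n)] [∀ n, InnerProductSpace ℂ (K n)] {u : ∀ n, K n}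
    {v : ∀ n, ℕ → K n}
    (hv : ∀ m, Tendsto (fun n => ‖⟪u n, v n m⟫_ℂ‖) l (𝓝 (if m = 0 then 1 else 0))) (m m' : ℕ) :
    Tendsto (fun n => ⟪v n m, InnerProductSpace.rankOne ℂ (u n) (u n) (v n m')⟫_ℂ) l
      (𝓝 ((if m = 0 then 1 else 0) * (if m' = 0 then 1 else 0))) := by
  simp only [inner_rankOne]
  by_cases h : m = 0 ∧ m' = 0
  · obtain ⟨rfl, rfl⟩ := h
    have h1 := (Complex.continuous_ofReal.tendsto _).comp ((hv 0).pow 2)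
    simp only [if_true, one_pow, mul_one, Complex.ofReal_one] at h1 ⊢
    refine h1.congr fun n => ?_
    rw [Function.comp_apply, ← inner_conj_symm (v n 0) (u n), Complex.mul_conj', Complex.ofReal_pow]
  · have h1 : Tendsto (fun n => ‖⟪u n, v n m'⟫_ℂ‖ * ‖⟪u n, v n m⟫_ℂ‖) l (𝓝 0) := by
      have h2 := (hv m').mul (hv m)
      have h3 : ((if m' = 0 then 1 else 0) * (if m = 0 then 1 else 0) : ℝ) = 0 := by
        by_cases hm : m = 0 <;> by_cases hm' : m' = 0 <;> simp_all
      rwa [h3] at h2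
    have h4 : ((if m = 0 then 1 else 0) * (if m' = 0 then 1 else 0) : ℂ) = 0 := by
      by_cases hm : m = 0 <;> by_cases hm' : m' = 0 <;> simp_all
    rw [h4, tendsto_zero_iff_norm_tendsto_zero]
    refine h1.congr fun n => ?_
    rw [norm_mul, norm_inner_symm (v n m) (u n)]

end QMDA

open QMDA

theorem theorem1
    {M Y : Type*} [MetricSpace M] [MeasurableSpace M] [BorelSpace M] [MetricSpace Y]
    -- the flow, its invariant measure, and the sampling interval
    (Φ : Flow ℝ M) (μ : Measure M) [IsProbabilityMeasure μ]
    (hinv : ∀ t : ℝ, MeasurePreserving (Φ t) μ μ)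
    (Δt : ℝ) (hΔt : 0 < Δt) (herg : Ergodic (Φ Δt) μ)
    (hμ : ∀ z : M, μ ≠ Measure.dirac z)
    -- the observation map of the training data and the assimilated observable
    (F : M → Y) (hF : Continuous F) (hFinj : Function.Injective F)
    (h : M → ℝ) (hh : Continuous h)
    -- the sampled trajectory and the compact set that contains it and the support of the measure
    (x₀ : M) (hx₀ : InBasin Φ Δt μ x₀)
    (X : Set M) (hX : IsCompact X) (hμX : μ Xᶜ = 0) (hxX : ∀ n : ℕ, orbit Φ Δt x₀ n ∈ X)
    -- the data-driven kernels, pulled back from data space, and their uniform limit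
    (p' : ℕ → Y → Y → ℝ) (hp' : ∀ N, 0 < N → IsKernelOn Set.univ (p' N))
    (pN : ℕ → M → M → ℝ) (hpull : ∀ N, 0 < N → ∀ x y, pN N x y = p' N (F x) (F y))
    (hpNpos : ∀ N, 0 < N → KernelStrictlyPositive (pN N) (samplingMeasure (orbit Φ Δt x₀) N))
    (hpNmarkov : ∀ N, 0 < N → KernelMarkov (pN N) (samplingMeasure (orbit Φ Δt x₀) N))
    (hpNerg : ∀ N, 0 < N → KernelErgodic (pN N) (samplingMeasure (orbit Φ Δt x₀) N))
    (p : M → M → ℝ) (hp : IsKernelOn X p)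
    (hppos : KernelStrictlyPositive p μ) (hpmarkov : KernelMarkov p μ) (hperg : KernelErgodic p μ)
    (hconv : TendstoUniformlyOn (fun N (z : M × M) => pN N z.1 z.2) (fun z => p z.1 z.2) atTop
      (X ×ˢ X))
    -- the ordered eigenbases of the kernel integral operators
    (b : HilbertBasis ℕ ℂ (Lp ℂ 2 μ)) (lam : ℕ → ℝ) (hb : IsEigenbasis p μ b lam)
    (bN : ∀ N, HilbertBasis (Fin N) ℂ (Lp ℂ 2 (samplingMeasure (orbit Φ Δt x₀) N)))
    (lamN : ∀ N, Fin N → ℝ)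
    (hbN : ∀ N, IsEigenbasis (pN N) (samplingMeasure (orbit Φ Δt x₀) N) (bN N) (lamN N))
    -- the number of elements of the partition; no boundary point of the true one is an atom
    (S : ℕ) (hS : 0 < S)
    (hbdry : ∀ k, 0 < k → k < S → μ {x | h x = bdry S μ h k} = 0) :
    -- the empirical partitions converge
    (∀ k, 0 < k → k < S →
      Tendsto (fun N => bdry S (samplingMeasure (orbit Φ Δt x₀) N) h k) atTop
        (𝓝 (bdry S μ h k))) ∧
    -- almost every true signal avoids the boundary points at all sampling times
    (∀ᵐ z ∂μ, ∀ m k : ℕ, 0 < k → k < S → h (orbit Φ Δt z m) ≠ bdry S μ h k) ∧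
    -- the measurement probabilities converge, for every spectral resolution `L` at which the
    -- retained subspace is determined by the spectrum or the retained eigenfunctions converge
    (∀ L : ℕ, 0 < L →
      (lam L < lam (L - 1) ∨
        ∀ l < L, ∀ ε > (0 : ℝ), ∀ᶠ N in atTop, ∀ hl : l < N, ∀ x ∈ X,
          ‖contRep (pN N) (samplingMeasure (orbit Φ Δt x₀) N) (lamN N ⟨l, hl⟩) (bN N ⟨l, hl⟩) x
            - contRep p μ (lam l) (b l) x‖ < ε) →
      ∀ (y : ℕ → Option ℝ) (j : ℕ),
        (∀ m < j, ∀ a, y m = some a → ∀ k, 0 < k → k < S → a ≠ bdry S μ h k) →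
        (trueScheme Φ Δt μ hinv hh.measurable S L b).StateDefined y j →
        ∀ i < S,
          Tendsto
            (fun N => (dataScheme (orbit Φ Δt x₀) N hh.measurable S L (bN N)).prob y j i) atTop
            (𝓝 ((trueScheme Φ Δt μ hinv hh.measurable S L b).prob y j i))) := by
  have hk : KernelConvOn X (samplingMeasure (orbit Φ Δt x₀)) μ pN p :=
    { isCompact := hX
      finite := fun N => inferInstance
      prob := inferInstance
      mass_le := samplingMeasure_real_univ_le _
      null := samplingMeasure_null hxX hX.measurableSet
      null_limit := hμX
      tendsto := hx₀
      kernelN := fun N hN => by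
        rw [show pN N = fun z w => p' N (F z) (F w) from funext₂ (hpull N hN)]
        exact (hp' N hN).comp hF X
      kernel := hp
      uniform := hconv }
  have hw : WeakConvOn X (samplingMeasure (orbit Φ Δt x₀)) μ := hk.toWeakConvOn
  obtain ⟨C, hC⟩ := hX.exists_bound_of_continuousOn hh.continuousOn
  have hpart : ∀ k, 0 < k → k < S →
      Tendsto (fun N => bdry S (samplingMeasure (orbit Φ Δt x₀) N) h k) atTop
        (𝓝 (bdry S μ h k)) := fun k hk0 hkS => by
    have hs0 : (0 : ℝ) < k / S := div_pos (by exact_mod_cast hk0) (by exact_mod_cast hS)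
    have hs1 : (k : ℝ) / S < 1 :=
      (div_lt_one (by exact_mod_cast hS)).2 (by exact_mod_cast hkS)
    exact hw.tendsto_quantile hh hs0 fun a => lt_cdfOf_of_quantile_lt hinv herg hh hs0 hs1
      (cdfOf_quantile hμX hC hh.measurable hs0 hs1.le (hbdry k hk0 hkS))
  refine ⟨hpart, ?_, ?_⟩
  · simp only [ae_all_iff]
    intro m k hk0 hkS
    exact (hinv ((m : ℝ) * Δt)).quasiMeasurePreserving.ae
      (measure_eq_zero_iff_ae_notMem.1 (hbdry k hk0 hkS))
  intro L hL hcase y j hy hdef i hi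
  have hlam : ∀ m, 0 < lam m := hppos.eigenvalue_pos hb
  have hlamN : ∀ N m, 0 < lamN N m := fun N m =>
    (hpNpos N m.pos).eigenvalue_pos (hbN N) m
  obtain ⟨φ, hφ⟩ := hk.exists_extension b lam
  obtain ⟨hgap01, c, hc, hconst⟩ := leading_eigenfunction hX hμX hp hpmarkov hperg hb
  -- From `N = L` on, the `L` retained indices are available in `Fin N`.
  refine (tendsto_add_atTop_iff_nat L).1 ?_
  let R : ∀ n, Scheme (Lp ℂ 2 (samplingMeasure (orbit Φ Δt x₀) (n + L))) (Fin (n + L)) := fun n =>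
    dataScheme (orbit Φ Δt x₀) (n + L) hh.measurable S L (bN (n + L))
  let Q := trueScheme Φ Δt μ hinv hh.measurable S L b
  let r : ∀ n, Fin L → Fin (n + L) := fun n => Fin.castLE (Nat.le_add_left L n)
  let v : ∀ n, ℕ → Lp ℂ 2 (samplingMeasure (orbit Φ Δt x₀) (n + L)) := fun n m =>
    (φ m).toLp 2 (samplingMeasure (orbit Φ Δt x₀) (n + L)) ℂ
  have hr : ∀ n, Function.Injective (r n) := fun n => Fin.castLE_injective _
  have hgram : ∀ m m' : Fin L, Tendsto (fun n => ⟪v n m, v n m'⟫_ℂ) atTop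
      (𝓝 (if m = m' then 1 else 0)) := fun m m' => by
    have h1 := (tendsto_add_atTop_iff_nat L).2 (hk.tendsto_gram hb hlam hφ m m')
    simpa only [Fin.ext_iff] using h1
  have hgram1 : ∀ m : Fin L, Tendsto (fun n => ⟪v n m, v n m⟫_ℂ) atTop (𝓝 1) := fun m => by
    simpa using hgram m m
  have hmass : ∀ m : Fin L, Tendsto (fun n => ∑ k, ‖⟪(R n).basis (r n k), v n m⟫_ℂ‖ ^ 2) atTop
      (𝓝 1) := hk.tendsto_mass hb hlam hφ hbN hlamN hL hcase
  have hpos : ∀ n, 0 < n + L := fun n => hL.trans_le (Nat.le_add_left L n)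
  have hlead : ∀ m, Tendsto (fun n => ‖⟪bN (n + L) ⟨0, hpos n⟩, v n m⟫_ℂ‖) atTop
      (𝓝 (if m = 0 then 1 else 0)) := hk.tendsto_leading hb hlam hφ hbN hgap01 hL
  have hbφ : ∀ m, b m = (φ m).toLp 2 μ ℂ := fun m => (hk.toLp_extension hb hlam hφ m).symm
  refine tendsto_prob (Q := Q) (R := R) (e := fun m : Fin L => (m : ℕ)) (r := r)
    (C := fun n => coeffMatrix (R n).basis (r n) fun m => v n m) (S := S)
    ⟨Fin.val_injective, ?_⟩ (fun n => ⟨hr n, ?_⟩)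
    (tendsto_conjTranspose_coeffMatrix_mul hr hgram hmass) ?_ ?_ ?_ (affil_lt hS μ h) ?_ hdef hi
  · intro m
    simp [Q, trueScheme]
  · intro m
    simp only [R, dataScheme, r, Finset.mem_filter, Finset.mem_univ, true_and, Set.mem_range]
    exact ⟨fun hm => ⟨⟨m, hm⟩, rfl⟩, by rintro ⟨k, rfl⟩; exact k.2⟩
  · intro q
    refine gaugeTendsto_of_inner hr hgram1 hmass
      (fun n => norm_inner_shiftOp_le (injOn_of_basis (bN (n + L))) q) fun m m' => ?_
    have h1 := (tendsto_add_atTop_iff_nat L).2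
      (tendsto_inner_shiftOp hinv hx₀ (fun N => injOn_of_basis (bN N)) q (φ m) (φ m'))
    rw [← hbφ, ← hbφ] at h1
    exact h1
  · intro i hi
    refine gaugeTendsto_of_inner hr hgram1 hmass
      (fun n => norm_inner_indicatorOp_le _) fun m m' => ?_
    have h1 := (tendsto_add_atTop_iff_nat L).2
      (hw.tendsto_inner_binProj hh hS hpart hbdry hi (φ m) (φ m'))
    rw [← hbφ, ← hbφ] at h1
    exact h1
  · have hinit : ∀ n, (R n).init = InnerProductSpace.rankOne ℂ (bN (n + L) ⟨0, hpos n⟩)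
        (bN (n + L) ⟨0, hpos n⟩) := fun n => dif_pos (hpos n)
    simp only [hinit]
    refine gaugeTendsto_of_inner hr hgram1 hmass
      (fun n => norm_inner_rankOne_le ((bN (n + L)).orthonormal.1 _)) fun m m' => ?_
    have h1 := tendsto_inner_rankOne hlead m m'
    -- The constant `1` is the leading eigenfunction up to a phase, which cancels in the projection.
    have h2 : Q.mat (fun m : Fin L => (m : ℕ)) Q.init m m' =
        (if (m : ℕ) = 0 then 1 else 0) * (if (m' : ℕ) = 0 then 1 else 0) := by
      change ⟪b m, InnerProductSpace.rankOne ℂ (Lp.const 2 μ (1 : ℂ)) (Lp.const 2 μ (1 : ℂ))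
        (b m')⟫_ℂ = _
      have hcc : (starRingEnd ℂ) c * c = 1 := by
        rw [Complex.conj_mul', hc]
        norm_num
      rw [inner_rankOne, hconst, inner_smul_left, inner_smul_right,
        orthonormal_iff_ite.1 b.orthonormal, orthonormal_iff_ite.1 b.orthonormal,
        mul_mul_mul_comm, hcc, one_mul, mul_comm]
      simp only [eq_comm]
    rw [h2]
    exact h1
  · intro m hm a ha
    exact (tendsto_add_atTop_nat L).eventually
      (eventually_affil_eq hpart (hy m hm a ha))
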